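/- Consider the linear system with $m$ sensors $$x_{k+1}=Ax_k+w_k,\qquad y_k^{(i)}=C^{(i)}x_k+v_k^{(i)},\quad i=1,\dots,m,\ k\ge 0,$$ with $x_k\in\mathbb R^n$, $y_k^{(i)}\in\mathbb R^{s_i}$, $s=\sum_i s_i$ and spectral radius $\rho(A)<1$. The random vectors $x_0\sim\mathcal N(0,\Sigma_0)$, $w_k\sim\mathcal N(0,Q)$, $v_k=[v_k^{(1)\prime},\dots,v_k^{(m)\prime}]'\sim\mathcal N(0,R)$ and the random variables $\zeta_k^{(i)}$, uniform on $[0,1]$ ($k\ge0$, $1\le i\le m$), are mutually independent, and $\Sigma_0,Q,R$ are positive definite. Let $Y^{(i)}\in\mathbb R^{s_i\times s_i}$ be positive definite, $Y=\operatorname{diag}(Y^{(1)},\dots,Y^{(m)})$ and $C=[C^{(1)\prime},\dots,C^{(m)\prime}]'$. At time $k$ sensor $i$ transmits $y_k^{(i)}$ to a remote estimator ($\gamma_k^{(i)}=1$) if $\zeta_k^{(i)}>\exp\left(-\tfrac12 y_k^{(i)\prime}Y^{(i)}y_k^{(i)}\right)$, and otherwise it does not transmit ($\gamma_k^{(i)}=0$).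 Let $\mathcal I_k$ be the information given by $\gamma_j^{(i)}$ for $j\le k$, $1\le i\le m$, and by the measurements transmitted at times $0,\dots,k$, and let $$\hat x_k=\mathbb E[x_k\mid\mathcal I_k],\qquad P_k=\mathbb E[(x_k-\hat x_k)(x_k-\hat x_k)'\mid\mathcal I_k].$$ Then the equation $$X=AXA'+Q-AXC'(CXC'+R+Y^{-1})^{-1}CXA'$$ has a unique positive semidefinite solution $\overline X$, and $\overline X$ is positive definite. Put $$\overline P=\overline X-\overline XC'(C\overline XC'+R+Y^{-1})^{-1}C\overline X.$$ With $\le$ the Loewner order on symmetric matrices, the following hold. 1. For every $\epsilon>0$ there is a deterministic $N$ such that, almost surely, $P_k\le\overline P+\epsilon I$ for all $k\ge N$. 2. For every $\epsilon>0$, almost surely, $P_k\ge\overline P-\epsilon I$ for infinitely many $k$. -/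

import Mathlib

open MeasureTheory ProbabilityTheory Filter
open scoped Matrix MatrixOrder ENNReal

noncomputable section

namespace EventTrigger

/-- The matrix `C = [C⁽¹⁾' ⋯ C⁽ᵐ⁾']'` obtained by stacking the sensor matrices. Its rows are indexed
by pairs (sensor, component of that sensor's measurement). -/
def stack {n m : ℕ} {s : Fin m → ℕ} (C : (i : Fin m) → Matrix (Fin (s i)) (Fin n) ℝ) :
    Matrix ((i : Fin m) × Fin (s i)) (Fin n) ℝ :=
  Matrix.of fun p => C p.1 p.2

/-- A real square matrix is stable if its spectral radius (the largest modulus of a complex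
eigenvalue) is less than one. -/
def SchurStable {n : ℕ} (A : Matrix (Fin n) (Fin n) ℝ) : Prop :=
  spectralRadius ℂ (A.map (algebraMap ℝ ℂ)) < 1

/-- The measurement update of the error covariance for measurement noise covariance `W`:
`X - X C' (C X C' + W)⁻¹ C X`. -/
def measUpdate {n : ℕ} {σ : Type*} [Fintype σ] [DecidableEq σ]
    (C : Matrix σ (Fin n) ℝ) (W : Matrix σ σ ℝ) (X : Matrix (Fin n) (Fin n) ℝ) :
    Matrix (Fin n) (Fin n) ℝ :=
  X - X * Cᵀ * (C * X * Cᵀ + W)⁻¹ * C * X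

/-- The Riccati operator
`g_W(X) = A X A' + Q - A X C' (C X C' + W)⁻¹ C X A'`. -/
def riccati {n : ℕ} {σ : Type*} [Fintype σ] [DecidableEq σ]
    (A : Matrix (Fin n) (Fin n) ℝ) (C : Matrix σ (Fin n) ℝ)
    (Q : Matrix (Fin n) (Fin n) ℝ) (W : Matrix σ σ ℝ) (X : Matrix (Fin n) (Fin n) ℝ) :
    Matrix (Fin n) (Fin n) ℝ :=
  A * X * Aᵀ + Q - A * X * Cᵀ * (C * X * Cᵀ + W)⁻¹ * C * X * Aᵀ

section Dynamics

variable {Ω : Type*} {n m : ℕ} {s : Fin m → ℕ}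

/-- The state process `x₀, x₁, …` with `x_{k+1} = A x_k + w_k`. -/
def state (A : Matrix (Fin n) (Fin n) ℝ) (x₀ : Ω → EuclideanSpace ℝ (Fin n))
    (w : ℕ → Ω → EuclideanSpace ℝ (Fin n)) : ℕ → Ω → EuclideanSpace ℝ (Fin n)
  | 0 => x₀
  | k + 1 => fun ω => WithLp.toLp 2 (A *ᵥ (state A x₀ w k ω).ofLp) + w k ω

/-- The measurement `y_k⁽ⁱ⁾ = C⁽ⁱ⁾ x_k + v_k⁽ⁱ⁾` of sensor `i` at time `k`, where `v_k⁽ⁱ⁾` is the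
`i`-th block of the stacked measurement noise `v_k`. -/
def meas (C : (i : Fin m) → Matrix (Fin (s i)) (Fin n) ℝ)
    (x : ℕ → Ω → EuclideanSpace ℝ (Fin n))
    (v : ℕ → Ω → EuclideanSpace ℝ ((i : Fin m) × Fin (s i)))
    (k : ℕ) (i : Fin m) (ω : Ω) : Fin (s i) → ℝ :=
  C i *ᵥ (x k ω).ofLp + fun a => v k ω ⟨i, a⟩

/-- The probability `φ(α) = exp(-α' Y α / 2)` of not transmitting the measurement `α`. -/
def dropProb {d : ℕ} (Y : Matrix (Fin d) (Fin d) ℝ) (α : Fin d → ℝ) : ℝ :=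
  Real.exp (-(1 / 2) * (α ⬝ᵥ (Y *ᵥ α)))

/-- The decision variable `γ_k⁽ⁱ⁾ ∈ {0, 1}`: sensor `i` is silent at time `k` (value `0`) if
`ζ_k⁽ⁱ⁾ ≤ φ⁽ⁱ⁾(y_k⁽ⁱ⁾)`, and it transmits (value `1`) otherwise. -/
def decision (Y : (i : Fin m) → Matrix (Fin (s i)) (Fin (s i)) ℝ)
    (y : ℕ → (i : Fin m) → Ω → Fin (s i) → ℝ) (ζ : ℕ → Fin m → Ω → ℝ)
    (k : ℕ) (i : Fin m) (ω : Ω) : ℝ :=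
  if ζ k i ω ≤ dropProb (Y i) (y k i ω) then 0 else 1

/-- The σ-algebra generated by the information `γ_0, …, γ_k` and the measurements received at
times `0, …, k`. A measurement that is not transmitted is replaced by `0`; since the decision
variables are known, this carries exactly the information of the list of received measurements. -/
@[reducible] def info (γ : ℕ → Fin m → Ω → ℝ) (y : ℕ → (i : Fin m) → Ω → Fin (s i) → ℝ) (k : ℕ) :
    MeasurableSpace Ω :=
  ⨆ (j : ℕ) (_ : j ≤ k) (i : Fin m),
    MeasurableSpace.comap (γ j i) inferInstance ⊔
      MeasurableSpace.comap (fun ω => γ j i ω • y j i ω) inferInstance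

/-- The conditional error covariance `E[(X - X̂)(X - X̂)' | 𝓘]` of a random vector `X`, where
`X̂ = E[X | 𝓘]`. -/
def condErrCov {mΩ : MeasurableSpace Ω} (μ : Measure Ω) (I : MeasurableSpace Ω)
    (X : Ω → EuclideanSpace ℝ (Fin n)) (ω : Ω) : Matrix (Fin n) (Fin n) ℝ :=
  Matrix.of fun a b =>
    (μ[fun ω' => (X ω' - (μ[X | I]) ω') a * (X ω' - (μ[X | I]) ω') b | I]) ω

/-- The error covariance `P_k = E[(x_k - x̂_k)(x_k - x̂_k)' | 𝓘_k]`, `x̂_k = E[x_k | 𝓘_k]`, of the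
remote estimator that receives the measurements selected by the event-based triggers. -/
def errCov {mΩ : MeasurableSpace Ω} (μ : Measure Ω)
    (A : Matrix (Fin n) (Fin n) ℝ) (C : (i : Fin m) → Matrix (Fin (s i)) (Fin n) ℝ)
    (Y : (i : Fin m) → Matrix (Fin (s i)) (Fin (s i)) ℝ)
    (x₀ : Ω → EuclideanSpace ℝ (Fin n)) (w : ℕ → Ω → EuclideanSpace ℝ (Fin n))
    (v : ℕ → Ω → EuclideanSpace ℝ ((i : Fin m) × Fin (s i))) (ζ : ℕ → Fin m → Ω → ℝ)
    (k : ℕ) : Ω → Matrix (Fin n) (Fin n) ℝ :=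
  let x := state A x₀ w
  let y := meas C x v
  condErrCov μ (info (decision Y y ζ) y k) (x k)

/-- Labels of the primitive random variables: the initial state, the process noises `w_k`, the
measurement noises `v_k`, and the trigger variables `ζ_k⁽ⁱ⁾`. -/
inductive Source (m : ℕ) : Type
  | init : Source m
  | process (k : ℕ) : Source m
  | measurement (k : ℕ) : Source m
  | trigger (k : ℕ) (i : Fin m) : Source m

/-- The σ-algebra generated by each primitive random variable. -/
@[reducible] def sourceSigma (x₀ : Ω → EuclideanSpace ℝ (Fin n)) (w : ℕ → Ω → EuclideanSpace ℝ (Fin n))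
    (v : ℕ → Ω → EuclideanSpace ℝ ((i : Fin m) × Fin (s i))) (ζ : ℕ → Fin m → Ω → ℝ) :
    Source m → MeasurableSpace Ω
  | .init => MeasurableSpace.comap x₀ inferInstance
  | .process k => MeasurableSpace.comap (w k) inferInstance
  | .measurement k => MeasurableSpace.comap (v k) inferInstance
  | .trigger k i => MeasurableSpace.comap (ζ k i) inferInstance

end Dynamics

end EventTrigger

end

/-! The error covariance depends on the data only through the pattern of silences. Fix a pattern up
to time `k`. Once the uniform trigger variables are averaged out, its likelihood given the
measurements is a product: `exp (-y'Yy / 2)` for every silent measurement and `1 - exp (-y'Yy / 2)`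
for every transmitted one. The second kind of factor is a function of the received data. The first
kind is a Gaussian weight, so tilting by it keeps state and measurements jointly Gaussian, with the
same effect on variances as observing the silent measurement through additional noise of covariance
`Y⁻¹`. Under the tilted law the best linear estimator based on the transmitted measurements has an
error uncorrelated with them, hence independent of them. The conditional covariance is therefore
deterministic on each pattern and follows the Kalman recursion `patternCov`; this is
`NoiseModel.errCov_eq`.

The analysis of the Riccati operator rests on a variational formula: the quadratic form of
`measUpdate` is a minimum over gains (`quad_measUpdate_add`). Monotonicity and subhomogeneity follow
by inserting the optimal gain of one problem into another. Iteration from `0` increases and is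
bounded because `A` is stable; its limit dominates `Q`. Since conversely `Q` dominates a multiple of
the limit, upper bounds `(1 + a) • X` contract, so every positive semidefinite start is attracted
(`exists_riccati_fixedPoint`), which also gives uniqueness.

Silence of all sensors is the worst case, so `patternCov` lies below the updated Riccati iterates
from `Sigma0` (`patternCov_le`); this gives the first bound with a deterministic time. After `N + 1`
consecutive silent times it lies above the update of the `N`-th iterate from `0` (`le_patternCov`).
Such windows recur almost surely (`NoiseModel.ae_exists_silent_window`): second moments of the
measurements are bounded uniformly in time, so in each window the measurements stay below a fixed
level with probability near one, while the independent event that all triggers of a window fall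
below a matching threshold recurs by Borel–Cantelli. -/

noncomputable section

namespace EventTrigger

/-! ### Gaussian families and quadratic exponential tilts -/

section GaussianFamily

variable {Ω V : Type*} [MeasurableSpace Ω] [AddCommGroup V] [Module ℝ V]

/-- A linear family of centered Gaussian random variables, with variances given by `q`. -/
structure GaussianFamily (L : V →ₗ[ℝ] Ω → ℝ) (q : V → ℝ) (μ : Measure Ω) : Prop where
  measurable : ∀ t, Measurable (L t)
  nonneg : ∀ t, 0 ≤ q t
  map_eq : ∀ t, μ.map (L t) = gaussianReal 0 (q t).toNNReal

variable {L : V →ₗ[ℝ] Ω → ℝ} {q : V → ℝ} {μ : Measure Ω}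

namespace GaussianFamily

lemma hasGaussianLaw (h : GaussianFamily L q μ) (t : V) : HasGaussianLaw (L t) μ :=
  ⟨by rw [h.map_eq]; infer_instance⟩

lemma isProbabilityMeasure (h : GaussianFamily L q μ) : IsProbabilityMeasure μ :=
  (h.hasGaussianLaw 0).isProbabilityMeasure

lemma memLp_two (h : GaussianFamily L q μ) (t : V) : MemLp (L t) 2 μ :=
  (h.hasGaussianLaw t).memLp_two

lemma integrable (h : GaussianFamily L q μ) (t : V) : Integrable (L t) μ :=
  (h.hasGaussianLaw t).integrable

lemma integral_eq_zero (h : GaussianFamily L q μ) (t : V) : ∫ ω, L t ω ∂μ = 0 := by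
  have := integral_map (μ := μ) (h.measurable t).aemeasurable
    (f := fun x : ℝ => x) (by fun_prop)
  rw [← this, h.map_eq]
  exact integral_id_gaussianReal

lemma variance_eq (h : GaussianFamily L q μ) (t : V) : Var[L t; μ] = q t := by
  have := variance_map (μ := μ) (X := fun x : ℝ => x) (Y := L t)
    (by fun_prop) (h.measurable t).aemeasurable
  rw [h.map_eq, variance_fun_id_gaussianReal, Real.coe_toNNReal _ (h.nonneg t)] at this
  exact this.symm

lemma covariance_eq_integral (h : GaussianFamily L q μ) (s t : V) :
    cov[L s, L t; μ] = ∫ ω, L s ω * L t ω ∂μ := by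
  have := h.isProbabilityMeasure
  rw [covariance_eq_sub (h.memLp_two s) (h.memLp_two t), h.integral_eq_zero]
  simp

lemma q_add_smul (h : GaussianFamily L q μ) (s t : V) (a : ℝ) :
    q (s + a • t) = q s + 2 * a * cov[L s, L t; μ] + a ^ 2 * q t := by
  have := h.isProbabilityMeasure
  rw [← h.variance_eq, map_add, map_smul,
    variance_add (h.memLp_two s) ((h.memLp_two t).const_smul a), variance_smul,
    covariance_smul_right, h.variance_eq, h.variance_eq]
  ring

lemma covariance_add_smul_left (h : GaussianFamily L q μ) (s t r : V) (a : ℝ) :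
    cov[L (s + a • t), L r; μ] = cov[L s, L r; μ] + a * cov[L t, L r; μ] := by
  have := h.isProbabilityMeasure
  rw [map_add, map_smul, covariance_add_left (h.memLp_two s) ((h.memLp_two t).const_smul a)
    (h.memLp_two r), covariance_smul_left]

/-- Discriminant of the nonnegative quadratic `a ↦ q (s + a • t)`. It serves the degenerate case `q
c = 0` of `tilted_sq`. -/
lemma covariance_sq_le (h : GaussianFamily L q μ) (s t : V) :
    cov[L s, L t; μ] ^ 2 ≤ q s * q t := by
  have h1 : ∀ a : ℝ, 0 ≤ q t * (a * a) + (2 * cov[L s, L t; μ]) * a + q s := fun a => by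
    have := h.nonneg (s + a • t)
    rw [h.q_add_smul] at this
    nlinarith
  have := discrim_le_zero h1
  simp only [discrim] at this
  nlinarith

/-- Finitely many members of a Gaussian family are jointly Gaussian. -/
lemma hasGaussianLaw_pi (h : GaussianFamily L q μ) {ι : Type*} [Finite ι] (z : ι → V) :
    HasGaussianLaw (fun ω i => L (z i) ω) μ := by
  cases nonempty_fintype ι
  classical
  have hm : Measurable (fun ω i => L (z i) ω) := measurable_pi_lambda _ fun i => h.measurable _
  -- Cramér–Wold: a linear functional of the vector is `L` at a single element of `V`, hence
  -- Gaussian by assumption.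
  refine ⟨isGaussian_of_map_eq_gaussianReal fun D => ⟨0, (q (∑ i, D (Pi.single i 1) • z i)).toNNReal, ?_⟩⟩
  rw [Measure.map_map (by fun_prop) hm, ← h.map_eq]
  congr 1
  ext ω
  simp only [Function.comp_apply, map_sum, map_smul, Finset.sum_apply, Pi.smul_apply, smul_eq_mul]
  conv_lhs => rw [← Finset.univ_sum_single (fun i => L (z i) ω)]
  rw [map_sum]
  refine Finset.sum_congr rfl fun i _ => ?_
  rw [mul_comm, ← smul_eq_mul, ← map_smul]
  congr 1
  ext j
  by_cases hj : j = i
  · subst hj; simp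
  · simp [hj]

/-- Uncorrelated members of a Gaussian family are independent. -/
lemma indepFun_pi (h : GaussianFamily L q μ) {ι κ : Type*} [Finite ι] [Finite κ] (z : ι → V)
    (y : κ → V) (hzy : ∀ i j, cov[L (z i), L (y j); μ] = 0) :
    IndepFun (fun ω i => L (z i) ω) (fun ω j => L (y j) ω) μ := by
  cases nonempty_fintype ι
  cases nonempty_fintype κ
  -- Uncorrelated implies independent only under joint normality, so both families are first merged
  -- into one.
  have h1 := h.hasGaussianLaw_pi (Sum.elim z y)
  let D : (ι ⊕ κ → ℝ) →L[ℝ] (ι → ℝ) × (κ → ℝ) :=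
    (ContinuousLinearMap.pi fun i => ContinuousLinearMap.proj (Sum.inl i)).prod
      (ContinuousLinearMap.pi fun i => ContinuousLinearMap.proj (Sum.inr i))
  exact HasGaussianLaw.indepFun_of_covariance_eval (h1.map D) hzy

lemma indepFun (h : GaussianFamily L q μ) (s t : V) (hst : cov[L s, L t; μ] = 0) :
    IndepFun (L s) (L t) μ :=
  (h.indepFun_pi (fun _ : Unit => s) (fun _ : Unit => t) fun _ _ => hst).comp
    (measurable_pi_apply ()) (measurable_pi_apply ())

lemma charFun_eq (h : GaussianFamily L q μ) (t : V) (u : ℝ) :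
    ∫ ω, Complex.exp (u * L t ω * Complex.I) ∂μ = Complex.exp (-(q t * u ^ 2 / 2)) := by
  have h2 := charFun_gaussianReal (μ := 0) (v := (q t).toNNReal) u
  rw [← h.map_eq, charFun_apply_real, integral_map (h.measurable t).aemeasurable (by fun_prop)] at h2
  rw [h2, Real.coe_toNNReal _ (h.nonneg t)]
  congr 1
  push_cast
  ring

end GaussianFamily

/-- Weighting a centered Gaussian law with `exp (-x² / 2)` gives, up to a constant, the centered
Gaussian law of variance `v / (1 + v)`. -/
lemma integral_exp_neg_sq_mul_gaussianReal (v : NNReal) (f : ℝ → ℂ) :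
    ∫ x, Real.exp (-(x ^ 2) / 2) * f x ∂(gaussianReal 0 v)
      = (√(1 + v))⁻¹ * ∫ x, f x ∂(gaussianReal 0 (v / (1 + v))) := by
  by_cases hv : v = 0
  · subst hv
    simp
  have hv0 : (0 : ℝ) < v := by positivity
  have hv' : v / (1 + v) ≠ 0 := by positivity
  rw [integral_gaussianReal_eq_integral_smul hv, integral_gaussianReal_eq_integral_smul hv',
    ← integral_const_mul]
  congr 1
  ext x
  -- The precisions add, `1 / v + 1 = (1 + v) / v`; the constant compares the two normalisations.
  have key : gaussianPDFReal 0 v x * Real.exp (-(x ^ 2) / 2)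
      = (√(1 + v))⁻¹ * gaussianPDFReal 0 (v / (1 + v)) x := by
    simp only [gaussianPDFReal, sub_zero, NNReal.coe_div, NNReal.coe_add, NNReal.coe_one]
    rw [mul_assoc, ← Real.exp_add, ← mul_assoc]
    congr 1
    · rw [← mul_inv, ← Real.sqrt_mul (by positivity)]
      congr 2
      field_simp
    · congr 1
      field_simp
      ring
  simp only [Complex.real_smul]
  rw [← mul_assoc, ← mul_assoc]
  congr 1
  exact_mod_cast key

lemma integrable_exp_neg_half {μ : Measure Ω} [IsFiniteMeasure μ] {f : Ω → ℝ} (hf : Measurable f)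
    (h0 : ∀ ω, 0 ≤ f ω) : Integrable (fun ω => Real.exp (-(f ω) / 2)) μ := by
  refine Integrable.of_bound (C := 1) (by fun_prop) (ae_of_all _ fun ω => ?_)
  rw [Real.norm_eq_abs, abs_of_pos (Real.exp_pos _), Real.exp_le_one_iff]
  linarith [h0 ω]

namespace GaussianFamily

/-- Tilting by `exp (-ξ² / 2)`, `ξ = L c`, has the effect on variances of observing `ξ` with
an independent standard Gaussian error. -/
lemma tilted_sq (h : GaussianFamily L q μ) (c : V) :
    ∃ q' : V → ℝ, GaussianFamily L q' (μ.tilted fun ω => -(L c ω) ^ 2 / 2) ∧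
      ∀ t, (∀ s : ℝ, q' t ≤ q (t + s • c) + s ^ 2) ∧ ∃ s : ℝ, q' t = q (t + s • c) + s ^ 2 := by
  have := h.isProbabilityMeasure
  set v := q c with hv
  have hv0 : 0 ≤ v := h.nonneg c
  have hint : Integrable (fun ω => Real.exp (-(L c ω) ^ 2 / 2)) μ :=
    integrable_exp_neg_half ((h.measurable c).pow_const 2) fun ω => sq_nonneg _
  have hν : IsProbabilityMeasure (μ.tilted fun ω => -(L c ω) ^ 2 / 2) :=
    isProbabilityMeasure_tilted hint
  -- the regression coefficient of `L t` on `L c`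
  set a : V → ℝ := fun t => cov[L t, L c; μ] / v with ha
  have hcov : ∀ t, cov[L (t + (-a t) • c), L c; μ] = 0 := fun t => by
    rw [h.covariance_add_smul_left, covariance_self (h.measurable c).aemeasurable, h.variance_eq,
      ← hv]
    -- For `v = 0` the coefficient is irrelevant: the covariance already vanishes by Cauchy–Schwarz.
    by_cases hv1 : v = 0
    · have := h.covariance_sq_le t c
      rw [← hv, hv1, mul_zero] at this
      rw [hv1, mul_zero, add_zero]
      exact pow_eq_zero_iff (two_ne_zero) |>.1 (le_antisymm this (sq_nonneg _))
    · simp only [ha]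
      field_simp
      ring
  -- Pythagoras: the residual `t + (-a t) • c` is uncorrelated with `c`.
  have hq : ∀ t s, q (t + s • c) = q (t + (-a t) • c) + (a t + s) ^ 2 * v := fun t s => by
    have h1 : t + s • c = (t + (-a t) • c) + (a t + s) • c := by module
    conv_lhs => rw [h1, h.q_add_smul, hcov]
    ring
  -- The weight involves only `L c`, so the independent residual keeps its variance while the
  -- variance `v` of `L c` shrinks to `v / (1 + v)`. The witness for `s` minimises `(a t + s) ^ 2 *
  -- v + s ^ 2`.
  refine ⟨fun t => q (t + (-a t) • c) + a t ^ 2 * (v / (1 + v)), ⟨h.measurable, fun t => ?_,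
    fun t => ?_⟩, fun t => ⟨fun s => ?_, -(a t * v / (1 + v)), ?_⟩⟩
  · have := h.nonneg (t + (-a t) • c)
    positivity
  · have hq0 : 0 ≤ q (t + (-a t) • c) + a t ^ 2 * (v / (1 + v)) := by
      have := h.nonneg (t + (-a t) • c)
      positivity
    have hpr : IsProbabilityMeasure ((μ.tilted fun ω => -(L c ω) ^ 2 / 2).map (L t)) :=
      Measure.isProbabilityMeasure_map (h.measurable t).aemeasurable
    have hind := h.indepFun _ _ (hcov t)
    -- weighted characteristic function
    have key : ∀ u : ℝ, ∫ ω, (Real.exp (-(L c ω) ^ 2 / 2) : ℂ) * Complex.exp (u * L t ω * Complex.I) ∂μ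
        = (√(1 + v))⁻¹ *
          Complex.exp (-((q (t + (-a t) • c) + a t ^ 2 * (v / (1 + v)) : ℝ) * u ^ 2 / 2)) := fun u => by
      have e1 : ∀ ω, (Real.exp (-(L c ω) ^ 2 / 2) : ℂ) * Complex.exp (u * L t ω * Complex.I)
          = Complex.exp (u * (L (t + (-a t) • c) ω : ℝ) * Complex.I) *
            ((Real.exp (-(L c ω) ^ 2 / 2) : ℂ) * Complex.exp ((u * a t : ℝ) * L c ω * Complex.I)) := by
        intro ω
        have : (L t ω : ℝ) = L (t + (-a t) • c) ω + a t * L c ω := by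
          simp
        rw [this, mul_left_comm, ← Complex.exp_add]
        congr 2
        push_cast
        ring
      simp_rw [e1]
      have h2 := hind.integral_fun_comp_mul_comp (𝕜 := ℂ)
        (f := fun x : ℝ => Complex.exp (u * x * Complex.I))
        (g := fun x : ℝ => (Real.exp (-x ^ 2 / 2) : ℂ) * Complex.exp ((u * a t : ℝ) * x * Complex.I))
        (h.measurable _).aemeasurable (h.measurable _).aemeasurable
        (by fun_prop) (by fun_prop)
      rw [h2, h.charFun_eq]
      have h3 := integral_map (μ := μ) (h.measurable c).aemeasurable
        (f := fun x : ℝ => (Real.exp (-x ^ 2 / 2) : ℂ) * Complex.exp ((u * a t : ℝ) * x * Complex.I))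
        (by fun_prop)
      rw [← h3, h.map_eq, integral_exp_neg_sq_mul_gaussianReal]
      have h4 := charFun_gaussianReal (μ := 0) (v := v.toNNReal / (1 + v.toNNReal)) (u * a t)
      rw [charFun_apply_real] at h4
      rw [h4]
      simp only [NNReal.coe_div, NNReal.coe_add, NNReal.coe_one, Real.coe_toNNReal _ hv0]
      rw [mul_left_comm, ← Complex.exp_add, ← hv, Real.coe_toNNReal _ hv0]
      congr 2
      push_cast
      ring
    refine Measure.ext_of_charFun ?_
    ext u
    rw [charFun_gaussianReal, charFun_apply_real,
      integral_map (h.measurable t).aemeasurable (by fun_prop), integral_tilted,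
      Real.coe_toNNReal _ hq0]
    -- At `u = 0` the identity gives the normalising constant of the tilt.
    have hZ := key 0
    simp only [Complex.ofReal_zero, zero_mul, Complex.exp_zero, mul_one] at hZ
    norm_num at hZ
    have hZ' : ∫ ω, Real.exp (-(L c ω) ^ 2 / 2) ∂μ = (√(1 + v))⁻¹ := by
      apply Complex.ofReal_injective
      rw [← integral_complex_ofReal]
      simpa using hZ
    rw [hZ']
    have e2 : ∀ ω, (Real.exp (-(L c ω) ^ 2 / 2) / (√(1 + v))⁻¹) • Complex.exp (u * L t ω * Complex.I)
        = (√(1 + v) : ℂ) *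
          ((Real.exp (-(L c ω) ^ 2 / 2) : ℂ) * Complex.exp (u * L t ω * Complex.I)) := fun ω => by
      rw [Complex.real_smul]
      push_cast
      rw [div_inv_eq_mul]
      ring
    simp_rw [e2]
    rw [integral_const_mul, key u, ← mul_assoc]
    have h5 : (√(1 + v) : ℂ) * ((√(1 + v))⁻¹ : ℝ) = 1 := by
      have : √(1 + v) ≠ 0 := by positivity
      rw [← Complex.ofReal_mul, mul_inv_cancel₀ this, Complex.ofReal_one]
    rw [h5, one_mul]
    congr 1
    push_cast
    ring
  · rw [hq t s]
    have : a t ^ 2 * (v / (1 + v)) ≤ (a t + s) ^ 2 * v + s ^ 2 := by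
      rw [← mul_div_assoc, div_le_iff₀ (by positivity)]
      nlinarith [sq_nonneg (a t * v + s * (1 + v))]
    linarith
  · rw [hq t]
    have h1v : (1 + v) ≠ 0 := by positivity
    field_simp
    ring

/-- Tilting by `exp (-∑ ξᵢ² / 2)` with `ξᵢ = L (c i)`. -/
lemma tilted_sum_sq {ι : Type*} [DecidableEq ι] (h : GaussianFamily L q μ) (c : ι → V) (F : Finset ι) :
    ∃ q' : V → ℝ, GaussianFamily L q' (μ.tilted fun ω => -(∑ i ∈ F, (L (c i) ω) ^ 2) / 2) ∧
      ∀ t, (∀ s : ι → ℝ, q' t ≤ q (t + ∑ i ∈ F, s i • c i) + ∑ i ∈ F, s i ^ 2) ∧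
        ∃ s : ι → ℝ, q' t = q (t + ∑ i ∈ F, s i • c i) + ∑ i ∈ F, s i ^ 2 := by
  have := h.isProbabilityMeasure
  induction F using Finset.induction_on with
  | empty =>
    refine ⟨q, ?_, fun t => ?_⟩
    · simpa using h
    · simp
  | insert i F hi ih =>
    obtain ⟨q₁, hq₁, hmin₁⟩ := ih
    obtain ⟨q₂, hq₂, hmin₂⟩ := hq₁.tilted_sq (c i)
    refine ⟨q₂, ?_, fun t => ⟨fun s => ?_, ?_⟩⟩
    · rw [tilted_tilted] at hq₂
      · convert hq₂ using 2
        ext ω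
        rw [Finset.sum_insert hi]
        simp only [Pi.add_apply]
        ring
      · exact integrable_exp_neg_half
          (Finset.measurable_sum _ fun j _ => (h.measurable (c j)).pow_const 2)
          fun ω => Finset.sum_nonneg fun j _ => sq_nonneg _
    · rw [Finset.sum_insert hi, Finset.sum_insert hi]
      have h1 := (hmin₂ t).1 (s i)
      have h2 := (hmin₁ (t + s i • c i)).1 s
      rw [add_assoc] at h2
      linarith
    · obtain ⟨a, ha⟩ := (hmin₂ t).2
      obtain ⟨s, hs⟩ := (hmin₁ (t + a • c i)).2
      -- The two successive minimisers form one joint minimiser; `i ∉ F` keeps the sums over `F`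
      -- unchanged.
      refine ⟨Function.update s i a, ?_⟩
      have e1 : ∑ j ∈ F, Function.update s i a j • c j = ∑ j ∈ F, s j • c j :=
        Finset.sum_congr rfl fun j hj => by
          rw [Function.update_of_ne (ne_of_mem_of_not_mem hj hi)]
      have e2 : ∑ j ∈ F, Function.update s i a j ^ 2 = ∑ j ∈ F, s j ^ 2 :=
        Finset.sum_congr rfl fun j hj => by
          rw [Function.update_of_ne (ne_of_mem_of_not_mem hj hi)]
      rw [Finset.sum_insert hi, Finset.sum_insert hi, e1, e2, ha, hs, Function.update_self,
        add_assoc t]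
      ring

/-- First-order optimality: at a minimum of `a ↦ q (z + a • y)` the linear coefficient vanishes.
Together with `indepFun_pi` this turns minimal variance into independence. -/
lemma covariance_eq_zero_of_min (h : GaussianFamily L q μ) (z y : V)
    (hmin : ∀ a : ℝ, q z ≤ q (z + a • y)) : cov[L z, L y; μ] = 0 := by
  set b := cov[L z, L y; μ] with hb
  have h1 : ∀ a : ℝ, 0 ≤ q y * (a * a) + (2 * b) * a + 0 := fun a => by
    have := hmin a
    rw [h.q_add_smul] at this
    nlinarith
  have := discrim_le_zero h1
  simp only [discrim] at this
  nlinarith [sq_nonneg b]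

end GaussianFamily

end GaussianFamily

/-! ### Quadratic forms and the Loewner order -/

section QuadraticForm

variable {ι κ : Type*} [Fintype ι] [Fintype κ]

/-- The quadratic form `t' M t`. -/
def quad (M : Matrix ι ι ℝ) (t : ι → ℝ) : ℝ := t ⬝ᵥ (M *ᵥ t)

@[simp] lemma quad_zero_left (t : ι → ℝ) : quad (0 : Matrix ι ι ℝ) t = 0 := by simp [quad]

@[simp] lemma quad_zero_right (M : Matrix ι ι ℝ) : quad M 0 = 0 := by simp [quad]

lemma quad_add_left (M N : Matrix ι ι ℝ) (t : ι → ℝ) : quad (M + N) t = quad M t + quad N t := by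
  simp [quad, Matrix.add_mulVec]

lemma quad_sub_left (M N : Matrix ι ι ℝ) (t : ι → ℝ) : quad (M - N) t = quad M t - quad N t := by
  simp [quad, Matrix.sub_mulVec]

lemma quad_smul_left (c : ℝ) (M : Matrix ι ι ℝ) (t : ι → ℝ) : quad (c • M) t = c * quad M t := by
  simp [quad, Matrix.smul_mulVec]

lemma quad_neg_right (M : Matrix ι ι ℝ) (t : ι → ℝ) : quad M (-t) = quad M t := by
  simp [quad, Matrix.mulVec_neg]

lemma quad_one [DecidableEq ι] (t : ι → ℝ) : quad (1 : Matrix ι ι ℝ) t = ∑ i, t i ^ 2 := by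
  simp [quad, dotProduct, sq]

lemma quad_conj (B : Matrix ι κ ℝ) (M : Matrix κ κ ℝ) (t : ι → ℝ) :
    quad (B * M * Bᵀ) t = quad M (Bᵀ *ᵥ t) := by
  simp only [quad, ← Matrix.mulVec_mulVec]
  rw [Matrix.dotProduct_mulVec t B, ← Matrix.mulVec_transpose]

lemma dotProduct_mulVec_comm {M : Matrix ι ι ℝ} (hM : Mᵀ = M) (s t : ι → ℝ) :
    s ⬝ᵥ (M *ᵥ t) = t ⬝ᵥ (M *ᵥ s) := by
  rw [Matrix.dotProduct_mulVec, dotProduct_comm, ← Matrix.mulVec_transpose, hM]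

lemma quad_add_right {M : Matrix ι ι ℝ} (hM : Mᵀ = M) (s t : ι → ℝ) :
    quad M (s + t) = quad M s + 2 * (s ⬝ᵥ (M *ᵥ t)) + quad M t := by
  simp only [quad, Matrix.mulVec_add, dotProduct_add, add_dotProduct]
  rw [dotProduct_mulVec_comm hM t s]
  ring

/-- Polarisation. Symmetric matrices are handled through their quadratic forms; this recovers
entries when limits are taken. -/
lemma apply_eq_quad [DecidableEq ι] {M : Matrix ι ι ℝ} (hM : Mᵀ = M) (a b : ι) :
    M a b = (quad M (Pi.single a 1 + Pi.single b 1) - quad M (Pi.single a 1)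
      - quad M (Pi.single b 1)) / 2 := by
  rw [quad_add_right hM]
  simp only [Matrix.mulVec_single_one, single_one_dotProduct, Matrix.col_apply]
  ring

omit [Fintype ι] in
lemma transpose_eq_of_posSemidef {M : Matrix ι ι ℝ} (hM : M.PosSemidef) : Mᵀ = M := by
  simpa using hM.isHermitian.eq

omit [Fintype ι] in
lemma transpose_eq_of_posDef {M : Matrix ι ι ℝ} (hM : M.PosDef) : Mᵀ = M := by
  simpa using hM.isHermitian.eq

lemma quad_nonneg {M : Matrix ι ι ℝ} (hM : M.PosSemidef) (t : ι → ℝ) : 0 ≤ quad M t := by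
  simpa [quad] using hM.dotProduct_mulVec_nonneg t

lemma quad_pos {M : Matrix ι ι ℝ} (hM : M.PosDef) {t : ι → ℝ} (ht : t ≠ 0) : 0 < quad M t := by
  simpa [quad] using hM.dotProduct_mulVec_pos ht

lemma posSemidef_of_quad {M : Matrix ι ι ℝ} (hM : Mᵀ = M) (h : ∀ t, 0 ≤ quad M t) :
    M.PosSemidef :=
  .of_dotProduct_mulVec_nonneg (by simpa [Matrix.IsHermitian] using hM) (by simpa [quad] using h)

lemma posDef_of_quad {M : Matrix ι ι ℝ} (hM : Mᵀ = M) (h : ∀ t, t ≠ 0 → 0 < quad M t) :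
    M.PosDef :=
  .of_dotProduct_mulVec_pos (by simpa [Matrix.IsHermitian] using hM) (by simpa [quad] using h)

lemma le_of_quad_le {M N : Matrix ι ι ℝ} (hM : Mᵀ = M) (hN : Nᵀ = N)
    (h : ∀ t, quad M t ≤ quad N t) : M ≤ N := by
  rw [Matrix.le_iff]
  refine posSemidef_of_quad (by simp [hM, hN]) fun t => ?_
  rw [quad_sub_left]
  linarith [h t]

lemma quad_le_of_le {M N : Matrix ι ι ℝ} (h : M ≤ N) (t : ι → ℝ) : quad M t ≤ quad N t := by
  have := quad_nonneg (Matrix.le_iff.1 h) t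
  rw [quad_sub_left] at this
  linarith

lemma quad_eq_sum (M : Matrix ι ι ℝ) (t : ι → ℝ) :
    quad M t = ∑ a, ∑ b, t a * (M a b * t b) := by
  simp [quad, dotProduct, Matrix.mulVec, Finset.mul_sum]

lemma abs_quad_le [DecidableEq ι] (M : Matrix ι ι ℝ) (t : ι → ℝ) :
    |quad M t| ≤ (∑ a, ∑ b, |M a b|) * quad 1 t := by
  have h2 : ∀ a, |t a| ^ 2 ≤ quad 1 t := fun a => by
    rw [quad_one, sq_abs]
    exact Finset.single_le_sum (f := fun i => t i ^ 2) (fun i _ => sq_nonneg _) (Finset.mem_univ a)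
  rw [quad_eq_sum, Finset.sum_mul]
  refine (Finset.abs_sum_le_sum_abs _ _).trans (Finset.sum_le_sum fun a _ => ?_)
  rw [Finset.sum_mul]
  refine (Finset.abs_sum_le_sum_abs _ _).trans (Finset.sum_le_sum fun b _ => ?_)
  rw [abs_mul, abs_mul]
  have h3 : |t a| * |t b| ≤ quad 1 t := by
    nlinarith [h2 a, h2 b, sq_nonneg (|t a| - |t b|)]
  calc |t a| * (|M a b| * |t b|) = |M a b| * (|t a| * |t b|) := by ring
    _ ≤ _ := by gcongr

/-- A positive definite real matrix has a symmetric invertible square root. -/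
lemma exists_sqrt [DecidableEq ι] {P : Matrix ι ι ℝ} (hP : P.PosDef) :
    ∃ B : Matrix ι ι ℝ, Bᵀ = B ∧ B * B = P ∧ IsUnit B.det := by
  have h1 : CFC.sqrt P * CFC.sqrt P = P := CFC.sqrt_mul_sqrt_self _ hP.posSemidef.nonneg
  refine ⟨CFC.sqrt P, ?_, h1, ?_⟩
  · exact transpose_eq_of_posSemidef (Matrix.nonneg_iff_posSemidef.1 (CFC.sqrt_nonneg P))
  · have h2 : (CFC.sqrt P).det * (CFC.sqrt P).det = P.det := by rw [← Matrix.det_mul, h1]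
    have := hP.det_pos
    exact isUnit_iff_ne_zero.2 fun h0 => by rw [h0] at h2; simp at h2; linarith

lemma quad_eq_sum_sq [DecidableEq ι] {P B : Matrix ι ι ℝ} (hB : Bᵀ = B) (hBP : B * B = P)
    (t : ι → ℝ) : quad P t = ∑ i, (B *ᵥ t) i ^ 2 := by
  have := quad_conj B 1 t
  rw [Matrix.mul_one, hB, hBP] at this
  rw [this, quad_one]

/-- A positive definite matrix dominates every symmetric matrix up to a constant. -/
lemma exists_le_smul [DecidableEq ι] {P : Matrix ι ι ℝ} (hP : P.PosDef) (S : Matrix ι ι ℝ)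
    (hS : Sᵀ = S) : ∃ c : ℝ, 1 ≤ c ∧ S ≤ c • P := by
  obtain ⟨B, hB, hBP, hu⟩ := exists_sqrt hP
  -- `K` bounds `S` in the coordinates `B *ᵥ t`, in which `P` is the identity; adding `1` secures `1
  -- ≤ c`.
  set K := ∑ a, ∑ b, |(B⁻¹ * S * (B⁻¹)ᵀ) a b|
  refine ⟨K + 1, by simp [K]; positivity, le_of_quad_le hS ?_ fun t => ?_⟩
  · rw [Matrix.transpose_smul, transpose_eq_of_posDef hP]
  · have h1 := abs_quad_le (B⁻¹ * S * (B⁻¹)ᵀ) (B *ᵥ t)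
    have h2 : (B⁻¹)ᵀ *ᵥ (B *ᵥ t) = t := by
      rw [Matrix.transpose_nonsing_inv, hB, Matrix.mulVec_mulVec, Matrix.nonsing_inv_mul _ hu,
        Matrix.one_mulVec]
    rw [quad_conj, h2, quad_one, ← quad_eq_sum_sq hB hBP] at h1
    rw [quad_smul_left]
    have h3 := quad_nonneg hP.posSemidef t
    have := le_abs_self (quad S t)
    nlinarith

lemma tendsto_of_tendsto_quad [DecidableEq ι] {X : ℕ → Matrix ι ι ℝ} {Y : Matrix ι ι ℝ}
    (hX : ∀ k, (X k)ᵀ = X k) (hY : Yᵀ = Y)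
    (h : ∀ t, Tendsto (fun k => quad (X k) t) atTop (nhds (quad Y t))) :
    Tendsto X atTop (nhds Y) := by
  refine tendsto_pi_nhds.2 fun a => tendsto_pi_nhds.2 fun b => ?_
  simp only [fun k => apply_eq_quad (hX k) a b, apply_eq_quad hY a b]
  exact (((h _).sub (h _)).sub (h _)).div_const 2

lemma continuous_quad (t : ι → ℝ) : Continuous fun M : Matrix ι ι ℝ => quad M t := by
  unfold quad
  fun_prop

/-- Entrywise convergence of symmetric matrices implies eventual closeness in the Loewner order. -/
lemma eventually_le_add_smul_one [DecidableEq ι] {X : ℕ → Matrix ι ι ℝ} {Y : Matrix ι ι ℝ}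
    (hX : ∀ k, (X k)ᵀ = X k) (hY : Yᵀ = Y) (h : Tendsto X atTop (nhds Y)) {ε : ℝ} (hε : 0 < ε) :
    ∀ᶠ k in atTop, X k ≤ Y + ε • 1 ∧ Y - ε • 1 ≤ X k := by
  have h1 : Tendsto (fun k => ∑ a, ∑ b, |(X k - Y) a b|) atTop (nhds 0) := by
    have : Tendsto (fun k => ∑ a, ∑ b, |(X k - Y) a b|) atTop
        (nhds (∑ a, ∑ b, |(Y - Y) a b|)) := by
      refine tendsto_finsetSum _ fun a _ => tendsto_finsetSum _ fun b _ => ?_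
      have h2 : Tendsto (fun k => X k a b) atTop (nhds (Y a b)) :=
        tendsto_pi_nhds.1 (tendsto_pi_nhds.1 h a) b
      exact (h2.sub_const _).abs
    simpa using this
  filter_upwards [h1.eventually (gt_mem_nhds hε)] with k hk
  have h3 : ∀ t, |quad (X k - Y) t| ≤ ε * quad 1 t := fun t =>
    (abs_quad_le _ t).trans (by
      gcongr
      exact quad_nonneg Matrix.PosSemidef.one t)
  constructor
  · refine le_of_quad_le (hX k) (by simp [hY]) fun t => ?_
    have := (abs_le.1 (h3 t)).2
    rw [quad_sub_left] at this
    rw [quad_add_left, quad_smul_left]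
    linarith
  · refine le_of_quad_le (by simp [hY]) (hX k) fun t => ?_
    have := (abs_le.1 (h3 t)).1
    rw [quad_sub_left] at this
    rw [quad_sub_left, quad_smul_left]
    linarith

end QuadraticForm

/-! ### Variational form of the measurement update and the Riccati operator -/

section Riccati

variable {n : ℕ} {σ : Type*} [Fintype σ] [DecidableEq σ]
  {A Q X X' : Matrix (Fin n) (Fin n) ℝ} {C : Matrix σ (Fin n) ℝ} {W W' : Matrix σ σ ℝ}

omit [DecidableEq σ] in
lemma innovation_posDef (hW : W.PosDef) (hX : X.PosSemidef) : (C * X * Cᵀ + W).PosDef := by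
  have := hX.mul_mul_conjTranspose_same C
  simp only [Matrix.conjTranspose_eq_transpose_of_trivial] at this
  exact hW.posSemidef_add this

/-- Completing the square in the gain `r`. The left side is the error variance when `t ⬝ᵥ x` is
estimated by `r` applied to the noisy observation of `x`, so the update is its minimum over `r`. The
order properties of the Riccati operator all come from here. -/
lemma quad_measUpdate_add (hW : W.PosDef) (hX : X.PosSemidef) (t : Fin n → ℝ) (r : σ → ℝ) :
    quad X (t - Cᵀ *ᵥ r) + quad W r = quad (measUpdate C W X) t
      + quad (C * X * Cᵀ + W) (r - ((C * X * Cᵀ + W)⁻¹ * C * X) *ᵥ t) := by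
  set S := C * X * Cᵀ + W with hS
  have hSd : S.PosDef := innovation_posDef hW hX
  have hXt := transpose_eq_of_posSemidef hX
  have hSt := transpose_eq_of_posDef hSd
  have hu : IsUnit S.det := isUnit_iff_ne_zero.2 hSd.det_pos.ne'
  have e1 : quad S r = quad X (Cᵀ *ᵥ r) + quad W r := by rw [hS, quad_add_left, quad_conj]
  set b := (C * X) *ᵥ t with hb
  have e2 : (S⁻¹ * C * X) *ᵥ t = S⁻¹ *ᵥ b := by
    rw [hb, Matrix.mulVec_mulVec, Matrix.mul_assoc]
  have e3 : quad X (t - Cᵀ *ᵥ r) = quad X t - 2 * (r ⬝ᵥ b) + quad X (Cᵀ *ᵥ r) := by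
    rw [sub_eq_add_neg, quad_add_right hXt, quad_neg_right, dotProduct_mulVec_comm hXt,
      neg_dotProduct, hb, ← Matrix.mulVec_mulVec, Matrix.dotProduct_mulVec r C,
      ← Matrix.mulVec_transpose]
    ring
  have e4 : quad S (r - S⁻¹ *ᵥ b) = quad S r - 2 * (r ⬝ᵥ b) + b ⬝ᵥ (S⁻¹ *ᵥ b) := by
    have : S *ᵥ (S⁻¹ *ᵥ b) = b := by
      rw [Matrix.mulVec_mulVec, Matrix.mul_nonsing_inv _ hu, Matrix.one_mulVec]
    rw [sub_eq_add_neg, quad_add_right hSt, quad_neg_right, Matrix.mulVec_neg, dotProduct_neg,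
      this, quad.eq_def S (S⁻¹ *ᵥ b), this, dotProduct_comm b]
    ring
  have e5 : quad (measUpdate C W X) t = quad X t - b ⬝ᵥ (S⁻¹ *ᵥ b) := by
    have : X * Cᵀ * S⁻¹ * C * X = (C * X)ᵀ * S⁻¹ * ((C * X)ᵀ)ᵀ := by
      rw [Matrix.transpose_transpose, Matrix.transpose_mul, hXt]
      simp only [Matrix.mul_assoc]
    rw [measUpdate, quad_sub_left, ← hS, this, quad_conj, Matrix.transpose_transpose, ← hb,
      quad.eq_def S⁻¹]
  rw [e2, e3, e4, e5, e1]
  ring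

lemma quad_measUpdate_le (hW : W.PosDef) (hX : X.PosSemidef) (t : Fin n → ℝ) (r : σ → ℝ) :
    quad (measUpdate C W X) t ≤ quad X (t - Cᵀ *ᵥ r) + quad W r := by
  rw [quad_measUpdate_add hW hX]
  linarith [quad_nonneg (innovation_posDef (C := C) hW hX).posSemidef
    (r - ((C * X * Cᵀ + W)⁻¹ * C * X) *ᵥ t)]

/-- The gain attaining the minimum in `quad_measUpdate_le`. -/
lemma quad_measUpdate_eq (hW : W.PosDef) (hX : X.PosSemidef) (t : Fin n → ℝ) :
    quad (measUpdate C W X) t = quad X (t - Cᵀ *ᵥ (((C * X * Cᵀ + W)⁻¹ * C * X) *ᵥ t))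
      + quad W (((C * X * Cᵀ + W)⁻¹ * C * X) *ᵥ t) := by
  rw [quad_measUpdate_add hW hX]
  simp

lemma measUpdate_transpose (hW : W.PosDef) (hX : X.PosSemidef) :
    (measUpdate C W X)ᵀ = measUpdate C W X := by
  have h1 := transpose_eq_of_posDef (innovation_posDef (C := C) hW hX)
  have h2 := transpose_eq_of_posSemidef hX
  rw [measUpdate, Matrix.transpose_sub]
  simp only [Matrix.transpose_mul, Matrix.transpose_transpose, Matrix.transpose_nonsing_inv, h1, h2]
  simp only [Matrix.mul_assoc]

lemma measUpdate_posSemidef (hW : W.PosDef) (hX : X.PosSemidef) :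
    (measUpdate C W X).PosSemidef := by
  refine posSemidef_of_quad (measUpdate_transpose hW hX) fun t => ?_
  rw [quad_measUpdate_eq hW hX]
  exact add_nonneg (quad_nonneg hX _) (quad_nonneg hW.posSemidef _)

/-- The optimal gain for `(W', X')` is a competitor for `(W, X)`, and the cost of a fixed gain is
monotone in both matrices. -/
lemma measUpdate_mono (hW : W.PosDef) (hW' : W'.PosDef) (hX : X.PosSemidef) (hX' : X'.PosSemidef)
    (hWW : W ≤ W') (hXX : X ≤ X') : measUpdate C W X ≤ measUpdate C W' X' := by
  refine le_of_quad_le (measUpdate_transpose hW hX) (measUpdate_transpose hW' hX') fun t => ?_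
  rw [quad_measUpdate_eq hW' hX']
  exact (quad_measUpdate_le hW hX t _).trans (add_le_add (quad_le_of_le hXX _) (quad_le_of_le hWW _))

lemma quad_measUpdate_le_quad (hW : W.PosDef) (hX : X.PosSemidef) (t : Fin n → ℝ) :
    quad (measUpdate C W X) t ≤ quad X t := by
  simpa using quad_measUpdate_le (C := C) hW hX t 0

/-- The optimal gain for `X` is tried at `c • X`: the state part scales by `c`, and the noise part
is at most its `c`-fold because `1 ≤ c`. This drives the contraction in `exists_riccati_fixedPoint`.
-/
lemma measUpdate_smul_le (hW : W.PosDef) (hX : X.PosSemidef) {c : ℝ} (hc : 1 ≤ c) :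
    measUpdate C W (c • X) ≤ c • measUpdate C W X := by
  have hcX : (c • X).PosSemidef := hX.smul (by linarith)
  refine le_of_quad_le (measUpdate_transpose hW hcX) ?_ fun t => ?_
  · rw [Matrix.transpose_smul, measUpdate_transpose hW hX]
  · rw [quad_smul_left, quad_measUpdate_eq hW hX]
    refine (quad_measUpdate_le hW hcX t (((C * X * Cᵀ + W)⁻¹ * C * X) *ᵥ t)).trans ?_
    rw [quad_smul_left, mul_add]
    gcongr
    exact le_mul_of_one_le_left (quad_nonneg hW.posSemidef _) hc

lemma riccati_eq : riccati A C Q W X = A * measUpdate C W X * Aᵀ + Q := by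
  simp only [riccati, measUpdate, Matrix.mul_sub, Matrix.sub_mul, Matrix.mul_assoc]
  abel

lemma quad_riccati (t : Fin n → ℝ) :
    quad (riccati A C Q W X) t = quad (measUpdate C W X) (Aᵀ *ᵥ t) + quad Q t := by
  rw [riccati_eq, quad_add_left, quad_conj]

lemma conj_posSemidef (hX : X.PosSemidef) : (A * X * Aᵀ).PosSemidef := by
  simpa using hX.mul_mul_conjTranspose_same A

lemma riccati_posSemidef (hQ : Q.PosDef) (hW : W.PosDef) (hX : X.PosSemidef) :
    (riccati A C Q W X).PosSemidef := by
  rw [riccati_eq]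
  exact (conj_posSemidef (measUpdate_posSemidef hW hX)).add hQ.posSemidef

lemma riccati_mono (hQ : Q.PosDef) (hW : W.PosDef) (hX : X.PosSemidef) (hX' : X'.PosSemidef)
    (hXX : X ≤ X') : riccati A C Q W X ≤ riccati A C Q W X' := by
  refine le_of_quad_le (transpose_eq_of_posSemidef (riccati_posSemidef hQ hW hX))
    (transpose_eq_of_posSemidef (riccati_posSemidef hQ hW hX')) fun t => ?_
  rw [quad_riccati, quad_riccati]
  gcongr
  exact quad_le_of_le (measUpdate_mono hW hW hX hX' le_rfl hXX) _

lemma iterate_riccati_posSemidef (hQ : Q.PosDef) (hW : W.PosDef) (hX : X.PosSemidef) (k : ℕ) :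
    ((riccati A C Q W)^[k] X).PosSemidef := by
  induction k with
  | zero => exact hX
  | succ k ih =>
    rw [Function.iterate_succ_apply']
    exact riccati_posSemidef hQ hW ih

lemma iterate_riccati_mono (hQ : Q.PosDef) (hW : W.PosDef) (hX : X.PosSemidef)
    (hX' : X'.PosSemidef) (hXX : X ≤ X') (k : ℕ) :
    (riccati A C Q W)^[k] X ≤ (riccati A C Q W)^[k] X' := by
  induction k with
  | zero => exact hXX
  | succ k ih =>
    rw [Function.iterate_succ_apply', Function.iterate_succ_apply']
    exact riccati_mono hQ hW (iterate_riccati_posSemidef hQ hW hX k)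
      (iterate_riccati_posSemidef hQ hW hX' k) ih

/-- Discarding the measurements only increases the variance; what is left is the open-loop
covariance, which stability of `A` bounds uniformly in `k`. -/
lemma quad_iterate_riccati_le (hQ : Q.PosDef) (hW : W.PosDef) (hX : X.PosSemidef) (k : ℕ)
    (t : Fin n → ℝ) : quad ((riccati A C Q W)^[k] X) t
      ≤ quad X ((Aᵀ ^ k) *ᵥ t) + ∑ j ∈ Finset.range k, quad Q ((Aᵀ ^ j) *ᵥ t) := by
  induction k generalizing t with
  | zero => simp
  | succ k ih =>
    rw [Function.iterate_succ_apply', quad_riccati, Finset.sum_range_succ']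
    have h1 := quad_measUpdate_le_quad (C := C) hW
      (iterate_riccati_posSemidef (A := A) (C := C) hQ hW hX k) (Aᵀ *ᵥ t)
    have h2 := ih (Aᵀ *ᵥ t)
    simp only [Matrix.mulVec_mulVec, ← pow_succ] at h2
    simp only [pow_zero, Matrix.one_mulVec]
    linarith

/-- Only the limit has to be positive semidefinite: the innovation determinant is nonzero there,
which makes the inverse continuous. -/
lemma tendsto_measUpdate {Y : ℕ → Matrix (Fin n) (Fin n) ℝ} (hW : W.PosDef) (hX : X.PosSemidef)
    (h : Tendsto Y atTop (nhds X)) :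
    Tendsto (fun k => measUpdate C W (Y k)) atTop (nhds (measUpdate C W X)) := by
  have hS := innovation_posDef (C := C) hW hX
  have h1 : Tendsto (fun k => C * Y k * Cᵀ + W) atTop (nhds (C * X * Cᵀ + W)) :=
    ((by fun_prop : Continuous fun Z : Matrix (Fin n) (Fin n) ℝ => C * Z * Cᵀ + W).tendsto X).comp h
  have h2 : Tendsto (fun k => (C * Y k * Cᵀ + W)⁻¹) atTop (nhds (C * X * Cᵀ + W)⁻¹) := by
    simp only [Matrix.inv_def, Ring.inverse_eq_inv']
    refine Tendsto.smul (Tendsto.inv₀ ?_ hS.det_pos.ne') ?_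
    · exact ((continuous_id.matrix_det).tendsto _).comp h1
    · exact ((continuous_id.matrix_adjugate).tendsto _).comp h1
  unfold measUpdate
  have h3 : Continuous fun p : Matrix (Fin n) (Fin n) ℝ × Matrix σ σ ℝ =>
      p.1 - p.1 * Cᵀ * p.2 * C * p.1 := by fun_prop
  exact (h3.tendsto (X, (C * X * Cᵀ + W)⁻¹)).comp (h.prodMk_nhds h2)

/-- The powers of a stable matrix decay geometrically. -/
lemma SchurStable.exists_abs_pow_le (hA : SchurStable A) :
    ∃ c ρ : ℝ, 0 ≤ c ∧ 0 ≤ ρ ∧ ρ < 1 ∧ ∀ k a b, |(A ^ k) a b| ≤ c * ρ ^ k := by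
  open scoped Matrix.Norms.Operator in
  set a : Matrix (Fin n) (Fin n) ℂ := A.map (algebraMap ℝ ℂ)
  -- With `r` strictly between the spectral radius and one, Gelfand's formula gives `‖a ^ k‖ ≤ r ^
  -- k` eventually; as `r > 0`, a constant extends the bound to all `k`.
  obtain ⟨r, hr1, hr2⟩ := ENNReal.lt_iff_exists_nnreal_btwn.1 hA
  have hr2' : r < 1 := by exact_mod_cast hr2
  have hr0 : 0 < r := by
    have : (0 : ℝ≥0∞) < r := zero_le.trans_lt hr1
    exact_mod_cast this
  have h1 := (spectrum.pow_nnnorm_pow_one_div_tendsto_nhds_spectralRadius a).eventually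
    (gt_mem_nhds hr1)
  have h2 : (fun k => ‖a ^ k‖) =O[atTop] fun k => (r : ℝ) ^ k := by
    refine Asymptotics.IsBigO.of_bound 1 ?_
    filter_upwards [h1, eventually_gt_atTop 0] with k hk hk0
    have h3 : (‖a ^ k‖₊ : ℝ≥0∞) ≤ (r : ℝ≥0∞) ^ k := by
      have h4 := ENNReal.rpow_le_rpow hk.le (Nat.cast_nonneg (α := ℝ) k)
      rw [← ENNReal.rpow_mul, one_div, inv_mul_cancel₀ (by positivity), ENNReal.rpow_one,
        ENNReal.rpow_natCast] at h4
      exact h4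
    have h5 : ‖a ^ k‖₊ ≤ r ^ k := by exact_mod_cast h3
    have h6 : ‖a ^ k‖ ≤ (r : ℝ) ^ k := by exact_mod_cast h5
    rw [norm_norm, one_mul, Real.norm_of_nonneg (by positivity)]
    exact h6
  obtain ⟨c, hc, hb⟩ := Asymptotics.bound_of_isBigO_nat_atTop h2
  refine ⟨c, r, hc.le, r.2, by exact_mod_cast hr2', fun k i j => ?_⟩
  have h7 := hb (x := k) (by positivity)
  rw [norm_norm, Real.norm_of_nonneg (by positivity)] at h7
  refine le_trans ?_ h7
  have h8 : a ^ k = (A ^ k).map (algebraMap ℝ ℂ) := (map_pow (algebraMap ℝ ℂ).mapMatrix A k).symm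
  have h9 : ‖(a ^ k) i j‖₊ ≤ ‖a ^ k‖₊ := by
    rw [Matrix.linfty_opNNNorm_def]
    exact (Finset.single_le_sum (f := fun j => ‖(a ^ k) i j‖₊) (fun _ _ => zero_le)
      (Finset.mem_univ j)).trans (Finset.le_sup (f := fun i => ∑ j, ‖(a ^ k) i j‖₊)
        (Finset.mem_univ i))
  have h10 : ‖(a ^ k) i j‖ ≤ ‖a ^ k‖ := h9
  rw [h8] at h10 ⊢
  simpa using h10

/-- The entries of `(Aᵀ ^ k) *ᵥ t` are `O(ρ ^ k)`, so the form decays like `(ρ ^ 2) ^ k`. These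
series bound the Riccati iterates and the second moments of the measurements uniformly in time. -/
lemma SchurStable.summable_quad (hA : SchurStable A) (S : Matrix (Fin n) (Fin n) ℝ)
    (t : Fin n → ℝ) : Summable fun k => quad S ((Aᵀ ^ k) *ᵥ t) := by
  obtain ⟨c, ρ, hc, hρ, hρ1, hk⟩ := hA.exists_abs_pow_le
  have h1 : ∀ k a, |((Aᵀ ^ k) *ᵥ t) a| ≤ (c * ∑ b, |t b|) * ρ ^ k := fun k a => by
    rw [Matrix.mulVec, dotProduct, ← Matrix.transpose_pow]
    refine (Finset.abs_sum_le_sum_abs _ _).trans ?_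
    rw [mul_assoc, mul_comm (∑ b, |t b|), ← mul_assoc, Finset.mul_sum]
    refine Finset.sum_le_sum fun b _ => ?_
    rw [abs_mul, Matrix.transpose_apply]
    gcongr
    exact hk k b a
  set K := c * ∑ b, |t b|
  have hK : 0 ≤ K := by positivity
  simp only [quad_eq_sum]
  refine summable_sum fun a _ => summable_sum fun b _ => ?_
  refine Summable.of_norm_bounded (g := fun k => (|S a b| * K ^ 2) * (ρ ^ 2) ^ k) ?_ fun k => ?_
  · exact (summable_geometric_of_lt_one (by positivity) (by nlinarith)).mul_left _
  · rw [Real.norm_eq_abs, abs_mul, abs_mul]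
    calc _ ≤ (K * ρ ^ k) * (|S a b| * (K * ρ ^ k)) := by
          gcongr
          exacts [h1 k a, h1 k b]
      _ = _ := by ring

end Riccati

/-! ### Fixed point of the Riccati operator and its attraction -/

section RiccatiLimit

variable {n : ℕ} {σ : Type*} [Fintype σ] [DecidableEq σ]
  {A Q : Matrix (Fin n) (Fin n) ℝ} {C : Matrix σ (Fin n) ℝ} {W : Matrix σ σ ℝ}

lemma iterate_riccati_zero_monotone (hQ : Q.PosDef) (hW : W.PosDef) :
    Monotone fun k => (riccati A C Q W)^[k] 0 := by
  refine monotone_nat_of_le_succ fun k => ?_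
  rw [Function.iterate_succ_apply]
  refine iterate_riccati_mono hQ hW .zero (riccati_posSemidef hQ hW .zero) ?_ k
  exact (riccati_posSemidef hQ hW .zero).nonneg

/-- For a stable system the Riccati iteration from `0` converges. -/
lemma exists_tendsto_iterate_riccati_zero (hA : SchurStable A) (hQ : Q.PosDef) (hW : W.PosDef) :
    ∃ X, Xᵀ = X ∧ Tendsto (fun k => (riccati A C Q W)^[k] 0) atTop (nhds X) := by
  have ht : ∀ k, ((riccati A C Q W)^[k] 0)ᵀ = (riccati A C Q W)^[k] 0 := fun k =>
    transpose_eq_of_posSemidef (iterate_riccati_posSemidef hQ hW .zero k)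
  have hconv : ∀ t, ∃ l, Tendsto (fun k => quad ((riccati A C Q W)^[k] 0) t) atTop (nhds l) := by
    intro t
    refine ⟨_, tendsto_atTop_ciSup
      (fun i j hij => quad_le_of_le (iterate_riccati_zero_monotone hQ hW hij) t)
      ⟨∑' j, quad Q ((Aᵀ ^ j) *ᵥ t), ?_⟩⟩
    rintro _ ⟨k, rfl⟩
    refine (quad_iterate_riccati_le hQ hW .zero k t).trans ?_
    rw [quad_zero_left, zero_add]
    exact (hA.summable_quad Q t).sum_le_tsum _ fun j _ => quad_nonneg hQ.posSemidef _
  choose l hl using hconv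
  -- The limit matrix is assembled by polarisation from the limits of the quadratic forms.
  have hentry : ∀ a b, Tendsto (fun k => ((riccati A C Q W)^[k] 0) a b) atTop
      (nhds ((l (Pi.single a 1 + Pi.single b 1) - l (Pi.single a 1) - l (Pi.single b 1)) / 2)) := by
    intro a b
    simp only [fun k => apply_eq_quad (ht k) a b]
    exact (((hl _).sub (hl _)).sub (hl _)).div_const 2
  refine ⟨Matrix.of fun a b =>
    (l (Pi.single a 1 + Pi.single b 1) - l (Pi.single a 1) - l (Pi.single b 1)) / 2, ?_,
    tendsto_pi_nhds.2 fun a => tendsto_pi_nhds.2 fun b => hentry a b⟩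
  ext a b
  simp only [Matrix.transpose_apply, Matrix.of_apply]
  rw [add_comm (Pi.single b 1 : Fin n → ℝ)]
  ring

/-- The Riccati operator of a stable system has a positive definite fixed point which attracts every
positive semidefinite matrix. -/
theorem exists_riccati_fixedPoint (hA : SchurStable A) (hQ : Q.PosDef) (hW : W.PosDef) :
    ∃ X : Matrix (Fin n) (Fin n) ℝ, X.PosDef ∧ riccati A C Q W X = X ∧
      ∀ X₀ : Matrix (Fin n) (Fin n) ℝ, X₀.PosSemidef →
        Tendsto (fun k => (riccati A C Q W)^[k] X₀) atTop (nhds X) := by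
  obtain ⟨X, hXt, hX⟩ := exists_tendsto_iterate_riccati_zero (C := C) hA hQ hW
  have hXQ : ∀ t, quad Q t ≤ quad X t := fun t => by
    refine ge_of_tendsto (((continuous_quad t).tendsto X).comp hX) ?_
    filter_upwards [eventually_gt_atTop 0] with k hk
    obtain ⟨k, rfl⟩ := Nat.exists_eq_succ_of_ne_zero hk.ne'
    simp only [Function.comp_apply, Function.iterate_succ_apply', quad_riccati]
    linarith [quad_nonneg (measUpdate_posSemidef (C := C) hW
      (iterate_riccati_posSemidef (A := A) (C := C) hQ hW .zero k)) (Aᵀ *ᵥ t)]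
  have hXpd : X.PosDef := posDef_of_quad hXt fun t ht => (quad_pos hQ ht).trans_le (hXQ t)
  have hfix : riccati A C Q W X = X := by
    have h1 : Tendsto (fun k => riccati A C Q W ((riccati A C Q W)^[k] 0)) atTop
        (nhds (riccati A C Q W X)) := by
      simp only [riccati_eq]
      have h2 := tendsto_measUpdate (C := C) hW hXpd.posSemidef hX
      exact ((by fun_prop : Continuous fun Z : Matrix (Fin n) (Fin n) ℝ =>
        A * Z * Aᵀ + Q).tendsto _).comp h2
    simp only [← Function.iterate_succ_apply'] at h1
    exact tendsto_nhds_unique h1 (hX.comp (tendsto_add_atTop_nat 1))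
  refine ⟨X, hXpd, hfix, fun X₀ hX₀ => ?_⟩
  -- `X₀ ≤ c • X` starts the upper bound; `X ≤ d • Q` says that each step injects at least the
  -- fraction `d⁻¹` of `X`.
  obtain ⟨c, hc, hcX⟩ := exists_le_smul hXpd X₀ (transpose_eq_of_posSemidef hX₀)
  obtain ⟨d, hd, hdX⟩ := exists_le_smul hQ X hXt
  -- the contraction factor in the part metric
  set θ := 1 - d⁻¹
  have hd0 : 0 < d := by linarith
  have hθ0 : 0 ≤ θ := sub_nonneg.2 (inv_le_one_of_one_le₀ hd)
  have hθ1 : θ < 1 := sub_lt_self _ (inv_pos.2 hd0)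
  -- Subhomogeneity and the fixed point equation bound the image of `(1 + a) • X` by `(1 + a) • X -
  -- a • Q`, and `Q` is at least `d⁻¹ • X`: the excess `a` shrinks by the factor `θ`.
  have hstep : ∀ a : ℝ, 0 ≤ a → ∀ Z : Matrix (Fin n) (Fin n) ℝ, Z.PosSemidef →
      Z ≤ (1 + a) • X → riccati A C Q W Z ≤ (1 + a * θ) • X := by
    intro a ha Z hZ hZX
    have h1 : ((1 + a) • X).PosSemidef := hXpd.posSemidef.smul (by linarith)
    refine le_of_quad_le (transpose_eq_of_posSemidef (riccati_posSemidef hQ hW hZ))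
      (by rw [Matrix.transpose_smul, hXt]) fun t => ?_
    have h2 := quad_le_of_le (riccati_mono (A := A) (C := C) hQ hW hZ h1 hZX) t
    have h3 := quad_le_of_le (measUpdate_smul_le (C := C) hW hXpd.posSemidef
      (by linarith : 1 ≤ 1 + a)) (Aᵀ *ᵥ t)
    have h4 : quad X t = quad (measUpdate C W X) (Aᵀ *ᵥ t) + quad Q t := by
      conv_lhs => rw [← hfix, quad_riccati]
    have h5 := quad_le_of_le hdX t
    rw [quad_smul_left] at h3 h5 ⊢
    rw [quad_riccati (X := (1 + a) • X)] at h2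
    have h6 : d⁻¹ * quad X t ≤ quad Q t := by
      rw [inv_mul_le_iff₀ hd0]; exact h5
    have h7 : a * (d⁻¹ * quad X t) ≤ a * quad Q t := by gcongr
    have h8 : (1 + a * θ) * quad X t = (1 + a) * quad X t - a * (d⁻¹ * quad X t) := by
      simp only [θ]; ring
    rw [h8]
    nlinarith
  have hupper : ∀ k, (riccati A C Q W)^[k] X₀ ≤ (1 + (c - 1) * θ ^ k) • X := fun k => by
    induction k with
    | zero => simpa using hcX
    | succ k ih =>
      rw [Function.iterate_succ_apply', pow_succ, ← mul_assoc]
      exact hstep _ (mul_nonneg (by linarith) (pow_nonneg hθ0 k)) _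
        (iterate_riccati_posSemidef hQ hW hX₀ k) ih
  refine tendsto_of_tendsto_quad
    (fun k => transpose_eq_of_posSemidef (iterate_riccati_posSemidef hQ hW hX₀ k)) hXt fun t => ?_
  have hup : Tendsto (fun k => (1 + (c - 1) * θ ^ k) * quad X t) atTop (nhds (quad X t)) := by
    have := (((tendsto_pow_atTop_nhds_zero_of_lt_one hθ0 hθ1).const_mul (c - 1)).const_add 1).mul_const
      (quad X t)
    simpa using this
  -- Squeeze between the iterates from `0` and the contracting multiples of `X`.
  refine tendsto_of_tendsto_of_tendsto_of_le_of_le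
    (((continuous_quad t).tendsto X).comp hX) hup (fun k => ?_) (fun k => ?_)
  · exact quad_le_of_le (iterate_riccati_mono hQ hW .zero hX₀ hX₀.nonneg k) t
  · have := quad_le_of_le (hupper k) t
    rwa [quad_smul_left] at this

end RiccatiLimit

/-! ### Joint Gaussianity of the state and the measurements -/

section Model

variable {Ω : Type*} [MeasurableSpace Ω] {n m : ℕ} {s : Fin m → ℕ}

/-- The standing assumptions on the primitive random variables. -/
structure NoiseModel (μ : Measure Ω) (Sigma0 Q : Matrix (Fin n) (Fin n) ℝ)
    (R : Matrix ((i : Fin m) × Fin (s i)) ((i : Fin m) × Fin (s i)) ℝ)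
    (x₀ : Ω → EuclideanSpace ℝ (Fin n)) (w : ℕ → Ω → EuclideanSpace ℝ (Fin n))
    (v : ℕ → Ω → EuclideanSpace ℝ ((i : Fin m) × Fin (s i))) (ζ : ℕ → Fin m → Ω → ℝ) : Prop where
  Q_posDef : Q.PosDef
  R_posDef : R.PosDef
  Sigma0_posDef : Sigma0.PosDef
  measurable_init : Measurable x₀
  measurable_process : ∀ k, Measurable (w k)
  measurable_measurement : ∀ k, Measurable (v k)
  measurable_trigger : ∀ k i, Measurable (ζ k i)
  map_init : μ.map x₀ = multivariateGaussian 0 Sigma0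
  map_process : ∀ k, μ.map (w k) = multivariateGaussian 0 Q
  map_measurement : ∀ k, μ.map (v k) = multivariateGaussian 0 R
  map_trigger : ∀ k i, μ.map (ζ k i) = (volume : Measure ℝ).restrict (Set.Icc 0 1)
  iIndep : iIndep (sourceSigma x₀ w v ζ) μ

variable {μ : Measure Ω} {A Sigma0 Q : Matrix (Fin n) (Fin n) ℝ}
  {C : (i : Fin m) → Matrix (Fin (s i)) (Fin n) ℝ}
  {R : Matrix ((i : Fin m) × Fin (s i)) ((i : Fin m) × Fin (s i)) ℝ}
  {x₀ : Ω → EuclideanSpace ℝ (Fin n)} {w : ℕ → Ω → EuclideanSpace ℝ (Fin n)}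
  {v : ℕ → Ω → EuclideanSpace ℝ ((i : Fin m) × Fin (s i))} {ζ : ℕ → Fin m → Ω → ℝ}

/-- A linear form of a centered Gaussian vector. -/
lemma map_dotProduct_of_multivariateGaussian {ι : Type*} [Fintype ι] [DecidableEq ι]
    {S : Matrix ι ι ℝ} (hS : S.PosSemidef) {X : Ω → EuclideanSpace ℝ ι} (hX : Measurable X)
    (hmap : μ.map X = multivariateGaussian 0 S) (l : ι → ℝ) :
    μ.map (fun ω => l ⬝ᵥ (X ω).ofLp) = gaussianReal 0 (quad S l).toNNReal := by
  have hpr : IsProbabilityMeasure (μ.map X) := by rw [hmap]; infer_instance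
  have : IsProbabilityMeasure μ := Measure.isProbabilityMeasure_of_map X
  have hl : Measurable fun y : EuclideanSpace ℝ ι => l ⬝ᵥ y.ofLp := by
    unfold dotProduct; fun_prop
  have h1 : (fun ω => l ⬝ᵥ (X ω).ofLp) = (fun y : EuclideanSpace ℝ ι => l ⬝ᵥ y.ofLp) ∘ X := rfl
  rw [h1, ← Measure.map_map hl hX, hmap]
  have : IsProbabilityMeasure
      ((multivariateGaussian 0 S).map fun y : EuclideanSpace ℝ ι => l ⬝ᵥ y.ofLp) :=
    Measure.isProbabilityMeasure_map hl.aemeasurable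
  refine Measure.ext_of_charFun ?_
  ext u
  have h2 := charFun_multivariateGaussian (μ := 0) hS (WithLp.toLp 2 (u • l))
  rw [charFun_apply] at h2
  rw [charFun_apply_real, integral_map hl.aemeasurable (by fun_prop), charFun_gaussianReal,
    Real.coe_toNNReal _ (quad_nonneg hS l)]
  have h3 : ∀ y : EuclideanSpace ℝ ι, inner ℝ y (WithLp.toLp 2 (u • l)) = u * (l ⬝ᵥ y.ofLp) := by
    intro y
    simp [PiLp.inner_apply, dotProduct, Finset.mul_sum, mul_assoc]
  simp only [h3] at h2
  push_cast at h2 ⊢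
  rw [h2]
  congr 1
  simp [quad, Matrix.mulVec_smul]
  ring

/-- The σ-algebra generated by a set of primitive random variables. -/
@[reducible] def sigmaOf (x₀ : Ω → EuclideanSpace ℝ (Fin n)) (w : ℕ → Ω → EuclideanSpace ℝ (Fin n))
    (v : ℕ → Ω → EuclideanSpace ℝ ((i : Fin m) × Fin (s i))) (ζ : ℕ → Fin m → Ω → ℝ)
    (S : Set (Source m)) : MeasurableSpace Ω := ⨆ a ∈ S, sourceSigma x₀ w v ζ a

lemma NoiseModel.sourceSigma_le (h : NoiseModel μ Sigma0 Q R x₀ w v ζ) (a : Source m) :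
    sourceSigma x₀ w v ζ a ≤ ‹MeasurableSpace Ω› := by
  cases a with
  | init => exact h.measurable_init.comap_le
  | process k => exact (h.measurable_process k).comap_le
  | measurement k => exact (h.measurable_measurement k).comap_le
  | trigger k i => exact (h.measurable_trigger k i).comap_le

lemma NoiseModel.sigmaOf_le (h : NoiseModel μ Sigma0 Q R x₀ w v ζ) (S : Set (Source m)) :
    sigmaOf x₀ w v ζ S ≤ ‹MeasurableSpace Ω› :=
  iSup₂_le fun a _ => h.sourceSigma_le a

lemma NoiseModel.indep_sigmaOf (h : NoiseModel μ Sigma0 Q R x₀ w v ζ) {S T : Set (Source m)}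
    (hST : Disjoint S T) : Indep (sigmaOf x₀ w v ζ S) (sigmaOf x₀ w v ζ T) μ :=
  indep_iSup_of_disjoint h.sourceSigma_le h.iIndep hST

omit [MeasurableSpace Ω] in
lemma sourceSigma_le_sigmaOf {S : Set (Source m)} {a : Source m} (ha : a ∈ S) :
    sourceSigma x₀ w v ζ a ≤ sigmaOf x₀ w v ζ S :=
  le_iSup₂_of_le a ha le_rfl

omit [MeasurableSpace Ω] in
lemma sigmaOf_mono {S T : Set (Source m)} (hST : S ⊆ T) :
    sigmaOf x₀ w v ζ S ≤ sigmaOf x₀ w v ζ T :=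
  biSup_mono fun _ ha => hST ha

/-- The sources of the first `k` process noises, the first `l` measurement noises and the initial
state. -/
def plantSources (m : ℕ) (k l : ℕ) : Set (Source m) :=
  {a | match a with
    | .init => True
    | .process j => j < k
    | .measurement j => j < l
    | .trigger _ _ => False}

omit [MeasurableSpace Ω] in
lemma measurable_state_sigmaOf {S : Set (Source m)} (k : ℕ) (h0 : .init ∈ S)
    (hw : ∀ j < k, .process j ∈ S) :
    Measurable[sigmaOf x₀ w v ζ S] (state A x₀ w k) := by
  let _ : MeasurableSpace Ω := sigmaOf x₀ w v ζ S
  induction k with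
  | zero => exact (comap_measurable x₀).mono (sourceSigma_le_sigmaOf h0) le_rfl
  | succ k ih =>
    have h1 := ih fun j hj => hw j (by omega)
    have h2 : Measurable (w k) :=
      (comap_measurable (w k)).mono (sourceSigma_le_sigmaOf (hw k (by omega))) le_rfl
    have h3 : Continuous fun y : EuclideanSpace ℝ (Fin n) =>
        (WithLp.toLp 2 (A *ᵥ y.ofLp) : EuclideanSpace ℝ (Fin n)) := by fun_prop
    exact (h3.measurable.comp h1).add h2

/-- The stacked measurement `y_k`. -/
def stackMeas (C : (i : Fin m) → Matrix (Fin (s i)) (Fin n) ℝ)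
    (x : ℕ → Ω → EuclideanSpace ℝ (Fin n))
    (v : ℕ → Ω → EuclideanSpace ℝ ((i : Fin m) × Fin (s i))) (k : ℕ) (ω : Ω) :
    (i : Fin m) × Fin (s i) → ℝ := fun p => meas C x v k p.1 ω p.2

omit [MeasurableSpace Ω] in
lemma stackMeas_eq (x : ℕ → Ω → EuclideanSpace ℝ (Fin n)) (k : ℕ) (ω : Ω) :
    stackMeas C x v k ω = stack C *ᵥ (x k ω).ofLp + (v k ω).ofLp := rfl

omit [MeasurableSpace Ω] in
lemma measurable_stackMeas_sigmaOf {S : Set (Source m)} (k : ℕ) (h0 : .init ∈ S)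
    (hw : ∀ j < k, .process j ∈ S) (hv : .measurement k ∈ S) :
    Measurable[sigmaOf x₀ w v ζ S] (stackMeas C (state A x₀ w) v k) := by
  have h1 := measurable_state_sigmaOf (A := A) (x₀ := x₀) (w := w) (v := v) (ζ := ζ) k h0 hw
  let _ : MeasurableSpace Ω := sigmaOf x₀ w v ζ S
  have h2 : Measurable (v k) := (comap_measurable (v k)).mono (sourceSigma_le_sigmaOf hv) le_rfl
  simp only [funext (stackMeas_eq (C := C) (v := v) (state A x₀ w) k)]
  have h3 : Continuous fun y : EuclideanSpace ℝ (Fin n) => stack C *ᵥ y.ofLp := by fun_prop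
  have h4 : Continuous fun y : EuclideanSpace ℝ ((i : Fin m) × Fin (s i)) => y.ofLp := by fun_prop
  exact (h3.measurable.comp h1).add (h4.measurable.comp h2)

/-- Linear combinations of the current state and of the measurements up to the current time. -/
def linComb (A : Matrix (Fin n) (Fin n) ℝ) (C : (i : Fin m) → Matrix (Fin (s i)) (Fin n) ℝ)
    (x₀ : Ω → EuclideanSpace ℝ (Fin n)) (w : ℕ → Ω → EuclideanSpace ℝ (Fin n))
    (v : ℕ → Ω → EuclideanSpace ℝ ((i : Fin m) × Fin (s i))) (k : ℕ) :
    ((Fin n → ℝ) × (ℕ → (i : Fin m) × Fin (s i) → ℝ)) →ₗ[ℝ] Ω → ℝ where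
  toFun p ω := p.1 ⬝ᵥ (state A x₀ w k ω).ofLp
    + ∑ j ∈ Finset.range (k + 1), p.2 j ⬝ᵥ stackMeas C (state A x₀ w) v j ω
  map_add' p q := by
    ext ω
    simp only [Prod.fst_add, Prod.snd_add, Pi.add_apply, add_dotProduct, Finset.sum_add_distrib]
    ring
  map_smul' c p := by
    ext ω
    simp only [Prod.smul_fst, Prod.smul_snd, Pi.smul_apply, smul_dotProduct, smul_eq_mul,
      RingHom.id_apply, mul_add, Finset.mul_sum]

omit [MeasurableSpace Ω] in
lemma linComb_apply (k : ℕ) (p : (Fin n → ℝ) × (ℕ → (i : Fin m) × Fin (s i) → ℝ)) (ω : Ω) :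
    linComb A C x₀ w v k p ω = p.1 ⬝ᵥ (state A x₀ w k ω).ofLp
      + ∑ j ∈ Finset.range (k + 1), p.2 j ⬝ᵥ stackMeas C (state A x₀ w) v j ω := rfl

/-- The variance of `linComb`, by backward recursion. -/
def linCombVar (A Sigma0 Q : Matrix (Fin n) (Fin n) ℝ)
    (C : (i : Fin m) → Matrix (Fin (s i)) (Fin n) ℝ)
    (R : Matrix ((i : Fin m) × Fin (s i)) ((i : Fin m) × Fin (s i)) ℝ) :
    ℕ → (Fin n → ℝ) × (ℕ → (i : Fin m) × Fin (s i) → ℝ) → ℝ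
  | 0, p => quad Sigma0 (p.1 + (stack C)ᵀ *ᵥ p.2 0) + quad R (p.2 0)
  | k + 1, p => linCombVar A Sigma0 Q C R k (Aᵀ *ᵥ (p.1 + (stack C)ᵀ *ᵥ p.2 (k + 1)), p.2)
      + quad Q (p.1 + (stack C)ᵀ *ᵥ p.2 (k + 1)) + quad R (p.2 (k + 1))

omit [MeasurableSpace Ω] in
lemma dotProduct_stackMeas (x : ℕ → Ω → EuclideanSpace ℝ (Fin n)) (k : ℕ) (ω : Ω)
    (r : (i : Fin m) × Fin (s i) → ℝ) : r ⬝ᵥ stackMeas C x v k ω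
      = ((stack C)ᵀ *ᵥ r) ⬝ᵥ (x k ω).ofLp + r ⬝ᵥ (v k ω).ofLp := by
  rw [stackMeas_eq, dotProduct_add, Matrix.dotProduct_mulVec, Matrix.mulVec_transpose]

omit [MeasurableSpace Ω] in
lemma linComb_zero (p : (Fin n → ℝ) × (ℕ → (i : Fin m) × Fin (s i) → ℝ)) :
    linComb A C x₀ w v 0 p = (fun ω => (p.1 + (stack C)ᵀ *ᵥ p.2 0) ⬝ᵥ (x₀ ω).ofLp)
      + fun ω => p.2 0 ⬝ᵥ (v 0 ω).ofLp := by
  ext ω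
  rw [linComb_apply, zero_add, Finset.sum_range_one, dotProduct_stackMeas]
  simp only [state, Pi.add_apply, add_dotProduct]
  ring

omit [MeasurableSpace Ω] in
lemma linComb_succ (k : ℕ) (p : (Fin n → ℝ) × (ℕ → (i : Fin m) × Fin (s i) → ℝ)) :
    linComb A C x₀ w v (k + 1) p
      = linComb A C x₀ w v k (Aᵀ *ᵥ (p.1 + (stack C)ᵀ *ᵥ p.2 (k + 1)), p.2)
        + (fun ω => (p.1 + (stack C)ᵀ *ᵥ p.2 (k + 1)) ⬝ᵥ (w k ω).ofLp)
        + fun ω => p.2 (k + 1) ⬝ᵥ (v (k + 1) ω).ofLp := by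
  ext ω
  rw [linComb_apply, Finset.sum_range_succ, dotProduct_stackMeas]
  simp only [Pi.add_apply, linComb_apply]
  set l := (stack C)ᵀ *ᵥ p.2 (k + 1) with hl
  have h1 : (state A x₀ w (k + 1) ω).ofLp = A *ᵥ (state A x₀ w k ω).ofLp + (w k ω).ofLp := rfl
  rw [h1, dotProduct_add, dotProduct_add, Matrix.dotProduct_mulVec, Matrix.dotProduct_mulVec,
    ← Matrix.mulVec_transpose, ← Matrix.mulVec_transpose]
  simp only [Matrix.mulVec_add, add_dotProduct]
  ring

omit [MeasurableSpace Ω] in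
lemma measurable_linComb_sigmaOf (k : ℕ)
    (p : (Fin n → ℝ) × (ℕ → (i : Fin m) × Fin (s i) → ℝ)) {S : Set (Source m)}
    (hS : plantSources m k (k + 1) ⊆ S) :
    Measurable[sigmaOf x₀ w v ζ S] (linComb A C x₀ w v k p) := by
  have h1 := measurable_state_sigmaOf (A := A) (x₀ := x₀) (w := w) (v := v) (ζ := ζ) (S := S) k
    (hS trivial) fun j hj => hS hj
  have h2 : ∀ j ∈ Finset.range (k + 1), Measurable[sigmaOf x₀ w v ζ S]
      (stackMeas C (state A x₀ w) v j) := fun j hj =>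
    measurable_stackMeas_sigmaOf j (hS trivial)
      (fun i hi => hS (show i < k by rw [Finset.mem_range] at hj; omega))
      (hS (Finset.mem_range.1 hj))
  let _ : MeasurableSpace Ω := sigmaOf x₀ w v ζ S
  have h3 : Continuous fun y : EuclideanSpace ℝ (Fin n) => p.1 ⬝ᵥ y.ofLp := by
    unfold dotProduct; fun_prop
  refine (h3.measurable.comp h1).add (Finset.measurable_sum _ fun j hj => ?_)
  have h4 : Continuous fun y : (i : Fin m) × Fin (s i) → ℝ => p.2 j ⬝ᵥ y := by
    unfold dotProduct; fun_prop
  exact h4.measurable.comp (h2 j hj)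

lemma indepFun_of_indep {m₁ m₂ : MeasurableSpace Ω} {f g : Ω → ℝ} (h : Indep m₁ m₂ μ)
    (hf : Measurable[m₁] f) (hg : Measurable[m₂] g) : IndepFun f g μ := by
  rw [IndepFun_iff_Indep]
  exact indep_of_indep_of_le_left (indep_of_indep_of_le_right h hg.comap_le) hf.comap_le

omit [MeasurableSpace Ω] in
lemma measurable_dotProduct_comap {ι : Type*} [Fintype ι] (X : Ω → EuclideanSpace ℝ ι) (l : ι → ℝ) :
    Measurable[MeasurableSpace.comap X inferInstance] fun ω => l ⬝ᵥ (X ω).ofLp := by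
  have h3 : Continuous fun y : EuclideanSpace ℝ ι => l ⬝ᵥ y.ofLp := by
    unfold dotProduct; fun_prop
  exact h3.measurable.comp (comap_measurable X)

lemma map_add_gaussianReal {X Y : Ω → ℝ} (hXY : IndepFun X Y μ) {a b : ℝ} (ha : 0 ≤ a) (hb : 0 ≤ b)
    (hX : μ.map X = gaussianReal 0 a.toNNReal) (hY : μ.map Y = gaussianReal 0 b.toNNReal) :
    μ.map (X + Y) = gaussianReal 0 (a + b).toNNReal := by
  rw [gaussianReal_add_gaussianReal_of_indepFun hXY hX hY, add_zero, Real.toNNReal_add ha hb]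

/-- The current state and the measurements up to the current time are jointly Gaussian. -/
lemma NoiseModel.gaussianFamily (h : NoiseModel μ Sigma0 Q R x₀ w v ζ) (k : ℕ) :
    GaussianFamily (linComb A C x₀ w v k) (linCombVar A Sigma0 Q C R k) μ := by
  have hmeas : ∀ k p, Measurable (linComb A C x₀ w v k p) := fun k p =>
    (measurable_linComb_sigmaOf k p (ζ := ζ) subset_rfl).mono (h.sigmaOf_le _) le_rfl
  have hnonneg : ∀ k p, 0 ≤ linCombVar A Sigma0 Q C R k p := by
    intro k
    induction k with
    | zero =>
      intro p
      rw [linCombVar]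
      exact add_nonneg (quad_nonneg h.Sigma0_posDef.posSemidef _)
        (quad_nonneg h.R_posDef.posSemidef _)
    | succ k ih =>
      intro p
      rw [linCombVar]
      exact add_nonneg (add_nonneg (ih _) (quad_nonneg h.Q_posDef.posSemidef _))
        (quad_nonneg h.R_posDef.posSemidef _)
  refine ⟨hmeas k, hnonneg k, ?_⟩
  induction k with
  | zero =>
    intro p
    rw [linComb_zero, linCombVar]
    refine map_add_gaussianReal ?_ (quad_nonneg h.Sigma0_posDef.posSemidef _)
      (quad_nonneg h.R_posDef.posSemidef _) ?_ ?_
    · exact indepFun_of_indep (h.iIndep.indep (i := .init) (j := .measurement 0) (by simp))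
        (measurable_dotProduct_comap _ _) (measurable_dotProduct_comap _ _)
    · exact map_dotProduct_of_multivariateGaussian h.Sigma0_posDef.posSemidef h.measurable_init
        h.map_init _
    · exact map_dotProduct_of_multivariateGaussian h.R_posDef.posSemidef
        (h.measurable_measurement 0) (h.map_measurement 0) _
  | succ k ih =>
    intro p
    rw [linComb_succ, linCombVar]
    set l := p.1 + (stack C)ᵀ *ᵥ p.2 (k + 1)
    have hw := measurable_dotProduct_comap (w k) l
    have hv := measurable_dotProduct_comap (v (k + 1)) (p.2 (k + 1))
    -- Each fresh noise is absent from the sources of what it is added to, so the sums are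
    -- independent and the variances add.
    refine map_add_gaussianReal ?_ (add_nonneg (hnonneg _ _) (quad_nonneg h.Q_posDef.posSemidef _))
      (quad_nonneg h.R_posDef.posSemidef _) (map_add_gaussianReal ?_ (hnonneg _ _)
      (quad_nonneg h.Q_posDef.posSemidef _) (ih _) ?_) ?_
    · have hST : Disjoint (plantSources m (k + 1) (k + 1)) {Source.measurement (k + 1)} := by
        rw [Set.disjoint_singleton_right]
        simp [plantSources]
      refine indepFun_of_indep (h.indep_sigmaOf hST) (Measurable.add ?_ ?_) ?_
      · exact measurable_linComb_sigmaOf k _ fun a ha => by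
          cases a <;> simp_all [plantSources]; omega
      · exact hw.mono (sourceSigma_le_sigmaOf (a := .process k) (by simp [plantSources])) le_rfl
      · exact hv.mono (sourceSigma_le_sigmaOf (a := .measurement (k + 1)) rfl) le_rfl
    · have hST : Disjoint (plantSources m k (k + 1)) {Source.process k} := by
        rw [Set.disjoint_singleton_right]
        simp [plantSources]
      refine indepFun_of_indep (h.indep_sigmaOf hST) (measurable_linComb_sigmaOf k _ subset_rfl) ?_
      exact hw.mono (sourceSigma_le_sigmaOf (a := .process k) rfl) le_rfl
    · exact map_dotProduct_of_multivariateGaussian h.Q_posDef.posSemidef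
        (h.measurable_process k) (h.map_process k) _
    · exact map_dotProduct_of_multivariateGaussian h.R_posDef.posSemidef
        (h.measurable_measurement _) (h.map_measurement _) _

end Model

/-! ### Kalman recursion for a fixed pattern, as dynamic programming -/

section Pattern

variable {n m : ℕ} {s : Fin m → ℕ}

lemma blockDiagonal'_mulVec_apply (M : (i : Fin m) → Matrix (Fin (s i)) (Fin (s i)) ℝ)
    (r : (i : Fin m) × Fin (s i) → ℝ) (i : Fin m) (a : Fin (s i)) :
    (Matrix.blockDiagonal' M *ᵥ r) ⟨i, a⟩ = (M i *ᵥ fun a => r ⟨i, a⟩) a := by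
  simp only [Matrix.mulVec, dotProduct, Fintype.sum_sigma]
  rw [Finset.sum_eq_single i]
  · simp [Matrix.blockDiagonal'_apply]
  · intro j _ hj
    refine Finset.sum_eq_zero fun b _ => ?_
    rw [Matrix.blockDiagonal'_apply_ne _ _ _ hj.symm, zero_mul]
  · simp

lemma quad_blockDiagonal' (M : (i : Fin m) → Matrix (Fin (s i)) (Fin (s i)) ℝ)
    (r : (i : Fin m) × Fin (s i) → ℝ) :
    quad (Matrix.blockDiagonal' M) r = ∑ i, quad (M i) fun a => r ⟨i, a⟩ := by
  simp only [quad, dotProduct, Fintype.sum_sigma, blockDiagonal'_mulVec_apply]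

variable {A Sigma0 Q : Matrix (Fin n) (Fin n) ℝ}
  {C : (i : Fin m) → Matrix (Fin (s i)) (Fin n) ℝ}
  {R : Matrix ((i : Fin m) × Fin (s i)) ((i : Fin m) × Fin (s i)) ℝ}
  {Y : (i : Fin m) → Matrix (Fin (s i)) (Fin (s i)) ℝ}

/-- The additional measurement noise covariance caused by the silence of the sensors `i` with
`d i = true`. -/
def silentNoise (Y : (i : Fin m) → Matrix (Fin (s i)) (Fin (s i)) ℝ) (d : Fin m → Bool) :
    Matrix ((i : Fin m) × Fin (s i)) ((i : Fin m) × Fin (s i)) ℝ :=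
  Matrix.blockDiagonal' fun i => if d i then (Y i)⁻¹ else 0

/-- The error covariance for the transmission pattern `g`, where `g k i = true` means that sensor
`i` is silent at time `k`. -/
def patternCov (A Sigma0 Q : Matrix (Fin n) (Fin n) ℝ)
    (C : (i : Fin m) → Matrix (Fin (s i)) (Fin n) ℝ)
    (R : Matrix ((i : Fin m) × Fin (s i)) ((i : Fin m) × Fin (s i)) ℝ)
    (Y : (i : Fin m) → Matrix (Fin (s i)) (Fin (s i)) ℝ) (g : ℕ → Fin m → Bool) :
    ℕ → Matrix (Fin n) (Fin n) ℝ
  | 0 => measUpdate (stack C) (R + silentNoise Y (g 0)) Sigma0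
  | k + 1 => measUpdate (stack C) (R + silentNoise Y (g (k + 1)))
      (A * patternCov A Sigma0 Q C R Y g k * Aᵀ + Q)

lemma quad_silentNoise (d : Fin m → Bool) (r : (i : Fin m) × Fin (s i) → ℝ) :
    quad (silentNoise Y d) r = ∑ i, if d i then quad (Y i)⁻¹ (fun a => r ⟨i, a⟩) else 0 := by
  rw [silentNoise, quad_blockDiagonal']
  refine Finset.sum_congr rfl fun i _ => ?_
  split_ifs <;> simp

lemma silentNoise_posSemidef (hY : ∀ i, (Y i).PosDef) (d : Fin m → Bool) :
    (silentNoise Y d).PosSemidef := by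
  refine posSemidef_of_quad ?_ fun t => ?_
  · rw [silentNoise, Matrix.blockDiagonal'_transpose]
    congr 1
    ext1 i
    split_ifs
    · exact transpose_eq_of_posDef (hY i).inv
    · simp
  · rw [quad_silentNoise]
    refine Finset.sum_nonneg fun i _ => ?_
    split_ifs
    · exact quad_nonneg (hY i).inv.posSemidef _
    · exact le_rfl

lemma silentNoise_posDef (hR : R.PosDef) (hY : ∀ i, (Y i).PosDef) (d : Fin m → Bool) :
    (R + silentNoise Y d).PosDef :=
  hR.add_posSemidef (silentNoise_posSemidef hY d)

lemma silentNoise_le (hY : ∀ i, (Y i).PosDef) (d : Fin m → Bool) :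
    silentNoise Y d ≤ silentNoise Y fun _ => true := by
  refine le_of_quad_le (transpose_eq_of_posSemidef (silentNoise_posSemidef hY _))
    (transpose_eq_of_posSemidef (silentNoise_posSemidef hY _)) fun t => ?_
  rw [quad_silentNoise, quad_silentNoise]
  refine Finset.sum_le_sum fun i _ => ?_
  simp only [if_true]
  split_ifs
  · exact le_rfl
  · exact quad_nonneg (hY i).inv.posSemidef _

lemma silentNoise_true (hY : ∀ i, (Y i).PosDef) :
    silentNoise Y (fun _ => true) = (Matrix.blockDiagonal' Y)⁻¹ := by
  symm
  apply Matrix.inv_eq_right_inv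
  rw [silentNoise, ← Matrix.blockDiagonal'_mul]
  have : (fun i => Y i * if true = true then (Y i)⁻¹ else 0) = fun i => 1 := by
    ext1 i
    rw [if_pos rfl, Matrix.mul_nonsing_inv _ (isUnit_iff_ne_zero.2 (hY i).det_pos.ne')]
  rw [this]
  exact Matrix.blockDiagonal'_one

lemma patternCov_posSemidef (hQ : Q.PosDef) (hR : R.PosDef) (hSigma0 : Sigma0.PosDef)
    (hY : ∀ i, (Y i).PosDef) (g : ℕ → Fin m → Bool) (k : ℕ) :
    (patternCov A Sigma0 Q C R Y g k).PosSemidef := by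
  induction k with
  | zero => exact measUpdate_posSemidef (silentNoise_posDef hR hY _) hSigma0.posSemidef
  | succ k ih =>
    exact measUpdate_posSemidef (silentNoise_posDef hR hY _) ((conj_posSemidef ih).add hQ.posSemidef)

lemma patternCov_congr {g g' : ℕ → Fin m → Bool} {k : ℕ} (h : ∀ j ≤ k, g j = g' j) :
    patternCov A Sigma0 Q C R Y g k = patternCov A Sigma0 Q C R Y g' k := by
  induction k with
  | zero => rw [patternCov, patternCov, h 0 le_rfl]
  | succ k ih => rw [patternCov, patternCov, h _ le_rfl, ih fun j hj => h j (by omega)]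

lemma linCombVar_congr {k : ℕ} {t : Fin n → ℝ} {r r' : ℕ → (i : Fin m) × Fin (s i) → ℝ}
    (h : ∀ j ≤ k, r j = r' j) :
    linCombVar A Sigma0 Q C R k (t, r) = linCombVar A Sigma0 Q C R k (t, r') := by
  induction k generalizing t with
  | zero => simp only [linCombVar, h 0 le_rfl]
  | succ k ih =>
    simp only [linCombVar, h _ le_rfl]
    rw [ih fun j hj => h j (by omega)]

/-- Dynamic programming, lower bound. -/
lemma quad_patternCov_le (hQ : Q.PosDef) (hR : R.PosDef) (hSigma0 : Sigma0.PosDef)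
    (hY : ∀ i, (Y i).PosDef) (g : ℕ → Fin m → Bool) (k : ℕ) (t : Fin n → ℝ)
    (r : ℕ → (i : Fin m) × Fin (s i) → ℝ) :
    quad (patternCov A Sigma0 Q C R Y g k) t ≤ linCombVar A Sigma0 Q C R k (t, r)
      + ∑ j ∈ Finset.range (k + 1), quad (silentNoise Y (g j)) (r j) := by
  induction k generalizing t with
  | zero =>
    -- The sign is reversed because `linComb` adds its combination of measurements, whereas a gain
    -- is subtracted.
    have h1 := quad_measUpdate_le (C := stack C) (silentNoise_posDef hR hY (g 0))
      hSigma0.posSemidef t (-r 0)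
    rw [Matrix.mulVec_neg, sub_neg_eq_add, quad_neg_right, quad_add_left] at h1
    simp only [patternCov, linCombVar, zero_add, Finset.sum_range_one]
    linarith
  | succ k ih =>
    have h1 := quad_measUpdate_le (C := stack C) (silentNoise_posDef hR hY (g (k + 1)))
      ((conj_posSemidef (A := A) (patternCov_posSemidef (A := A) (C := C) hQ hR hSigma0 hY g k)).add
        hQ.posSemidef) t (-r (k + 1))
    rw [Matrix.mulVec_neg, sub_neg_eq_add, quad_neg_right, quad_add_left R, quad_add_left,
      quad_conj] at h1
    have h2 := ih (Aᵀ *ᵥ (t + (stack C)ᵀ *ᵥ r (k + 1)))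
    simp only [patternCov, linCombVar]
    rw [Finset.sum_range_succ]
    linarith

/-- Dynamic programming, attainment. -/
lemma exists_quad_patternCov_eq (hQ : Q.PosDef) (hR : R.PosDef) (hSigma0 : Sigma0.PosDef)
    (hY : ∀ i, (Y i).PosDef) (g : ℕ → Fin m → Bool) (k : ℕ) (t : Fin n → ℝ) :
    ∃ r : ℕ → (i : Fin m) × Fin (s i) → ℝ, linCombVar A Sigma0 Q C R k (t, r)
      + ∑ j ∈ Finset.range (k + 1), quad (silentNoise Y (g j)) (r j)
        = quad (patternCov A Sigma0 Q C R Y g k) t := by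
  induction k generalizing t with
  | zero =>
    have h1 := quad_measUpdate_eq (C := stack C) (silentNoise_posDef hR hY (g 0))
      hSigma0.posSemidef t
    set ρ := ((stack C * Sigma0 * (stack C)ᵀ + (R + silentNoise Y (g 0)))⁻¹ * stack C * Sigma0) *ᵥ t
    refine ⟨fun _ => -ρ, ?_⟩
    simp only [patternCov, linCombVar, zero_add, Finset.sum_range_one]
    rw [h1, Matrix.mulVec_neg, ← sub_eq_add_neg, quad_neg_right, quad_neg_right, quad_add_left]
    ring
  | succ k ih =>
    have h1 := quad_measUpdate_eq (C := stack C) (silentNoise_posDef hR hY (g (k + 1)))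
      ((conj_posSemidef (A := A) (patternCov_posSemidef (A := A) (C := C) hQ hR hSigma0 hY g k)).add
        hQ.posSemidef) t
    set ρ := ((stack C * (A * patternCov A Sigma0 Q C R Y g k * Aᵀ + Q) * (stack C)ᵀ
      + (R + silentNoise Y (g (k + 1))))⁻¹ * stack C
        * (A * patternCov A Sigma0 Q C R Y g k * Aᵀ + Q)) *ᵥ t
    obtain ⟨r, hr⟩ := ih (Aᵀ *ᵥ (t + (stack C)ᵀ *ᵥ (-ρ)))
    -- The last coefficient is the optimal gain; the earlier ones are optimal for the direction
    -- propagated back by `Aᵀ`.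
    refine ⟨Function.update r (k + 1) (-ρ), ?_⟩
    have h2 : ∀ j ≤ k, Function.update r (k + 1) (-ρ) j = r j := fun j hj =>
      Function.update_of_ne (by omega) _ _
    simp only [patternCov, linCombVar, Function.update_self]
    rw [Finset.sum_range_succ, linCombVar_congr h2, Function.update_self, h1,
      Finset.sum_congr rfl fun j hj => by rw [h2 j (by rw [Finset.mem_range] at hj; omega)],
      quad_neg_right, quad_neg_right, quad_add_left R, quad_add_left (A * _ * Aᵀ), quad_conj]
    rw [Matrix.mulVec_neg, ← sub_eq_add_neg] at hr ⊢
    linarith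

end Pattern

/-! ### Tilting by the likelihood of the silent sensors -/

section TiltedModel

variable {Ω : Type*} [MeasurableSpace Ω] {n m : ℕ} {s : Fin m → ℕ}
  {μ : Measure Ω} {A Sigma0 Q : Matrix (Fin n) (Fin n) ℝ}
  {C : (i : Fin m) → Matrix (Fin (s i)) (Fin n) ℝ}
  {R : Matrix ((i : Fin m) × Fin (s i)) ((i : Fin m) × Fin (s i)) ℝ}
  {x₀ : Ω → EuclideanSpace ℝ (Fin n)} {w : ℕ → Ω → EuclideanSpace ℝ (Fin n)}
  {v : ℕ → Ω → EuclideanSpace ℝ ((i : Fin m) × Fin (s i))} {ζ : ℕ → Fin m → Ω → ℝ}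
  {Y : (i : Fin m) → Matrix (Fin (s i)) (Fin (s i)) ℝ}

/-- The exponent `∑ y' Y y` collected from the silent sensors up to time `k`. -/
def silentExponent (Y : (i : Fin m) → Matrix (Fin (s i)) (Fin (s i)) ℝ)
    (y : ℕ → (i : Fin m) → Ω → Fin (s i) → ℝ) (g : ℕ → Fin m → Bool) (k : ℕ) (ω : Ω) : ℝ :=
  ∑ j ∈ Finset.range (k + 1), ∑ i, if g j i then quad (Y i) (y j i ω) else 0

/-- Coefficients supported on the transmitted measurements of the pattern `g`. -/
def IsTransmitted (g : ℕ → Fin m → Bool) (r : ℕ → (i : Fin m) × Fin (s i) → ℝ) : Prop :=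
  ∀ j i a, g j i = true → r j ⟨i, a⟩ = 0

lemma sum_filter_silent (g : ℕ → Fin m → Bool) (k : ℕ) (f : ℕ → (i : Fin m) × Fin (s i) → ℝ) :
    ∑ b ∈ (Finset.range (k + 1) ×ˢ Finset.univ).filter
        (fun b : ℕ × ((i : Fin m) × Fin (s i)) => g b.1 b.2.1 = true), f b.1 b.2
      = ∑ j ∈ Finset.range (k + 1), ∑ i, if g j i then ∑ a, f j ⟨i, a⟩ else 0 := by
  rw [Finset.sum_filter, Finset.sum_product]
  refine Finset.sum_congr rfl fun j _ => ?_
  rw [Fintype.sum_sigma]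
  refine Finset.sum_congr rfl fun i _ => ?_
  split_ifs <;> simp [*]

/-- After weighting with the likelihood of the silent sensors, the model is still Gaussian, and
the minimal variance of the error of a linear estimator based on the transmitted measurements is
given by `patternCov`. -/
lemma NoiseModel.exists_gaussianFamily_tilted (h : NoiseModel μ Sigma0 Q R x₀ w v ζ)
    (hY : ∀ i, (Y i).PosDef) (g : ℕ → Fin m → Bool) (k : ℕ) :
    ∃ q : (Fin n → ℝ) × (ℕ → (i : Fin m) × Fin (s i) → ℝ) → ℝ,
      GaussianFamily (linComb A C x₀ w v k) q
        (μ.tilted fun ω => -(silentExponent Y (meas C (state A x₀ w) v) g k ω) / 2) ∧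
      (∀ t r, IsTransmitted g r → quad (patternCov A Sigma0 Q C R Y g k) t ≤ q (t, r)) ∧
      ∀ t, ∃ r, IsTransmitted g r ∧ q (t, r) = quad (patternCov A Sigma0 Q C R Y g k) t := by
  classical
  choose B hBt hBB hBu using fun i => exists_sqrt (hY i)
  -- With `B i` a square root of `Y i`, the exponent is a sum of squares of the forms `linComb` at
  -- `c b`, one per component of a silent measurement.
  set c : ℕ × ((i : Fin m) × Fin (s i)) → (Fin n → ℝ) × (ℕ → (i : Fin m) × Fin (s i) → ℝ) :=
    fun b => (0, Pi.single b.1 (Matrix.blockDiagonal' B b.2)) with hc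
  set F := (Finset.range (k + 1) ×ˢ Finset.univ).filter
        (fun b : ℕ × ((i : Fin m) × Fin (s i)) => g b.1 b.2.1 = true) with hF
  obtain ⟨q, hq, hmin⟩ := (h.gaussianFamily (A := A) (C := C) k).tilted_sum_sq c F
  have hexp : ∀ ω, ∑ b ∈ F, (linComb A C x₀ w v k (c b) ω) ^ 2
      = silentExponent Y (meas C (state A x₀ w) v) g k ω := by
    intro ω
    have h1 : ∀ b ∈ F, (linComb A C x₀ w v k (c b) ω) ^ 2
        = (Matrix.blockDiagonal' B *ᵥ stackMeas C (state A x₀ w) v b.1 ω) b.2 ^ 2 := fun b hb => by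
      congr 1
      have hb1 : b.1 ∈ Finset.range (k + 1) :=
        (Finset.mem_product.1 (Finset.mem_filter.1 hb).1).1
      rw [linComb_apply, zero_dotProduct, zero_add, Finset.sum_eq_single b.1]
      · simp only [hc, Pi.single_eq_same]
        rfl
      · intro j _ hj
        simp only [hc, Pi.single_eq_of_ne hj, zero_dotProduct]
      · exact fun hh => absurd hb1 hh
    rw [Finset.sum_congr rfl h1, hF, sum_filter_silent g k fun j p =>
      (Matrix.blockDiagonal' B *ᵥ stackMeas C (state A x₀ w) v j ω) p ^ 2]
    refine Finset.sum_congr rfl fun j _ => Finset.sum_congr rfl fun i _ => ?_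
    simp only [blockDiagonal'_mulVec_apply]
    rw [quad_eq_sum_sq (hBt i) (hBB i)]
    rfl
  simp only [hexp] at hq
  -- the combination of directions with coefficients `σ`
  have hcomb : ∀ σ : ℕ × ((i : Fin m) × Fin (s i)) → ℝ, ∑ b ∈ F, σ b • c b
      = (0, fun j p => if j ∈ Finset.range (k + 1) then
          (if g j p.1 then (B p.1 *ᵥ fun a => σ (j, ⟨p.1, a⟩)) p.2 else 0) else 0) := by
    intro σ
    refine Prod.ext ?_ ?_
    · simp [hc, Prod.fst_sum]
    · ext j ⟨i, a⟩
      have e1 : ∀ b, (σ b • c b).2 j ⟨i, a⟩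
          = (fun j' p => if j' = j then σ (j', p) * Matrix.blockDiagonal' B p ⟨i, a⟩ else 0) b.1 b.2 := by
        rintro ⟨j', p⟩
        simp only [hc, Prod.smul_snd, Pi.smul_apply, smul_eq_mul]
        by_cases hj : j' = j
        · subst hj; simp
        · rw [if_neg hj, Pi.single_eq_of_ne (Ne.symm hj)]; simp
      rw [Prod.snd_sum, Finset.sum_apply, Finset.sum_apply, Finset.sum_congr rfl fun b _ => e1 b, hF,
        sum_filter_silent g k fun j' p =>
          if j' = j then σ (j', p) * Matrix.blockDiagonal' B p ⟨i, a⟩ else 0]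
      have e2 : ∀ j', (∑ i', if g j' i' = true then ∑ a', (if j' = j then σ (j', ⟨i', a'⟩) *
          Matrix.blockDiagonal' B ⟨i', a'⟩ ⟨i, a⟩ else 0) else 0)
          = if j' = j then (if g j i then (B i *ᵥ fun a => σ (j, ⟨i, a⟩)) a else 0) else 0 := by
        intro j'
        by_cases hj : j' = j
        · subst hj
          simp only [if_true]
          rw [Finset.sum_eq_single i]
          · split_ifs with hg
            · simp only [Matrix.mulVec, dotProduct, Matrix.blockDiagonal'_apply_eq]
              refine Finset.sum_congr rfl fun a' _ => ?_
              rw [mul_comm, ← Matrix.transpose_apply (B i), hBt i]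
            · rfl
          · intro i' _ hi'
            split_ifs
            · refine Finset.sum_eq_zero fun a' _ => ?_
              rw [Matrix.blockDiagonal'_apply_ne _ _ _ hi', mul_zero]
            · rfl
          · simp
        · simp [hj]
      rw [Finset.sum_congr rfl fun j' _ => e2 j', Finset.sum_ite_eq']
  have hsq : ∀ σ : ℕ × ((i : Fin m) × Fin (s i)) → ℝ, ∑ b ∈ F, σ b ^ 2
      = ∑ j ∈ Finset.range (k + 1), ∑ i, if g j i then ∑ a, σ (j, ⟨i, a⟩) ^ 2 else 0 := fun σ => by
    rw [hF]; exact sum_filter_silent g k fun j p => σ (j, p) ^ 2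
  have hinv : ∀ i (z : Fin (s i) → ℝ), quad (Y i)⁻¹ z = ∑ a, ((B i)⁻¹ *ᵥ z) a ^ 2 := fun i z =>
    quad_eq_sum_sq (by rw [Matrix.transpose_nonsing_inv, hBt])
      (by rw [← Matrix.mul_inv_rev, hBB]) z
  have hlower : ∀ t r, IsTransmitted g r → quad (patternCov A Sigma0 Q C R Y g k) t ≤ q (t, r) := by
    intro t r hr
    obtain ⟨σ, hσ⟩ := (hmin (t, r)).2
    rw [hσ, hcomb, Prod.mk_add_mk, add_zero, hsq]
    -- The minimiser over the tilt is itself a choice of coefficients on the silent measurements,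
    -- and its penalty `∑ σ ^ 2` is their form under `(Y i)⁻¹`, that is, the cost of `silentNoise`.
    set u : ℕ → (i : Fin m) × Fin (s i) → ℝ := fun j p => if j ∈ Finset.range (k + 1) then
      (if g j p.1 then (B p.1 *ᵥ fun a => σ (j, ⟨p.1, a⟩)) p.2 else 0) else 0 with hu
    refine (quad_patternCov_le h.Q_posDef h.R_posDef h.Sigma0_posDef hY g k t (r + u)).trans_eq ?_
    congr 1
    refine Finset.sum_congr rfl fun j hj => ?_
    rw [quad_silentNoise]
    refine Finset.sum_congr rfl fun i _ => ?_
    split_ifs with hg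
    · rw [hinv]
      have e3 : (fun a => (r + u) j ⟨i, a⟩) = B i *ᵥ fun a => σ (j, ⟨i, a⟩) := by
        ext a
        simp only [hu, Pi.add_apply, hr j i a hg, zero_add, if_pos hj, if_pos hg]
      rw [e3, Matrix.mulVec_mulVec, Matrix.nonsing_inv_mul _ (hBu i), Matrix.one_mulVec]
    · rfl
  refine ⟨q, hq, hlower, fun t => ?_⟩
  obtain ⟨ρ, hρ⟩ := exists_quad_patternCov_eq (A := A) (C := C) h.Q_posDef h.R_posDef
    h.Sigma0_posDef hY g k t
  -- The optimal `ρ` is split: its transmitted part is the estimator, its silent part enters the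
  -- tilt through `(B i)⁻¹`.
  set r : ℕ → (i : Fin m) × Fin (s i) → ℝ := fun j p => if g j p.1 then 0 else ρ j p
  have hr : IsTransmitted g r := fun j i a hg => by simp [r, hg]
  refine ⟨r, hr, le_antisymm ?_ (hlower t r hr)⟩
  have h2 := (hmin (t, r)).1 fun b => ((B b.2.1)⁻¹ *ᵥ fun a => ρ b.1 ⟨b.2.1, a⟩) b.2.2
  rw [hcomb, Prod.mk_add_mk, add_zero, hsq] at h2
  refine h2.trans_eq ?_
  rw [← hρ]
  congr 1
  · refine linCombVar_congr fun j hj => ?_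
    ext ⟨i, a⟩
    have hj' : j ∈ Finset.range (k + 1) := Finset.mem_range.2 (by omega)
    simp only [Pi.add_apply, if_pos hj', r]
    by_cases hg : g j i = true
    · rw [if_pos hg, if_pos hg, zero_add]
      have := congr_fun (Matrix.mulVec_mulVec (fun a => ρ j ⟨i, a⟩) (B i) (B i)⁻¹) a
      rw [Matrix.mul_nonsing_inv _ (hBu i), Matrix.one_mulVec] at this
      exact this
    · rw [if_neg hg, if_neg hg, add_zero]
  · refine Finset.sum_congr rfl fun j hj => ?_
    rw [quad_silentNoise]
    refine Finset.sum_congr rfl fun i _ => ?_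
    split_ifs
    · rw [hinv]
    · rfl

end TiltedModel

/-! ### Averaging out the uniform trigger variables -/

section Thinning

variable {Ω : Type*} {𝓖 𝓗 mΩ : MeasurableSpace Ω} {μ : Measure Ω} [IsProbabilityMeasure μ]

/-- Averaging out an independent uniform random variable. -/
lemma integral_mul_ite_le_of_uniform (h𝓖 : 𝓖 ≤ mΩ) {U f p : Ω → ℝ} (hU : Measurable U)
    (hUmap : μ.map U = (volume : Measure ℝ).restrict (Set.Icc 0 1))
    (hind : Indep 𝓖 (MeasurableSpace.comap U inferInstance) μ)
    (hf : Measurable[𝓖] f) (hfi : Integrable f μ) (hp : Measurable[𝓖] p)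
    (hp0 : ∀ ω, 0 ≤ p ω) (hp1 : ∀ ω, p ω ≤ 1) :
    ∫ ω, f ω * (if U ω ≤ p ω then 1 else 0) ∂μ = ∫ ω, f ω * p ω ∂μ := by
  have hfp : Measurable[𝓖] fun ω => (f ω, p ω) := hf.prodMk hp
  have hfp' : Measurable fun ω => (f ω, p ω) := hfp.mono h𝓖 le_rfl
  -- The pair `(f, p)` is independent of `U`, so Fubini integrates `U` out with `p` frozen; the
  -- inner integral is the length of `[0, p]`.
  have hI : IndepFun (fun ω => (f ω, p ω)) U μ := by
    rw [IndepFun_iff_Indep]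
    exact indep_of_indep_of_le_left hind hfp.comap_le
  rw [indepFun_iff_map_prod_eq_prod_map_map hfp'.aemeasurable hU.aemeasurable] at hI
  have hset : MeasurableSet {z : (ℝ × ℝ) × ℝ | z.2 ≤ z.1.2} :=
    measurableSet_le measurable_snd (measurable_snd.comp measurable_fst)
  have hF : Measurable fun z : (ℝ × ℝ) × ℝ => z.1.1 * (if z.2 ≤ z.1.2 then (1 : ℝ) else 0) :=
    (measurable_fst.comp measurable_fst).mul (Measurable.ite hset measurable_const measurable_const)
  have hUp : IsProbabilityMeasure (μ.map U) := Measure.isProbabilityMeasure_map hU.aemeasurable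
  have hFi : Integrable (fun z : (ℝ × ℝ) × ℝ => z.1.1 * (if z.2 ≤ z.1.2 then (1 : ℝ) else 0))
      ((μ.map fun ω => (f ω, p ω)).prod (μ.map U)) := by
    rw [← hI, integrable_map_measure hF.aestronglyMeasurable (hfp'.prodMk hU).aemeasurable]
    refine hfi.mono (hF.comp (hfp'.prodMk hU)).aestronglyMeasurable (ae_of_all _ fun ω => ?_)
    simp only [Function.comp_apply]
    split_ifs <;> simp
  have h1 := integral_map (μ := μ) (hfp'.prodMk hU).aemeasurable hF.aestronglyMeasurable
  simp only at h1
  rw [← h1, hI, integral_prod _ hFi, integral_map hfp'.aemeasurable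
    hFi.1.integral_prod_right']
  refine integral_congr_ae (ae_of_all _ fun ω => ?_)
  simp only
  rw [integral_const_mul, hUmap]
  congr 1
  have h2 : (fun u : ℝ => if u ≤ p ω then (1 : ℝ) else 0) = (Set.Iic (p ω)).indicator 1 := by
    ext u; simp [Set.indicator_apply]
  rw [h2, integral_indicator_one measurableSet_Iic, measureReal_def,
    Measure.restrict_apply measurableSet_Iic]
  have h3 : Set.Iic (p ω) ∩ Set.Icc 0 1 = Set.Icc 0 (p ω) := by
    ext u
    simp only [Set.mem_inter_iff, Set.mem_Iic, Set.mem_Icc]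
    exact ⟨fun hu => ⟨hu.2.1, hu.1⟩, fun hu => ⟨hu.2, hu.1, hu.2.trans (hp1 ω)⟩⟩
  rw [h3, Real.volume_Icc, sub_zero, ENNReal.toReal_ofReal (hp0 ω)]

omit [IsProbabilityMeasure μ] in
lemma measurable_prod_ite_le {ι : Type*} {U p : ι → Ω → ℝ} (hp : ∀ b, Measurable[𝓗] (p b))
    (g : ι → Bool) (F : Finset ι) :
    Measurable[𝓗 ⊔ ⨆ b ∈ F, MeasurableSpace.comap (U b) inferInstance]
      fun ω => ∏ b ∈ F, (if decide (U b ω ≤ p b ω) = g b then (1 : ℝ) else 0) := by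
  let 𝓖 : MeasurableSpace Ω := 𝓗 ⊔ ⨆ b ∈ F, MeasurableSpace.comap (U b) inferInstance
  refine Finset.measurable_prod _ fun b hb => ?_
  have h0 : MeasurableSpace.comap (U b) inferInstance
      ≤ ⨆ b ∈ F, MeasurableSpace.comap (U b) inferInstance :=
    le_iSup₂_of_le (f := fun b (_ : b ∈ F) => MeasurableSpace.comap (U b) inferInstance) b hb le_rfl
  have h1 : Measurable[𝓖] (U b) := (comap_measurable (U b)).mono (h0.trans le_sup_right) le_rfl
  have h2 : Measurable[𝓖] (p b) := (hp b).mono le_sup_left le_rfl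
  have h3 : MeasurableSet[𝓖] {ω | U b ω ≤ p b ω} := measurableSet_le h1 h2
  refine Measurable.ite ?_ measurable_const measurable_const
  cases g b
  · have h4 : MeasurableSet[𝓖] {ω | p b ω < U b ω} := measurableSet_lt h2 h1
    simpa using h4
  · simpa using h3

/-- Averaging out several independent uniform random variables. -/
lemma integral_mul_prod_ite_le_of_uniform {ι : Type*} [DecidableEq ι]
    (h𝓗 : 𝓗 ≤ mΩ) {U p : ι → Ω → ℝ} (hU : ∀ b, Measurable (U b))
    (hUmap : ∀ b, μ.map (U b) = (volume : Measure ℝ).restrict (Set.Icc 0 1))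
    (hind : ∀ (F : Finset ι) (a : ι), a ∉ F →
      Indep (𝓗 ⊔ ⨆ b ∈ F, MeasurableSpace.comap (U b) inferInstance)
        (MeasurableSpace.comap (U a) inferInstance) μ)
    (hp : ∀ b, Measurable[𝓗] (p b)) (hp0 : ∀ b ω, 0 ≤ p b ω) (hp1 : ∀ b ω, p b ω ≤ 1)
    (g : ι → Bool) (F : Finset ι) {f : Ω → ℝ} (hf : Measurable[𝓗] f) (hfi : Integrable f μ) :
    ∫ ω, f ω * ∏ b ∈ F, (if decide (U b ω ≤ p b ω) = g b then 1 else 0) ∂μ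
      = ∫ ω, f ω * ∏ b ∈ F, (if g b then p b ω else 1 - p b ω) ∂μ := by
  induction F using Finset.induction_on generalizing f with
  | empty => simp
  | insert a F ha ih =>
    have hq : Measurable[𝓗] fun ω => if g a then p a ω else 1 - p a ω := by
      split_ifs
      · exact hp a
      · exact measurable_const.sub (hp a)
    have hq0 : ∀ ω, 0 ≤ (if g a then p a ω else 1 - p a ω) := fun ω => by
      split_ifs
      · exact hp0 a ω
      · linarith [hp1 a ω]
    have hq1 : ∀ ω, (if g a then p a ω else 1 - p a ω) ≤ 1 := fun ω => by
      split_ifs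
      · exact hp1 a ω
      · linarith [hp0 a ω]
    set q : Ω → ℝ := fun ω => if g a then p a ω else 1 - p a ω with hqdef
    -- the other factors
    set X : Ω → ℝ := fun ω => ∏ b ∈ F, (if decide (U b ω ≤ p b ω) = g b then 1 else 0) with hX
    have h𝓖le : 𝓗 ⊔ ⨆ b ∈ F, MeasurableSpace.comap (U b) inferInstance ≤ mΩ :=
      sup_le h𝓗 (iSup₂_le fun b _ => (hU b).comap_le)
    have hXm := measurable_prod_ite_le (U := U) hp g F
    have hX01 : ∀ ω, |X ω| ≤ 1 := fun ω => by
      rw [hX, Finset.abs_prod]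
      refine Finset.prod_le_one (fun _ _ => abs_nonneg _) fun b _ => ?_
      split_ifs <;> simp
    have hfX : Measurable[𝓗 ⊔ ⨆ b ∈ F, MeasurableSpace.comap (U b) inferInstance]
        fun ω => f ω * X ω := (hf.mono le_sup_left le_rfl).mul hXm
    have hbd : ∀ {f' : Ω → ℝ}, Integrable f' μ → ∀ {Z : Ω → ℝ}, Measurable Z → (∀ ω, |Z ω| ≤ 1) →
        Integrable (fun ω => f' ω * Z ω) μ := fun hf' Z hZ hZ1 =>
      hf'.mul_bdd (c := 1) hZ.aestronglyMeasurable (ae_of_all _ fun ω => hZ1 ω)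
    have hfXi : Integrable (fun ω => f ω * X ω) μ := hbd hfi (hXm.mono h𝓖le le_rfl) hX01
    -- The remaining indicators are measurable for the enlarged σ-algebra, so the one-variable case
    -- applies to `f * X`.
    have key := integral_mul_ite_le_of_uniform h𝓖le (hU a) (hUmap a) (hind F a ha) hfX hfXi
      ((hp a).mono le_sup_left le_rfl) (hp0 a) (hp1 a)
    have hple : MeasurableSet {ω | U a ω ≤ p a ω} :=
      measurableSet_le (hU a) ((hp a).mono h𝓗 le_rfl)
    have key' : ∫ ω, f ω * X ω * (if decide (U a ω ≤ p a ω) = g a then 1 else 0) ∂μ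
        = ∫ ω, f ω * X ω * q ω ∂μ := by
      simp only [hqdef]
      cases g a
      · have e1 : ∀ ω, f ω * X ω * (if decide (U a ω ≤ p a ω) = false then 1 else 0)
            = f ω * X ω - f ω * X ω * (if U a ω ≤ p a ω then 1 else 0) := fun ω => by
          by_cases hω : U a ω ≤ p a ω <;> simp [hω]
        have e2 : ∀ ω, f ω * X ω * (if false = true then p a ω else 1 - p a ω)
            = f ω * X ω - f ω * X ω * p a ω := fun ω => by simp; ring
        simp only [e1, e2]
        rw [integral_sub hfXi, integral_sub hfXi, key]
        · exact hbd hfXi ((hp a).mono h𝓗 le_rfl) fun ω => abs_le.2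
            ⟨by linarith [hp0 a ω], hp1 a ω⟩
        · refine hbd hfXi (Measurable.ite hple measurable_const measurable_const) fun ω => ?_
          split_ifs <;> simp
      · simpa using key
    have e3 : ∀ ω, f ω * ∏ b ∈ insert a F, (if decide (U b ω ≤ p b ω) = g b then 1 else 0)
        = f ω * X ω * (if decide (U a ω ≤ p a ω) = g a then 1 else 0) := fun ω => by
      rw [Finset.prod_insert ha]; simp only [hX]; ring
    have e4 : ∀ ω, f ω * ∏ b ∈ insert a F, (if g b then p b ω else 1 - p b ω)
        = f ω * q ω * ∏ b ∈ F, (if g b then p b ω else 1 - p b ω) := fun ω => by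
      rw [Finset.prod_insert ha]; simp only [hqdef]; ring
    simp only [e3, e4]
    -- The factor `q` is `𝓗`-measurable and is absorbed into `f`; hence the induction over arbitrary
    -- `f`.
    rw [key', ← ih (f := fun ω => f ω * q ω) (hf.mul hq) (hbd hfi (hq.mono h𝓗 le_rfl) fun ω => abs_le.2
      ⟨by linarith [hq0 ω], hq1 ω⟩)]
    refine integral_congr_ae (ae_of_all _ fun ω => ?_)
    simp only [hX]
    ring

end Thinning

/-! ### The optimal linear estimator on a fixed pattern -/

section Estimator

variable {Ω : Type*} [MeasurableSpace Ω] {n m : ℕ} {s : Fin m → ℕ}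
  {μ : Measure Ω} {A Sigma0 Q : Matrix (Fin n) (Fin n) ℝ}
  {C : (i : Fin m) → Matrix (Fin (s i)) (Fin n) ℝ}
  {R : Matrix ((i : Fin m) × Fin (s i)) ((i : Fin m) × Fin (s i)) ℝ}
  {x₀ : Ω → EuclideanSpace ℝ (Fin n)} {w : ℕ → Ω → EuclideanSpace ℝ (Fin n)}
  {v : ℕ → Ω → EuclideanSpace ℝ ((i : Fin m) × Fin (s i))} {ζ : ℕ → Fin m → Ω → ℝ}
  {Y : (i : Fin m) → Matrix (Fin (s i)) (Fin (s i)) ℝ}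

/-- The measurements transmitted up to time `k` according to the pattern `g`. -/
def transmitted (C : (i : Fin m) → Matrix (Fin (s i)) (Fin n) ℝ)
    (x : ℕ → Ω → EuclideanSpace ℝ (Fin n))
    (v : ℕ → Ω → EuclideanSpace ℝ ((i : Fin m) × Fin (s i))) (g : ℕ → Fin m → Bool) (k : ℕ) (ω : Ω) :
    Fin (k + 1) × ((i : Fin m) × Fin (s i)) → ℝ :=
  fun b => if g b.1 b.2.1 then 0 else stackMeas C x v b.1 ω b.2

lemma NoiseModel.isProbabilityMeasure (h : NoiseModel μ Sigma0 Q R x₀ w v ζ) :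
    IsProbabilityMeasure μ :=
  (h.gaussianFamily (A := 0) (C := 0) 0).isProbabilityMeasure

/-- On the pattern `g` the state is the sum of a linear function of the transmitted measurements
and an error whose weighted moments, given the transmitted measurements, are deterministic. -/
lemma NoiseModel.exists_linear_estimator (h : NoiseModel μ Sigma0 Q R x₀ w v ζ)
    (hY : ∀ i, (Y i).PosDef) (g : ℕ → Fin m → Bool) (k : ℕ) :
    ∃ r : Fin n → ℕ → (i : Fin m) × Fin (s i) → ℝ, (∀ a, IsTransmitted g (r a)) ∧
      ∀ H : (Fin (k + 1) × ((i : Fin m) × Fin (s i)) → ℝ) → ℝ, Measurable H →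
        (∀ a, ∫ ω, linComb A C x₀ w v k (Pi.single a 1, r a) ω
            * H (transmitted C (state A x₀ w) v g k ω)
            * Real.exp (-(silentExponent Y (meas C (state A x₀ w) v) g k ω) / 2) ∂μ = 0) ∧
        ∀ a b, ∫ ω, linComb A C x₀ w v k (Pi.single a 1, r a) ω
            * linComb A C x₀ w v k (Pi.single b 1, r b) ω
            * H (transmitted C (state A x₀ w) v g k ω)
            * Real.exp (-(silentExponent Y (meas C (state A x₀ w) v) g k ω) / 2) ∂μ
          = patternCov A Sigma0 Q C R Y g k a b * ∫ ω, H (transmitted C (state A x₀ w) v g k ω)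
            * Real.exp (-(silentExponent Y (meas C (state A x₀ w) v) g k ω) / 2) ∂μ := by
  obtain ⟨q, hq, hlow, hatt⟩ := h.exists_gaussianFamily_tilted (A := A) (C := C) hY g k
  set E := silentExponent Y (meas C (state A x₀ w) v) g k with hE
  set L := linComb A C x₀ w v k
  set P := patternCov A Sigma0 Q C R Y g k
  have hPt : Pᵀ = P := transpose_eq_of_posSemidef
    (patternCov_posSemidef h.Q_posDef h.R_posDef h.Sigma0_posDef hY g k)
  set ν := μ.tilted fun ω => -(E ω) / 2 with hν
  have := h.isProbabilityMeasure
  have hνp := hq.isProbabilityMeasure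
  -- A tilt by a non-integrable exponential would be the zero measure, but the tilt is a probability
  -- measure.
  have hexp : Integrable (fun ω => Real.exp (-(E ω) / 2)) μ := by
    by_contra hcon
    have := tilted_of_not_integrable hcon
    rw [← hν] at this
    exact IsProbabilityMeasure.ne_zero ν this
  have hZ := integral_exp_pos hexp
  set Z := ∫ ω, Real.exp (-(E ω) / 2) ∂μ
  have htilt : ∀ f : Ω → ℝ, ∫ ω, f ω * Real.exp (-(E ω) / 2) ∂μ = Z * ∫ ω, f ω ∂ν := fun f => by
    rw [hν, integral_tilted, ← integral_const_mul]
    refine integral_congr_ae (ae_of_all _ fun ω => ?_)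
    simp only [smul_eq_mul]
    change _ = Z * (_ / Z * _)
    field_simp
  choose r hr hqr using fun a : Fin n => hatt (Pi.single a 1)
  refine ⟨r, hr, fun H hH => ?_⟩
  set z : Fin n → (Fin n → ℝ) × (ℕ → (i : Fin m) × Fin (s i) → ℝ) :=
    fun a => (Pi.single a 1, r a) with hz
  -- Silent components get the zero vector, so evaluating `L` on `y` reproduces the vector
  -- `transmitted`.
  set y : Fin (k + 1) × ((i : Fin m) × Fin (s i)) →
      (Fin n → ℝ) × (ℕ → (i : Fin m) × Fin (s i) → ℝ) := fun b =>
    (0, if g b.1 b.2.1 then 0 else Pi.single (b.1 : ℕ) (Pi.single b.2 1)) with hy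
  have hyT : ∀ b, IsTransmitted g (y b).2 := fun b j i a hg => by
    simp only [hy]
    split_ifs with hb
    · rfl
    · by_cases hj : j = b.1
      · subst hj
        have : (⟨i, a⟩ : (i : Fin m) × Fin (s i)) ≠ b.2 := by
          rintro hia
          rw [← hia] at hb
          exact hb hg
        rw [Pi.single_eq_same, Pi.single_eq_of_ne this]
      · rw [Pi.single_eq_of_ne hj]; rfl
  have hLy : ∀ ω, transmitted C (state A x₀ w) v g k ω = fun b => L (y b) ω := by
    intro ω
    ext b
    rw [transmitted, linComb_apply, zero_dotProduct, zero_add]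
    simp only [hy]
    split_ifs
    · simp
    · rw [Finset.sum_eq_single (b.1 : ℕ)]
      · rw [Pi.single_eq_same, single_one_dotProduct]
      · intro j _ hj
        rw [Pi.single_eq_of_ne hj, zero_dotProduct]
      · intro hb
        exact absurd (Finset.mem_range.2 b.1.2) hb
  -- Adding a multiple of a transmitted measurement to the estimator leaves it admissible, so
  -- minimality forces zero covariance.
  have hcov : ∀ a b, cov[L (z a), L (y b); ν] = 0 := fun a b => by
    refine hq.covariance_eq_zero_of_min _ _ fun u => ?_
    have h1 : z a + u • y b = (Pi.single a 1, r a + u • (y b).2) := by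
      simp [hz, hy]
    rw [h1, hqr a]
    refine hlow _ _ fun j i c hg => ?_
    rw [Pi.add_apply, Pi.add_apply, hr a j i c hg, Pi.smul_apply, Pi.smul_apply, hyT b j i c hg]
    simp
  have hind := hq.indepFun_pi z y hcov
  -- parallelogram law
  have hcovz : ∀ a b, ∫ ω, L (z a) ω * L (z b) ω ∂ν = P a b := fun a b => by
    rw [← hq.covariance_eq_integral]
    have h1 := hq.q_add_smul (z a) (z b) 1
    have h2 := hq.q_add_smul (z a) (z b) (-1)
    -- The bound for the sum gives `P a b ≤ cov`, the one for the difference `cov ≤ P a b`.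
    have h3 : quad P (Pi.single a 1 + Pi.single b 1) ≤ q (z a + (1 : ℝ) • z b) := by
      have : z a + (1 : ℝ) • z b = (Pi.single a 1 + Pi.single b 1, r a + r b) := by
        rw [one_smul]; rfl
      rw [this]
      refine hlow _ _ fun j i c hg => ?_
      rw [Pi.add_apply, Pi.add_apply, hr a j i c hg, hr b j i c hg, add_zero]
    have h4 : quad P (Pi.single a 1 + -Pi.single b 1) ≤ q (z a + (-1 : ℝ) • z b) := by
      have : z a + (-1 : ℝ) • z b = (Pi.single a 1 + -Pi.single b 1, r a + -r b) := by
        rw [neg_one_smul]; rfl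
      rw [this]
      refine hlow _ _ fun j i c hg => ?_
      rw [Pi.add_apply, Pi.add_apply, hr a j i c hg, Pi.neg_apply, Pi.neg_apply, hr b j i c hg]
      simp
    have h5 := quad_add_right hPt (Pi.single a 1) (Pi.single b 1)
    have h6 := quad_add_right hPt (Pi.single a 1) (-Pi.single b 1)
    rw [quad_neg_right, Matrix.mulVec_neg, dotProduct_neg] at h6
    have h7 : (Pi.single a 1 : Fin n → ℝ) ⬝ᵥ (P *ᵥ Pi.single b 1) = P a b := by
      simp
    have h8 : q (z a) = quad P (Pi.single a 1) := hqr a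
    have h9 : q (z b) = quad P (Pi.single b 1) := hqr b
    rw [h7] at h5 h6
    linarith
  have hzm : Measurable fun ω i => L (z i) ω := measurable_pi_lambda _ fun i => hq.measurable _
  have hym : Measurable fun ω i => L (y i) ω := measurable_pi_lambda _ fun i => hq.measurable _
  constructor
  · intro a
    rw [htilt, mul_eq_zero]
    right
    simp only [hLy]
    have h1 := hind.integral_fun_comp_mul_comp (𝕜 := ℝ) (f := fun u => u a) (g := H)
      hzm.aemeasurable hym.aemeasurable (measurable_pi_apply a).aestronglyMeasurable
      hH.aestronglyMeasurable
    rw [hq.integral_eq_zero, zero_mul] at h1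
    exact h1
  · intro a b
    rw [htilt, htilt]
    simp only [hLy]
    have h1 := hind.integral_fun_comp_mul_comp (𝕜 := ℝ) (f := fun u => u a * u b) (g := H)
      hzm.aemeasurable hym.aemeasurable
      ((measurable_pi_apply a).mul (measurable_pi_apply b)).aestronglyMeasurable
      hH.aestronglyMeasurable
    rw [hcovz] at h1
    change Z * ∫ ω, L (z a) ω * L (z b) ω * H (fun b => L (y b) ω) ∂ν = _
    rw [h1]
    ring

end Estimator

/-- Here `e` is a candidate estimation error: `X - e` is `I`-measurable and `e` integrates to zero
over sets of `I`, so `X - e` is the conditional expectation coordinatewise. The same uniqueness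
argument identifies `P` as the conditional second moment of `e`. -/
lemma condErrCov_eq_of_setIntegral {Ω : Type*} {mΩ : MeasurableSpace Ω} {n : ℕ} {μ : Measure Ω}
    [IsProbabilityMeasure μ] {I : MeasurableSpace Ω} (hI : I ≤ mΩ)
    {X : Ω → EuclideanSpace ℝ (Fin n)} (hX : Integrable X μ) {e : Fin n → Ω → ℝ}
    {P : Ω → Matrix (Fin n) (Fin n) ℝ}
    (hest : ∀ a, Measurable[I] fun ω => X ω a - e a ω)
    (hP : ∀ a b, Measurable[I] fun ω => P ω a b) (he : ∀ a, Integrable (e a) μ)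
    (hee : ∀ a b, Integrable (fun ω => e a ω * e b ω) μ)
    (hPi : ∀ a b, Integrable (fun ω => P ω a b) μ)
    (h1 : ∀ S, MeasurableSet[I] S → ∀ a, ∫ ω in S, e a ω ∂μ = 0)
    (h2 : ∀ S, MeasurableSet[I] S → ∀ a b,
      ∫ ω in S, e a ω * e b ω ∂μ = ∫ ω in S, P ω a b ∂μ) :
    ∀ᵐ ω ∂μ, condErrCov μ I X ω = P ω := by
  have hXa : ∀ a, Integrable (fun ω => X ω a) μ := fun a =>
    (EuclideanSpace.proj (𝕜 := ℝ) a).integrable_comp hX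
  have e1 : ∀ a, (fun ω => X ω a - e a ω) =ᵐ[μ] μ[fun ω => X ω a | I] := fun a => by
    refine ae_eq_condExp_of_forall_setIntegral_eq hI (hXa a)
      (fun S _ _ => ((hXa a).sub (he a)).integrableOn) (fun S hS _ => ?_)
      (hest a).aestronglyMeasurable
    rw [integral_sub (hXa a).integrableOn (he a).integrableOn, h1 S hS, sub_zero]
  have e2 : ∀ a, (fun ω => (μ[X | I]) ω a) =ᵐ[μ] μ[fun ω => X ω a | I] := fun a =>
    (EuclideanSpace.proj (𝕜 := ℝ) a).comp_condExp_comm hX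
  have e3 : ∀ a b, μ[fun ω => (X ω - (μ[X | I]) ω) a * (X ω - (μ[X | I]) ω) b | I]
      =ᵐ[μ] fun ω => P ω a b := fun a b => by
    have e4 : (fun ω => (X ω - (μ[X | I]) ω) a * (X ω - (μ[X | I]) ω) b)
        =ᵐ[μ] fun ω => e a ω * e b ω := by
      filter_upwards [e1 a, e1 b, e2 a, e2 b] with ω h1 h2 h3 h4
      rw [PiLp.sub_apply, PiLp.sub_apply, h3, h4, ← h1, ← h2]
      ring
    refine (condExp_congr_ae e4).trans (EventuallyEq.symm ?_)
    exact ae_eq_condExp_of_forall_setIntegral_eq hI (hee a b)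
      (fun S _ _ => (hPi a b).integrableOn) (fun S hS _ => (h2 S hS a b).symm)
      (hP a b).aestronglyMeasurable
  filter_upwards [ae_all_iff.2 fun a => ae_all_iff.2 (e3 a)] with ω hω
  ext a b
  exact hω a b

/-! ### Likelihood of a transmission pattern -/

section Conditioning

variable {Ω : Type*} [mΩ : MeasurableSpace Ω] {n m : ℕ} {s : Fin m → ℕ}
  {μ : Measure Ω} {A Sigma0 Q : Matrix (Fin n) (Fin n) ℝ}
  {C : (i : Fin m) → Matrix (Fin (s i)) (Fin n) ℝ}
  {R : Matrix ((i : Fin m) × Fin (s i)) ((i : Fin m) × Fin (s i)) ℝ}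
  {x₀ : Ω → EuclideanSpace ℝ (Fin n)} {w : ℕ → Ω → EuclideanSpace ℝ (Fin n)}
  {v : ℕ → Ω → EuclideanSpace ℝ ((i : Fin m) × Fin (s i))} {ζ : ℕ → Fin m → Ω → ℝ}
  {Y : (i : Fin m) → Matrix (Fin (s i)) (Fin (s i)) ℝ}

/-- The transmission pattern: `true` if the sensor is silent. -/
def silent (Y : (i : Fin m) → Matrix (Fin (s i)) (Fin (s i)) ℝ)
    (y : ℕ → (i : Fin m) → Ω → Fin (s i) → ℝ) (ζ : ℕ → Fin m → Ω → ℝ) (ω : Ω) (k : ℕ)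
    (i : Fin m) : Bool := decide (ζ k i ω ≤ dropProb (Y i) (y k i ω))

/-- All sources except the trigger variables. -/
def noiseSources (m : ℕ) : Set (Source m) :=
  {a | match a with
    | .trigger _ _ => False
    | _ => True}

lemma dropProb_eq {d : ℕ} (M : Matrix (Fin d) (Fin d) ℝ) (y : Fin d → ℝ) :
    dropProb M y = Real.exp (-(quad M y) / 2) := by
  rw [dropProb, quad]; ring_nf

lemma dropProb_le_one {d : ℕ} {M : Matrix (Fin d) (Fin d) ℝ} (hM : M.PosDef) (y : Fin d → ℝ) :
    dropProb M y ≤ 1 := by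
  rw [dropProb_eq, Real.exp_le_one_iff]
  linarith [quad_nonneg hM.posSemidef y]

lemma continuous_dropProb {d : ℕ} (M : Matrix (Fin d) (Fin d) ℝ) : Continuous (dropProb M) := by
  unfold dropProb dotProduct; fun_prop

omit mΩ in
lemma measurable_meas_sigmaOf (k : ℕ) (i : Fin m) :
    Measurable[sigmaOf x₀ w v ζ (noiseSources m)] (meas C (state A x₀ w) v k i) := by
  have h := measurable_stackMeas_sigmaOf (A := A) (C := C) (x₀ := x₀) (w := w) (v := v) (ζ := ζ)
    (S := noiseSources m) k trivial (fun _ _ => trivial) trivial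
  let _ : MeasurableSpace Ω := sigmaOf x₀ w v ζ (noiseSources m)
  exact measurable_pi_lambda _ fun a => (measurable_pi_apply (⟨i, a⟩ : (i : Fin m) × Fin (s i))).comp h

/-- Averaging out the trigger variables. -/
lemma NoiseModel.integral_mul_prod_silent (h : NoiseModel μ Sigma0 Q R x₀ w v ζ)
    (hY : ∀ i, (Y i).PosDef) (g : ℕ → Fin m → Bool) (k : ℕ) {f : Ω → ℝ}
    (hf : Measurable[sigmaOf x₀ w v ζ (noiseSources m)] f) (hfi : Integrable f μ) :
    ∫ ω, f ω * ∏ b ∈ Finset.range (k + 1) ×ˢ Finset.univ,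
        (if silent Y (meas C (state A x₀ w) v) ζ ω b.1 b.2 = g b.1 b.2 then 1 else 0) ∂μ
      = ∫ ω, f ω * ∏ b ∈ Finset.range (k + 1) ×ˢ (Finset.univ : Finset (Fin m)),
        (if g b.1 b.2 then dropProb (Y b.2) (meas C (state A x₀ w) v b.1 b.2 ω)
          else 1 - dropProb (Y b.2) (meas C (state A x₀ w) v b.1 b.2 ω)) ∂μ := by
  have := h.isProbabilityMeasure
  refine integral_mul_prod_ite_le_of_uniform (U := fun b : ℕ × Fin m => ζ b.1 b.2)
    (p := fun b ω => dropProb (Y b.2) (meas C (state A x₀ w) v b.1 b.2 ω))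
    (h.sigmaOf_le (noiseSources m))
    (fun b => h.measurable_trigger b.1 b.2) (fun b => h.map_trigger b.1 b.2) (fun F a ha => ?_)
    (fun b => (continuous_dropProb _).measurable.comp (measurable_meas_sigmaOf b.1 b.2))
    (fun b ω => (Real.exp_pos _).le) (fun b ω => dropProb_le_one (hY _) _)
    (fun b => g b.1 b.2) _ hf hfi
  have hd : Disjoint (noiseSources m ∪ (fun b : ℕ × Fin m => Source.trigger b.1 b.2) '' F)
      {Source.trigger a.1 a.2} := by
    rw [Set.disjoint_singleton_right]
    rintro (hn | ⟨b, hb, hba⟩)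
    · exact hn
    · simp only [Source.trigger.injEq] at hba
      exact ha (by rwa [← Prod.ext hba.1 hba.2])
  refine indep_of_indep_of_le_left (indep_of_indep_of_le_right (h.indep_sigmaOf hd)
    (sourceSigma_le_sigmaOf (a := .trigger a.1 a.2) rfl)) (sup_le ?_ (iSup₂_le fun b hb => ?_))
  · exact sigmaOf_mono Set.subset_union_left
  · exact sourceSigma_le_sigmaOf (a := .trigger b.1 b.2) (Or.inr ⟨b, hb, rfl⟩)

omit mΩ in
-- Separates the likelihood of the pattern: the remaining product involves only transmitted
-- measurements, the exponential only silent ones, and the latter is the Gaussian weight of the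
-- tilt.
lemma prod_dropProb_eq (y : ℕ → (i : Fin m) → Ω → Fin (s i) → ℝ) (g : ℕ → Fin m → Bool) (k : ℕ)
    (ω : Ω) : ∏ b ∈ Finset.range (k + 1) ×ˢ (Finset.univ : Finset (Fin m)),
        (if g b.1 b.2 then dropProb (Y b.2) (y b.1 b.2 ω) else 1 - dropProb (Y b.2) (y b.1 b.2 ω))
      = (∏ b ∈ Finset.range (k + 1) ×ˢ (Finset.univ : Finset (Fin m)),
          if g b.1 b.2 then 1 else 1 - dropProb (Y b.2) (y b.1 b.2 ω))
        * Real.exp (-(silentExponent Y y g k ω) / 2) := by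
  have h1 : Real.exp (-(silentExponent Y y g k ω) / 2)
      = ∏ b ∈ Finset.range (k + 1) ×ˢ (Finset.univ : Finset (Fin m)),
        if g b.1 b.2 then dropProb (Y b.2) (y b.1 b.2 ω) else 1 := by
    rw [silentExponent, ← Finset.sum_product', ← Finset.sum_neg_distrib, Finset.sum_div,
      Real.exp_sum]
    refine Finset.prod_congr rfl fun b _ => ?_
    split_ifs
    · rw [dropProb_eq]
    · simp
  rw [h1, ← Finset.prod_mul_distrib]
  refine Finset.prod_congr rfl fun b _ => ?_
  split_ifs <;> simp

omit mΩ in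
lemma prod_silent_eq (d g : ℕ → Fin m → Bool) (k : ℕ) :
    ∏ b ∈ Finset.range (k + 1) ×ˢ (Finset.univ : Finset (Fin m)),
        (if d b.1 b.2 = g b.1 b.2 then (1 : ℝ) else 0)
      = if ∀ j ≤ k, d j = g j then 1 else 0 := by
  classical
  split_ifs with hd
  · refine Finset.prod_eq_one fun b hb => ?_
    rw [Finset.mem_product, Finset.mem_range] at hb
    rw [if_pos (by rw [hd b.1 (by omega)])]
  · simp only [not_forall] at hd
    obtain ⟨j, hj, hdj⟩ := hd
    obtain ⟨i, hi⟩ := Function.ne_iff.1 hdj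
    refine Finset.prod_eq_zero (i := (j, i)) ?_ (if_neg hi)
    simp; omega

end Conditioning

/-! ### The information σ-algebra restricted to a pattern -/

section Information

variable {Ω : Type*} [mΩ : MeasurableSpace Ω] {n m : ℕ} {s : Fin m → ℕ}
  {μ : Measure Ω} {A Sigma0 Q : Matrix (Fin n) (Fin n) ℝ}
  {C : (i : Fin m) → Matrix (Fin (s i)) (Fin n) ℝ}
  {R : Matrix ((i : Fin m) × Fin (s i)) ((i : Fin m) × Fin (s i)) ℝ}
  {x₀ : Ω → EuclideanSpace ℝ (Fin n)} {w : ℕ → Ω → EuclideanSpace ℝ (Fin n)}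
  {v : ℕ → Ω → EuclideanSpace ℝ ((i : Fin m) × Fin (s i))} {ζ : ℕ → Fin m → Ω → ℝ}
  {Y : (i : Fin m) → Matrix (Fin (s i)) (Fin (s i)) ℝ}

/-- The decisions and the received measurements up to time `k`. -/
def received (γ : ℕ → Fin m → Ω → ℝ) (y : ℕ → (i : Fin m) → Ω → Fin (s i) → ℝ) (k : ℕ) (ω : Ω) :
    (Fin (k + 1) × Fin m → ℝ) × (Fin (k + 1) × ((i : Fin m) × Fin (s i)) → ℝ) :=
  (fun b => γ b.1 b.2 ω, fun b => γ b.1 b.2.1 ω * y b.1 b.2.1 ω b.2.2)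

omit mΩ in
lemma info_le_comap_received (γ : ℕ → Fin m → Ω → ℝ) (y : ℕ → (i : Fin m) → Ω → Fin (s i) → ℝ)
    (k : ℕ) : info γ y k ≤ MeasurableSpace.comap (received γ y k) inferInstance := by
  refine iSup₂_le fun j hj => iSup_le fun i => sup_le ?_ ?_
  · refine Measurable.comap_le ?_
    have h1 : Measurable fun z : (Fin (k + 1) × Fin m → ℝ) ×
        (Fin (k + 1) × ((i : Fin m) × Fin (s i)) → ℝ) => z.1 (⟨j, by omega⟩, i) := by fun_prop
    exact h1.comp (comap_measurable (received γ y k))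
  · refine Measurable.comap_le ?_
    have h1 : Measurable fun z : (Fin (k + 1) × Fin m → ℝ) ×
        (Fin (k + 1) × ((i : Fin m) × Fin (s i)) → ℝ) => fun a : Fin (s i) =>
          z.2 (⟨j, by omega⟩, ⟨i, a⟩) := by fun_prop
    exact h1.comp (comap_measurable (received γ y k))

omit mΩ in
lemma measurable_decision_info (γ : ℕ → Fin m → Ω → ℝ) (y : ℕ → (i : Fin m) → Ω → Fin (s i) → ℝ)
    {k j : ℕ} (hj : j ≤ k) (i : Fin m) : Measurable[info γ y k] (γ j i) :=
  (comap_measurable (γ j i)).mono ((le_sup_left.trans (le_iSup (fun i =>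
    MeasurableSpace.comap (γ j i) inferInstance ⊔
      MeasurableSpace.comap (fun ω => γ j i ω • y j i ω) inferInstance) i)).trans
        (le_iSup₂_of_le (f := fun j (_ : j ≤ k) => ⨆ i, MeasurableSpace.comap (γ j i) inferInstance ⊔
      MeasurableSpace.comap (fun ω => γ j i ω • y j i ω) inferInstance) j hj le_rfl)) le_rfl

omit mΩ in
lemma measurable_received_info (γ : ℕ → Fin m → Ω → ℝ) (y : ℕ → (i : Fin m) → Ω → Fin (s i) → ℝ)
    {k j : ℕ} (hj : j ≤ k) (i : Fin m) : Measurable[info γ y k] fun ω => γ j i ω • y j i ω :=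
  (comap_measurable fun ω => γ j i ω • y j i ω).mono ((le_sup_right.trans (le_iSup (fun i =>
    MeasurableSpace.comap (γ j i) inferInstance ⊔
      MeasurableSpace.comap (fun ω => γ j i ω • y j i ω) inferInstance) i)).trans
        (le_iSup₂_of_le (f := fun j (_ : j ≤ k) => ⨆ i, MeasurableSpace.comap (γ j i) inferInstance ⊔
      MeasurableSpace.comap (fun ω => γ j i ω • y j i ω) inferInstance) j hj le_rfl)) le_rfl

omit mΩ in
lemma decision_eq (y : ℕ → (i : Fin m) → Ω → Fin (s i) → ℝ) (j : ℕ) (i : Fin m) (ω : Ω) :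
    decision Y y ζ j i ω = if silent Y y ζ ω j i then 0 else 1 := by
  simp [decision, silent]

lemma measurable_meas (h : NoiseModel μ Sigma0 Q R x₀ w v ζ) (k : ℕ) (i : Fin m) :
    Measurable (meas C (state A x₀ w) v k i) :=
  (measurable_meas_sigmaOf k i (ζ := ζ)).mono (h.sigmaOf_le _) le_rfl

lemma measurableSet_silent (h : NoiseModel μ Sigma0 Q R x₀ w v ζ) (k : ℕ) (i : Fin m) :
    MeasurableSet {ω | ζ k i ω ≤ dropProb (Y i) (meas C (state A x₀ w) v k i ω)} :=
  measurableSet_le (h.measurable_trigger k i)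
    ((continuous_dropProb _).measurable.comp (measurable_meas h k i))

lemma NoiseModel.info_le (h : NoiseModel μ Sigma0 Q R x₀ w v ζ) (k : ℕ) :
    info (decision Y (meas C (state A x₀ w) v) ζ) (meas C (state A x₀ w) v) k ≤ mΩ := by
  have h1 : ∀ j i, Measurable (decision Y (meas C (state A x₀ w) v) ζ j i) := fun j i =>
    Measurable.ite (measurableSet_silent h j i) measurable_const measurable_const
  exact iSup₂_le fun j _ => iSup_le fun i => sup_le (h1 j i).comap_le
    ((h1 j i).smul (measurable_meas h j i)).comap_le

omit mΩ in
lemma measurable_transmitted_sigmaOf (g : ℕ → Fin m → Bool) (k : ℕ) :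
    Measurable[sigmaOf x₀ w v ζ (noiseSources m)] (transmitted C (state A x₀ w) v g k) := by
  have h1 := fun b => measurable_meas_sigmaOf (A := A) (C := C) (x₀ := x₀) (w := w) (v := v)
    (ζ := ζ) b
  let _ : MeasurableSpace Ω := sigmaOf x₀ w v ζ (noiseSources m)
  refine measurable_pi_lambda _ fun b => ?_
  simp only [transmitted]
  split_ifs
  · exact measurable_const
  · exact (measurable_pi_apply b.2.2).comp (h1 b.1 b.2.1)

/-- On the pattern `g`, the state is a linear function of the received measurements up to an error
that has mean zero and covariance `patternCov` given the information. -/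
lemma NoiseModel.exists_setIntegral_linComb (h : NoiseModel μ Sigma0 Q R x₀ w v ζ)
    (hY : ∀ i, (Y i).PosDef) (g : ℕ → Fin m → Bool) (k : ℕ) :
    ∃ r : Fin n → ℕ → (i : Fin m) × Fin (s i) → ℝ, (∀ a, IsTransmitted g (r a)) ∧
      ∀ S, MeasurableSet[info (decision Y (meas C (state A x₀ w) v) ζ)
          (meas C (state A x₀ w) v) k] S →
        (∀ a, ∫ ω in S ∩ {ω | ∀ j ≤ k, silent Y (meas C (state A x₀ w) v) ζ ω j = g j},
          linComb A C x₀ w v k (Pi.single a 1, r a) ω ∂μ = 0) ∧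
        ∀ a b, ∫ ω in S ∩ {ω | ∀ j ≤ k, silent Y (meas C (state A x₀ w) v) ζ ω j = g j},
          linComb A C x₀ w v k (Pi.single a 1, r a) ω
            * linComb A C x₀ w v k (Pi.single b 1, r b) ω ∂μ
          = ∫ _ in S ∩ {ω | ∀ j ≤ k, silent Y (meas C (state A x₀ w) v) ζ ω j = g j},
            patternCov A Sigma0 Q C R Y g k a b ∂μ := by
  classical
  obtain ⟨r, hr, hmom⟩ := h.exists_linear_estimator (A := A) (C := C) hY g k
  refine ⟨r, hr, fun S hS => ?_⟩
  set y := meas C (state A x₀ w) v with hy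
  have hSm : MeasurableSet S := h.info_le k S hS
  -- An information event is a preimage of some `D` under `received`. On the pattern `g` the
  -- decisions are the constant `c` below, so membership is a condition on the transmitted
  -- measurements alone.
  obtain ⟨D, hD, hDS⟩ := info_le_comap_received _ _ _ S hS
  set c : Fin (k + 1) × Fin m → ℝ := fun b => if g b.1 b.2 then 0 else 1 with hc
  set T := {ω | ∀ j ≤ k, silent Y y ζ ω j = g j} with hT
  have hTm : MeasurableSet T := by
    have : T = ⋂ (j : ℕ) (_ : j ≤ k) (i : Fin m), {ω | silent Y y ζ ω j i = g j i} := by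
      ext ω; simp [hT, funext_iff]
    rw [this]
    refine MeasurableSet.iInter fun j => MeasurableSet.iInter fun _ => MeasurableSet.iInter fun i => ?_
    cases g j i
    · have h1 := (measurableSet_silent (A := A) (C := C) (Y := Y) h j i).compl
      simpa [silent, Set.compl_ofPred] using h1
    · simpa [silent] using measurableSet_silent (A := A) (C := C) (Y := Y) h j i
  have hTrec : ∀ ω ∈ T, received (decision Y y ζ) y k ω
      = (c, transmitted C (state A x₀ w) v g k ω) := by
    intro ω hω
    refine Prod.ext (funext fun b => ?_) (funext fun b => ?_)
    · simp only [received, decision_eq, hc]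
      rw [hω b.1 (by omega)]
    · simp only [received, decision_eq, transmitted, stackMeas]
      rw [hω b.1 (by omega)]
      split_ifs <;> simp [hy]
  set I : (Fin (k + 1) × ((i : Fin m) × Fin (s i)) → ℝ) → ℝ := fun t =>
    if (c, t) ∈ D then 1 else 0 with hI
  have hIm : Measurable I := Measurable.ite (measurable_prodMk_left hD) measurable_const
    measurable_const
  -- Membership in `S` times the factors `1 - dropProb` of the transmitting sensors: a function of
  -- the transmitted data, as `NoiseModel.exists_linear_estimator` requires.
  set H : (Fin (k + 1) × ((i : Fin m) × Fin (s i)) → ℝ) → ℝ := fun t => I t *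
    ∏ j : Fin (k + 1), ∏ i, if g j i then 1 else 1 - dropProb (Y i) fun a => t (j, ⟨i, a⟩) with hH
  have hHm : Measurable H := by
    refine hIm.mul (Finset.measurable_prod _ fun j _ => Finset.measurable_prod _ fun i _ => ?_)
    split_ifs
    · exact measurable_const
    · refine measurable_const.sub ((continuous_dropProb _).measurable.comp ?_)
      fun_prop
  have htrm := measurable_transmitted_sigmaOf (A := A) (C := C) (x₀ := x₀) (w := w) (v := v)
    (ζ := ζ) g k
  have hle := h.sigmaOf_le (noiseSources m)
  -- Averaging out the triggers turns the restriction to `S ∩ T` into the weight `H` times the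
  -- Gaussian exponential.
  have key : ∀ f : Ω → ℝ, Measurable[sigmaOf x₀ w v ζ (noiseSources m)] f → Integrable f μ →
      ∫ ω in S ∩ T, f ω ∂μ = ∫ ω, f ω * H (transmitted C (state A x₀ w) v g k ω)
        * Real.exp (-(silentExponent Y y g k ω) / 2) ∂μ := by
    intro f hf hfi
    have hf' : Measurable[sigmaOf x₀ w v ζ (noiseSources m)]
        fun ω => f ω * I (transmitted C (state A x₀ w) v g k ω) := hf.mul (hIm.comp htrm)
    have hfi' : Integrable (fun ω => f ω * I (transmitted C (state A x₀ w) v g k ω)) μ := by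
      refine hfi.mul_bdd (c := 1) ((hIm.comp htrm).mono hle le_rfl).aestronglyMeasurable
        (ae_of_all _ fun ω => ?_)
      simp only [hI]
      split_ifs <;> simp
    have h1 := h.integral_mul_prod_silent (A := A) (C := C) hY g k hf' hfi'
    rw [← hy] at h1
    rw [← integral_indicator (hSm.inter hTm)]
    refine (integral_congr_ae (ae_of_all _ fun ω => ?_)).trans
      (h1.trans (integral_congr_ae (ae_of_all _ fun ω => ?_)))
    · simp only [prod_silent_eq]
      by_cases hω : ω ∈ T
      · rw [if_pos (show ∀ j ≤ k, silent Y y ζ ω j = g j from hω), mul_one]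
        have h2 : ω ∈ S ↔ (c, transmitted C (state A x₀ w) v g k ω) ∈ D := by
          rw [← hTrec ω hω, ← hDS]; rfl
        simp only [hI, Set.indicator_apply, Set.mem_inter_iff, hω, and_true, h2]
        split_ifs <;> simp
      · rw [if_neg (show ¬ ∀ j ≤ k, silent Y y ζ ω j = g j from hω), Set.indicator_of_notMem (fun h => hω h.2), mul_zero]
    · simp only [prod_dropProb_eq]
      simp only [hH]
      rw [Finset.prod_product, Finset.prod_range]
      have h3 : ∀ (j : Fin (k + 1)) i, (if g j i = true then (1 : ℝ) else 1 - dropProb (Y i) (y j i ω))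
          = if g j i = true then 1 else 1 - dropProb (Y i)
            fun a => transmitted C (state A x₀ w) v g k ω (j, ⟨i, a⟩) := fun j i => by
        by_cases hg : g j i = true
        · simp [hg]
        · simp only [transmitted, hg]
          rfl
      simp only [h3]
      ring
  have hL : ∀ p, Measurable[sigmaOf x₀ w v ζ (noiseSources m)] (linComb A C x₀ w v k p) := fun p =>
    measurable_linComb_sigmaOf k p fun a ha => by
      cases a
      · trivial
      · trivial
      · trivial
      · exact ha
  have hG := h.gaussianFamily (A := A) (C := C) k
  have := h.isProbabilityMeasure
  refine ⟨fun a => ?_, fun a b => ?_⟩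
  · rw [key _ (hL _) (hG.integrable _)]
    exact (hmom H hHm).1 a
  · rw [key (fun ω => linComb A C x₀ w v k (Pi.single a 1, r a) ω
      * linComb A C x₀ w v k (Pi.single b 1, r b) ω) ((hL _).mul (hL _))
      ((hG.memLp_two _).integrable_mul (hG.memLp_two _)), (hmom H hHm).2 a b]
    have h1 := key (fun _ => 1) measurable_const (integrable_const _)
    simp only [one_mul] at h1
    rw [← h1, ← integral_const_mul]
    simp only [mul_one]

end Information

/-! ### Quantities selected by a discrete random variable -/

section Selection

variable {Ω α : Type*} [mΩ : MeasurableSpace Ω] {μ : Measure Ω} [MeasurableSpace α]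
  [MeasurableSingletonClass α] {N : Ω → α}

lemma measurable_select [Countable α] (hN : Measurable N) {f : α → Ω → ℝ}
    (hf : ∀ a, Measurable (f a)) : Measurable fun ω => f (N ω) ω :=
  (measurable_from_prod_countable_right (f := fun z : α × Ω => f z.1 z.2) hf).comp
    (hN.prodMk measurable_id)

lemma integrable_select [Fintype α] (hN : Measurable N) {f : α → Ω → ℝ}
    (hf : ∀ a, Integrable (f a) μ) : Integrable (fun ω => f (N ω) ω) μ := by
  classical
  have h1 : (fun ω => f (N ω) ω) = fun ω => ∑ a, (N ⁻¹' {a}).indicator (f a) ω := by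
    ext ω
    rw [Finset.sum_eq_single (N ω)]
    · simp
    · intro a _ ha
      exact Set.indicator_of_notMem (s := N ⁻¹' {a}) (fun h => ha (Set.mem_singleton_iff.1 h).symm)
        (f a)
    · simp
  rw [h1]
  exact integrable_finsetSum _ fun a _ => (hf a).indicator (hN (measurableSet_singleton a))

lemma setIntegral_select [Fintype α] (hN : Measurable N) {f : α → Ω → ℝ}
    (hf : ∀ a, Integrable (f a) μ) {S : Set Ω} (hS : MeasurableSet S) :
    ∫ ω in S, f (N ω) ω ∂μ = ∑ a, ∫ ω in S ∩ N ⁻¹' {a}, f a ω ∂μ := by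
  have h1 : S = ⋃ a, S ∩ N ⁻¹' {a} := by
    ext ω; simp
  have hm : ∀ a, MeasurableSet (S ∩ N ⁻¹' {a}) := fun a =>
    hS.inter (hN (measurableSet_singleton a))
  conv_lhs => rw [h1]
  rw [integral_iUnion_fintype hm]
  · refine Finset.sum_congr rfl fun a _ => setIntegral_congr_fun (hm a) fun ω hω => ?_
    have : N ω = a := hω.2
    simp only [this]
  · intro a b hab
    exact Set.disjoint_left.2 fun ω h1 h2 => hab ((show N ω = a from h1.2).symm.trans h2.2)
  · exact fun a => (integrable_select hN hf).integrableOn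

end Selection

/-! ### Identification of the error covariance -/

section ErrorCovariance

variable {Ω : Type*} [mΩ : MeasurableSpace Ω] {n m : ℕ} {s : Fin m → ℕ}
  {μ : Measure Ω} {A Sigma0 Q : Matrix (Fin n) (Fin n) ℝ}
  {C : (i : Fin m) → Matrix (Fin (s i)) (Fin n) ℝ}
  {R : Matrix ((i : Fin m) × Fin (s i)) ((i : Fin m) × Fin (s i)) ℝ}
  {x₀ : Ω → EuclideanSpace ℝ (Fin n)} {w : ℕ → Ω → EuclideanSpace ℝ (Fin n)}
  {v : ℕ → Ω → EuclideanSpace ℝ ((i : Fin m) × Fin (s i))} {ζ : ℕ → Fin m → Ω → ℝ}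
  {Y : (i : Fin m) → Matrix (Fin (s i)) (Fin (s i)) ℝ}

/-- The extension of a pattern on the first `k + 1` times. -/
def extendPattern {k : ℕ} (G : Fin (k + 1) → Fin m → Bool) (j : ℕ) : Fin m → Bool :=
  -- The default beyond `k` is immaterial, since `patternCov` at time `k` reads the pattern only up
  -- to `k`.
  if h : j < k + 1 then G ⟨j, h⟩ else fun _ => true

lemma forall_eq_extendPattern_iff {k : ℕ} (d : ℕ → Fin m → Bool) (G : Fin (k + 1) → Fin m → Bool) :
    (∀ j ≤ k, d j = extendPattern G j) ↔ (fun j : Fin (k + 1) => d j) = G := by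
  constructor
  · intro h
    ext1 j
    rw [h j (by omega), extendPattern, dif_pos j.2]
  · rintro rfl j hj
    rw [extendPattern, dif_pos (by omega)]

omit mΩ in
lemma measurable_silent_info (y : ℕ → (i : Fin m) → Ω → Fin (s i) → ℝ) (k : ℕ) :
    Measurable[info (decision Y y ζ) y k] fun ω => fun j : Fin (k + 1) => silent Y y ζ ω j := by
  have h1 := fun (j : Fin (k + 1)) i => measurable_decision_info (decision Y y ζ) y
    (show (j : ℕ) ≤ k by omega) i
  let _ : MeasurableSpace Ω := info (decision Y y ζ) y k
  refine measurable_pi_lambda _ fun j => measurable_pi_lambda _ fun i => ?_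
  have h2 : (fun ω => silent Y y ζ ω j i)
      = fun ω => if decision Y y ζ j i ω = 0 then true else false := by
    ext1 ω
    rw [decision_eq]
    cases silent Y y ζ ω j i <;> simp
  rw [h2]
  exact Measurable.ite (h1 j i (measurableSet_singleton 0)) measurable_const measurable_const

omit mΩ in
lemma measurable_dotProduct_received_info (y : ℕ → (i : Fin m) → Ω → Fin (s i) → ℝ) (k : ℕ)
    (r : ℕ → (i : Fin m) × Fin (s i) → ℝ) :
    Measurable[info (decision Y y ζ) y k] fun ω => ∑ j ∈ Finset.range (k + 1), ∑ p,
      r j p * (decision Y y ζ j p.1 ω • y j p.1 ω) p.2 := by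
  have h1 := fun (j : ℕ) (hj : j ≤ k) i => measurable_received_info (decision Y y ζ) y hj i
  let _ : MeasurableSpace Ω := info (decision Y y ζ) y k
  refine Finset.measurable_sum _ fun j hj => Finset.measurable_sum _ fun p _ => ?_
  rw [Finset.mem_range] at hj
  exact measurable_const.mul ((measurable_pi_apply p.2).comp (h1 j (by omega) p.1))

/-- The error covariance of the remote estimator is the covariance of its transmission pattern. -/
theorem NoiseModel.errCov_eq (h : NoiseModel μ Sigma0 Q R x₀ w v ζ) (hY : ∀ i, (Y i).PosDef)
    (k : ℕ) : ∀ᵐ ω ∂μ, errCov μ A C Y x₀ w v ζ k ω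
      = patternCov A Sigma0 Q C R Y (silent Y (meas C (state A x₀ w) v) ζ ω) k := by
  have := h.isProbabilityMeasure
  set y := meas C (state A x₀ w) v with hy
  -- One estimator for each of the finitely many patterns; `N` below selects the one in force.
  choose r hr hmom using fun G : Fin (k + 1) → Fin m → Bool =>
    h.exists_setIntegral_linComb (A := A) (C := C) hY (extendPattern G) k
  set N : Ω → Fin (k + 1) → Fin m → Bool := fun ω j => silent Y y ζ ω j with hN
  have hNI : Measurable[info (decision Y y ζ) y k] N := measurable_silent_info y k
  have hle := h.info_le (A := A) (C := C) (Y := Y) k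
  have hNm : Measurable N := hNI.mono hle le_rfl
  have hG := h.gaussianFamily (A := A) (C := C) k
  have hset : ∀ G, {ω | ∀ j ≤ k, silent Y y ζ ω j = extendPattern G j} = N ⁻¹' {G} := fun G =>
    Set.ext fun ω => forall_eq_extendPattern_iff (silent Y y ζ ω) G
  rw [← hy] at hmom hle
  simp only [hset] at hmom
  have hcoord : ∀ a ω, linComb A C x₀ w v k (Pi.single a 1, 0) ω = state A x₀ w k ω a := by
    intro a ω
    simp [linComb_apply]
  have hx : Integrable (state A x₀ w k) μ := by
    refine integrable_piLp_iff.2 fun a => ?_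
    simp only [← hcoord]
    exact hG.integrable _
  have hLL : ∀ p q, Integrable (fun ω => linComb A C x₀ w v k p ω * linComb A C x₀ w v k q ω) μ :=
    fun p q => (hG.memLp_two _).integrable_mul (hG.memLp_two _)
  -- The coefficients vanish on silent sensors, so on the realised pattern the estimate can be
  -- rewritten in the received data `γ • y`.
  have hest : ∀ a, Measurable[info (decision Y y ζ) y k] fun ω => state A x₀ w k ω a
      - linComb A C x₀ w v k (Pi.single a 1, r (N ω) a) ω := by
    intro a
    have h1 : (fun ω => state A x₀ w k ω a - linComb A C x₀ w v k (Pi.single a 1, r (N ω) a) ω)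
        = fun ω => -∑ j ∈ Finset.range (k + 1), ∑ p,
          r (N ω) a j p * (decision Y y ζ j p.1 ω • y j p.1 ω) p.2 := by
      ext ω
      rw [linComb_apply, single_one_dotProduct, sub_add_cancel_left, neg_inj]
      refine Finset.sum_congr rfl fun j hj => Finset.sum_congr rfl fun p _ => ?_
      rw [Finset.mem_range] at hj
      have h2 := ((forall_eq_extendPattern_iff (silent Y y ζ ω) (N ω)).2 rfl) j (by omega)
      rw [Pi.smul_apply, decision_eq, h2]
      split_ifs with h3
      · change r (N ω) a j ⟨p.1, p.2⟩ * _ = r (N ω) a j ⟨p.1, p.2⟩ * _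
        rw [hr (N ω) a j p.1 p.2 h3, zero_mul, zero_mul]
      · rw [one_smul]; rfl
    rw [h1]
    exact @measurable_select _ _ (info (decision Y y ζ) y k) _ _ _ _ hNI
      (fun G ω => -∑ j ∈ Finset.range (k + 1), ∑ p,
        r G a j p * (decision Y y ζ j p.1 ω • y j p.1 ω) p.2)
      fun G => (measurable_dotProduct_received_info y k (r G a)).neg
  have hfin := condErrCov_eq_of_setIntegral hle hx
    (P := fun ω => patternCov A Sigma0 Q C R Y (extendPattern (N ω)) k) hest
    (fun a b => @measurable_select _ _ (info (decision Y y ζ) y k) _ _ _ _ hNI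
      (fun G _ => patternCov A Sigma0 Q C R Y (extendPattern G) k a b) fun G => measurable_const)
    (fun a => integrable_select hNm fun G => hG.integrable (Pi.single a 1, r G a))
    (fun a b => integrable_select hNm fun G => hLL (Pi.single a 1, r G a) (Pi.single b 1, r G b))
    (fun a b => integrable_select hNm (f := fun G _ =>
      patternCov A Sigma0 Q C R Y (extendPattern G) k a b) fun G => integrable_const _)
    (fun S hS a => by
      rw [setIntegral_select hNm (f := fun G => linComb A C x₀ w v k (Pi.single a 1, r G a))
        (fun G => hG.integrable _) (hle S hS)]
      exact Finset.sum_eq_zero fun G _ => (hmom G S hS).1 a)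
    (fun S hS a b => by
      rw [setIntegral_select hNm (f := fun G ω => linComb A C x₀ w v k (Pi.single a 1, r G a) ω
          * linComb A C x₀ w v k (Pi.single b 1, r G b) ω) (fun G => hLL _ _) (hle S hS),
        setIntegral_select hNm (f := fun G _ =>
          patternCov A Sigma0 Q C R Y (extendPattern G) k a b) (fun G => integrable_const _)
          (hle S hS)]
      exact Finset.sum_congr rfl fun G _ => (hmom G S hS).2 a b)
  filter_upwards [hfin] with ω hω
  change condErrCov μ (info (decision Y y ζ) y k) (state A x₀ w k) ω = _
  rw [hω]
  refine patternCov_congr fun j hj => ?_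
  exact ((forall_eq_extendPattern_iff (silent Y y ζ ω) (N ω)).2 rfl j hj).symm

end ErrorCovariance

/-! ### Independent events over disjoint windows -/

section Windows

variable {Ω : Type*} {mΩ : MeasurableSpace Ω} {μ : Measure Ω}

/-- Intersections of independent events over disjoint finite sets of indices are independent. -/
lemma iIndepSet_biInter {ι κ : Type*} {E : ι → Set Ω} (hE : ∀ b, MeasurableSet (E b))
    (hind : iIndepSet E μ) {F : κ → Finset ι} (hF : Pairwise (Function.onFun Disjoint F)) :
    iIndepSet (fun l => ⋂ b ∈ F l, E b) μ := by
  classical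
  rw [iIndepSet_iff_meas_biInter hE] at hind
  rw [iIndepSet_iff_meas_biInter fun l => Finset.measurableSet_biInter _ fun b _ => hE b]
  intro s
  have h1 : (⋂ l ∈ s, ⋂ b ∈ F l, E b) = ⋂ b ∈ s.biUnion F, E b := by
    ext ω
    simp only [Set.mem_iInter, Finset.mem_biUnion]
    exact ⟨fun h b ⟨l, hl, hb⟩ => h l hl b hb, fun h l hl b hb => h b ⟨l, hl, hb⟩⟩
  rw [h1, hind, Finset.prod_biUnion fun a _ b _ hab => hF hab]
  exact Finset.prod_congr rfl fun l _ => (hind _).symm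

/-- A sequence of events one of which occurs almost surely hits an independent sequence of likely
events with at least the probability of the latter. -/
lemma le_measure_iUnion_inter {𝓐 𝓑 : MeasurableSpace Ω} (h𝓐 : 𝓐 ≤ mΩ) (h𝓑 : 𝓑 ≤ mΩ)
    (hind : Indep 𝓐 𝓑 μ) {E F : ℕ → Set Ω} (hE : ∀ l, MeasurableSet[𝓐] (E l))
    (hF : ∀ l, MeasurableSet[𝓑] (F l)) (hF1 : μ (⋃ l, F l) = 1) {c : ℝ≥0∞}
    (hc : ∀ l, c ≤ μ (E l)) : c ≤ μ (⋃ l, E l ∩ F l) := by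
  -- Disjointing selects the first index at which `F` occurs. That choice is independent of each `E
  -- l`, so no independence among the `E l` is needed.
  have hD : ∀ l, MeasurableSet[𝓑] (disjointed F l) := fun l =>
    @MeasurableSet.disjointed _ 𝓑 F hF l
  have h1 : (⋃ l, E l ∩ disjointed F l) ⊆ ⋃ l, E l ∩ F l :=
    Set.iUnion_mono fun l => Set.inter_subset_inter_right _ (disjointed_subset F l)
  refine le_trans ?_ (measure_mono h1)
  rw [measure_iUnion]
  · have h2 : ∀ l, μ (E l ∩ disjointed F l) = μ (E l) * μ (disjointed F l) := fun l =>
      (Indep_iff 𝓐 𝓑 μ).1 hind _ _ (hE l) (hD l)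
    simp only [h2]
    calc c = c * ∑' l, μ (disjointed F l) := by
          rw [← measure_iUnion (disjoint_disjointed F) fun l => h𝓑 _ (hD l), iUnion_disjointed,
            hF1, mul_one]
      _ = ∑' l, c * μ (disjointed F l) := ENNReal.tsum_mul_left.symm
      _ ≤ _ := ENNReal.tsum_le_tsum fun l => by gcongr; exact hc l
  · intro a b hab
    exact (disjoint_disjointed F hab).mono Set.inter_subset_right Set.inter_subset_right
  · exact fun l => (h𝓐 _ (hE l)).inter (h𝓑 _ (hD l))

end Windows

/-! ### Recurrence of silent windows -/

section Silence

variable {Ω : Type*} [mΩ : MeasurableSpace Ω] {n m : ℕ} {s : Fin m → ℕ}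
  {μ : Measure Ω} {A Sigma0 Q : Matrix (Fin n) (Fin n) ℝ}
  {C : (i : Fin m) → Matrix (Fin (s i)) (Fin n) ℝ}
  {R : Matrix ((i : Fin m) × Fin (s i)) ((i : Fin m) × Fin (s i)) ℝ}
  {x₀ : Ω → EuclideanSpace ℝ (Fin n)} {w : ℕ → Ω → EuclideanSpace ℝ (Fin n)}
  {v : ℕ → Ω → EuclideanSpace ℝ ((i : Fin m) × Fin (s i))} {ζ : ℕ → Fin m → Ω → ℝ}
  {Y : (i : Fin m) → Matrix (Fin (s i)) (Fin (s i)) ℝ}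

/-- With no measurement coefficients the recursion unrolls to the open-loop variance of `t ⬝ᵥ x_k`,
which `SchurStable.summable_quad` bounds uniformly in `k`. -/
lemma linCombVar_zero_right (k : ℕ) (t : Fin n → ℝ) :
    linCombVar A Sigma0 Q C R k (t, 0)
      = quad Sigma0 ((Aᵀ ^ k) *ᵥ t) + ∑ j ∈ Finset.range k, quad Q ((Aᵀ ^ j) *ᵥ t) := by
  induction k generalizing t with
  | zero => simp [linCombVar, quad_zero_right]
  | succ k ih =>
    rw [linCombVar, Finset.sum_range_succ']
    simp only [Pi.zero_apply, Matrix.mulVec_zero, add_zero, quad_zero_right]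
    rw [ih]
    simp only [Matrix.mulVec_mulVec, ← pow_succ, pow_zero, Matrix.one_mulVec]
    ring

lemma linCombVar_single (k : ℕ) (e : (i : Fin m) × Fin (s i) → ℝ) :
    linCombVar A Sigma0 Q C R k (0, Pi.single k e)
      = linCombVar A Sigma0 Q C R k ((stack C)ᵀ *ᵥ e, 0) + quad R e := by
  cases k with
  | zero => simp [linCombVar, quad_zero_right]
  | succ k =>
    simp only [linCombVar, Pi.single_eq_same, Pi.zero_apply, Matrix.mulVec_zero, add_zero, zero_add,
      quad_zero_right]
    rw [linCombVar_congr (r' := 0)]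
    intro j hj
    rw [Pi.single_eq_of_ne (by omega)]
    rfl

omit mΩ in
lemma linComb_single (k : ℕ) (p : (i : Fin m) × Fin (s i)) (ω : Ω) :
    linComb A C x₀ w v k (0, Pi.single k (Pi.single p 1)) ω
      = stackMeas C (state A x₀ w) v k ω p := by
  rw [linComb_apply, zero_dotProduct, zero_add, Finset.sum_eq_single k]
  · simp
  · intro j _ hj
    simp [Pi.single_eq_of_ne hj]
  · simp

lemma continuous_quad_right {ι : Type*} [Fintype ι] (M : Matrix ι ι ℝ) : Continuous (quad M) := by
  have : quad M = fun y => y ⬝ᵥ (M *ᵥ y) := rfl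
  rw [this]
  unfold dotProduct
  fun_prop

/-- The second moments of the measurements are bounded uniformly in time. -/
lemma NoiseModel.exists_integral_quad_meas_le (h : NoiseModel μ Sigma0 Q R x₀ w v ζ)
    (hA : SchurStable A) : ∃ K : ℝ, ∀ k,
      Integrable (fun ω => ∑ i, quad (Y i) (meas C (state A x₀ w) v k i ω)) μ ∧
      ∫ ω, ∑ i, quad (Y i) (meas C (state A x₀ w) v k i ω) ∂μ ≤ K := by
  have hG := fun k => h.gaussianFamily (A := A) (C := C) k
  have := h.isProbabilityMeasure
  have hsq : ∀ k p, Integrable (fun ω => stackMeas C (state A x₀ w) v k ω p ^ 2) μ := fun k p => by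
    simp only [← linComb_single]
    exact ((hG k).memLp_two _).integrable_sq
  have hint : ∀ k p, ∫ ω, stackMeas C (state A x₀ w) v k ω p ^ 2 ∂μ
      = linCombVar A Sigma0 Q C R k ((stack C)ᵀ *ᵥ Pi.single p 1, 0) + quad R (Pi.single p 1) := by
    intro k p
    have h1 := (hG k).covariance_eq_integral (0, Pi.single k (Pi.single p 1))
      (0, Pi.single k (Pi.single p 1))
    rw [covariance_self ((hG k).measurable _).aemeasurable, (hG k).variance_eq,
      linCombVar_single] at h1
    rw [h1]
    simp only [linComb_single, sq]
  have hbd : ∀ t : Fin n → ℝ, ∃ b : ℝ, ∀ k, linCombVar A Sigma0 Q C R k (t, 0) ≤ b := fun t =>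
    ⟨(∑' k, quad Sigma0 ((Aᵀ ^ k) *ᵥ t)) + ∑' k, quad Q ((Aᵀ ^ k) *ᵥ t), fun k => by
      rw [linCombVar_zero_right]
      exact add_le_add ((hA.summable_quad Sigma0 t).le_tsum k
          fun j _ => quad_nonneg h.Sigma0_posDef.posSemidef _)
        ((hA.summable_quad Q t).sum_le_tsum _ fun j _ => quad_nonneg h.Q_posDef.posSemidef _)⟩
  choose b hb using hbd
  set c := ∑ p, ∑ q, |Matrix.blockDiagonal' Y p q| with hc
  have hc0 : 0 ≤ c := Finset.sum_nonneg fun _ _ => Finset.sum_nonneg fun _ _ => abs_nonneg _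
  have hsum : ∀ k ω, ∑ i, quad (Y i) (meas C (state A x₀ w) v k i ω)
      = quad (Matrix.blockDiagonal' Y) (stackMeas C (state A x₀ w) v k ω) := fun k ω => by
    rw [quad_blockDiagonal']; rfl
  have hle : ∀ k ω, |∑ i, quad (Y i) (meas C (state A x₀ w) v k i ω)|
      ≤ c * ∑ p, stackMeas C (state A x₀ w) v k ω p ^ 2 := fun k ω => by
    rw [hsum]
    exact (abs_quad_le _ _).trans_eq (by rw [quad_one])
  have hint' : ∀ k, Integrable (fun ω => c * ∑ p, stackMeas C (state A x₀ w) v k ω p ^ 2) μ :=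
    fun k => (integrable_finsetSum _ fun p _ => hsq k p).const_mul c
  have hmeas : ∀ k, Measurable fun ω => ∑ i, quad (Y i) (meas C (state A x₀ w) v k i ω) := fun k =>
    Finset.measurable_sum _ fun i _ =>
      (continuous_quad_right (Y i)).measurable.comp
        (measurable_meas h k i)
  refine ⟨c * ∑ p, (b ((stack C)ᵀ *ᵥ Pi.single p 1) + quad R (Pi.single p 1)), fun k => ?_⟩
  have hi : Integrable (fun ω => ∑ i, quad (Y i) (meas C (state A x₀ w) v k i ω)) μ :=
    (hint' k).mono' (hmeas k).aestronglyMeasurable (ae_of_all _ fun ω => hle k ω)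
  refine ⟨hi, (integral_mono hi (hint' k) fun ω => (le_abs_self _).trans (hle k ω)).trans ?_⟩
  rw [integral_const_mul, integral_finsetSum _ fun p _ => hsq k p]
  gcongr with p
  rw [hint]
  gcongr
  exact hb _ k

/-- For every window length, the sensors are all silent on windows arbitrarily far out. -/
lemma NoiseModel.ae_exists_silent_window (h : NoiseModel μ Sigma0 Q R x₀ w v ζ)
    (hA : SchurStable A) (hY : ∀ i, (Y i).PosDef) (N L : ℕ) :
    ∀ᵐ ω ∂μ, ∃ k, L ≤ k ∧ ∀ j, k * N ≤ j → j < k * N + N →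
      silent Y (meas C (state A x₀ w) v) ζ ω j = fun _ => true := by
  have := h.isProbabilityMeasure
  obtain ⟨K, hK⟩ := h.exists_integral_quad_meas_le (C := C) (Y := Y) hA
  set u : ℕ → Ω → ℝ := fun k ω => ∑ i, quad (Y i) (meas C (state A x₀ w) v k i ω) with hu
  have hq0 : ∀ k i ω, 0 ≤ quad (Y i) (meas C (state A x₀ w) v k i ω) := fun k i ω =>
    quad_nonneg (hY i).posSemidef _
  have hu0 : ∀ k ω, 0 ≤ u k ω := fun k ω => Finset.sum_nonneg fun i _ => hq0 k i ω
  have hK0 : 0 ≤ K := (integral_nonneg fun ω => hu0 0 ω).trans (hK 0).2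
  set G := {ω | ∃ k, L ≤ k ∧ ∀ j, k * N ≤ j → j < k * N + N →
      silent Y (meas C (state A x₀ w) v) ζ ω j = fun _ => true} with hG
  suffices hG1 : 1 ≤ μ G by
    have hGm : MeasurableSet G := by
      have : G = ⋃ (k : ℕ) (_ : L ≤ k), ⋂ (j : ℕ) (_ : k * N ≤ j) (_ : j < k * N + N) (i : Fin m),
          {ω | ζ j i ω ≤ dropProb (Y i) (meas C (state A x₀ w) v j i ω)} := by
        ext ω
        simp [hG, funext_iff, silent]
      rw [this]
      exact MeasurableSet.iUnion fun k => MeasurableSet.iUnion fun _ => MeasurableSet.iInter fun j =>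
        MeasurableSet.iInter fun _ => MeasurableSet.iInter fun _ => MeasurableSet.iInter fun i =>
          measurableSet_silent h j i
    exact (prob_compl_eq_zero_iff hGm).2 (le_antisymm prob_le_one hG1)
  -- Probability one is approached by giving up an arbitrary `δ` to windows with large measurements.
  refine ENNReal.le_of_forall_pos_le_add fun δ hδ _ => ?_
  -- a level that is exceeded in a window with probability at most `δ`
  set M : ℝ := (N * K + 1) / δ with hM
  have hM0 : 0 < M := by positivity
  set E : ℕ → Set Ω := fun l => {ω | M ≤ ∑ j ∈ Finset.Ico (l * N) (l * N + N), u j ω}ᶜ with hE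
  have hum : ∀ j, Measurable[sigmaOf x₀ w v ζ (noiseSources m)] (u j) := fun j => by
    refine Finset.measurable_sum _ fun i _ => ?_
    exact (continuous_quad_right (Y i)).measurable.comp
        (measurable_meas_sigmaOf j i)
  have hEm : ∀ l, MeasurableSet[sigmaOf x₀ w v ζ (noiseSources m)] (E l) := fun l =>
    (measurableSet_le measurable_const (Finset.measurable_sum _ fun j _ => hum j)).compl
  have hEμ : ∀ l, 1 - (δ : ℝ≥0∞) ≤ μ (E l) := by
    intro l
    have h1 := mul_meas_ge_le_integral_of_nonneg (μ := μ)
      (f := fun ω => ∑ j ∈ Finset.Ico (l * N) (l * N + N), u j ω)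
      (ae_of_all _ fun ω => Finset.sum_nonneg fun j _ => hu0 j ω)
      (integrable_finsetSum _ fun j _ => (hK j).1) M
    have h2 : ∫ ω, ∑ j ∈ Finset.Ico (l * N) (l * N + N), u j ω ∂μ ≤ N * K := by
      rw [integral_finsetSum _ fun j _ => (hK j).1]
      refine (Finset.sum_le_card_nsmul _ _ K fun j _ => (hK j).2).trans_eq ?_
      simp
    have h3 : μ.real {ω | M ≤ ∑ j ∈ Finset.Ico (l * N) (l * N + N), u j ω} ≤ δ := by
      have h4 : M * δ = N * K + 1 := by
        rw [hM]; field_simp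
      nlinarith
    rw [hE, prob_compl_eq_one_sub (h.sigmaOf_le (noiseSources m) _ (MeasurableSet.of_compl (hEm l)))]
    refine tsub_le_tsub_left ?_ _
    rw [← ENNReal.ofReal_coe_nnreal, ← ofReal_measureReal]
    exact ENNReal.ofReal_le_ofReal h3
  -- While the exponents in a window stay below `M`, the condition `ζ ≤ ρ` forces silence; it does
  -- not involve the measurements.
  set ρ : ℝ := Real.exp (-M / 2) with hρ
  have hρ1 : ρ ≤ 1 := Real.exp_le_one_iff.2 (by linarith)
  have hρ0 : 0 < ρ := Real.exp_pos _
  set B : ℕ × Fin m → Set Ω := fun b => {ω | ζ b.1 b.2 ω ≤ ρ} with hB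
  set I : ℕ → Finset (ℕ × Fin m) := fun l => Finset.Ico (l * N) (l * N + N) ×ˢ Finset.univ with hI
  set F : ℕ → Set Ω := fun l => ⋂ b ∈ I l, B b with hF
  have hBm : ∀ b, MeasurableSet (B b) := fun b =>
    measurableSet_le (h.measurable_trigger _ _) measurable_const
  have hBμ : ∀ b, μ (B b) = ENNReal.ofReal ρ := by
    intro b
    have h1 : B b = ζ b.1 b.2 ⁻¹' Set.Iic ρ := rfl
    rw [h1, ← Measure.map_apply (h.measurable_trigger _ _) measurableSet_Iic, h.map_trigger,
      Measure.restrict_apply measurableSet_Iic]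
    have h3 : Set.Iic ρ ∩ Set.Icc 0 1 = Set.Icc 0 ρ := by
      ext z
      simp only [Set.mem_inter_iff, Set.mem_Iic, Set.mem_Icc]
      exact ⟨fun hz => ⟨hz.2.1, hz.1⟩, fun hz => ⟨hz.2, hz.1, hz.2.trans hρ1⟩⟩
    rw [h3, Real.volume_Icc, sub_zero]
  have hBi : iIndepSet B μ := by
    have hinj : Function.Injective fun b : ℕ × Fin m => Source.trigger b.1 b.2 := by
      rintro ⟨a, b⟩ ⟨c, d⟩ hab
      simpa using hab
    refine iIndepSets.iIndepSet_of_mem (fun b => ?_) hBm (h.iIndep.precomp hinj).iIndepSets'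
    exact ⟨Set.Iic ρ, measurableSet_Iic, rfl⟩
  have hIdis : Pairwise (Function.onFun Disjoint I) := by
    intro l l' hl
    refine Finset.disjoint_left.2 fun b h1 h2 => ?_
    simp only [hI, Finset.mem_product, Finset.mem_Ico, Finset.mem_univ, and_true] at h1 h2
    rcases lt_or_gt_of_ne hl with h3 | h3
    · have := Nat.mul_le_mul_right N (Nat.succ_le_of_lt h3)
      rw [Nat.succ_mul] at this
      omega
    · have := Nat.mul_le_mul_right N (Nat.succ_le_of_lt h3)
      rw [Nat.succ_mul] at this
      omega
  have hFi : iIndepSet F μ := iIndepSet_biInter hBm hBi hIdis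
  have hFm : ∀ l, MeasurableSet (F l) := fun l => Finset.measurableSet_biInter _ fun b _ => hBm b
  have hFμ : ∀ l, μ (F l) = ENNReal.ofReal ρ ^ (N * m) := by
    intro l
    rw [hF, (iIndepSet_iff_meas_biInter hBm).1 hBi]
    simp [hBμ, hI]
  -- Second Borel–Cantelli lemma: disjoint windows give independent events of the same positive
  -- probability `ρ ^ (N * m)`.
  have hlim : μ (limsup F atTop) = 1 := by
    refine measure_limsup_eq_one hFm hFi ?_
    simp only [hFμ]
    exact ENNReal.tsum_const_eq_top_of_ne_zero (pow_ne_zero _ (ENNReal.ofReal_pos.2 hρ0).ne')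
  have hU : μ (⋃ l, F (l + L)) = 1 := by
    refine le_antisymm prob_le_one (hlim.symm.le.trans (measure_mono fun ω hω => ?_))
    rw [mem_limsup_iff_frequently_mem, frequently_atTop] at hω
    obtain ⟨l, hl, hlF⟩ := hω L
    exact Set.mem_iUnion.2 ⟨l - L, by rwa [Nat.sub_add_cancel hl]⟩
  have hFT : ∀ l, MeasurableSet[sigmaOf x₀ w v ζ (noiseSources m)ᶜ] (F l) := by
    intro l
    refine Finset.measurableSet_biInter _ fun b _ => ?_
    exact sourceSigma_le_sigmaOf (a := .trigger b.1 b.2) (fun hb => hb) _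
      ⟨Set.Iic ρ, measurableSet_Iic, rfl⟩
  have key := le_measure_iUnion_inter (h.sigmaOf_le _) (h.sigmaOf_le _)
    (h.indep_sigmaOf (disjoint_compl_right (a := noiseSources m)))
    (fun l => hEm (l + L)) (fun l => hFT (l + L)) hU fun l => hEμ (l + L)
  have hsub : (⋃ l, E (l + L) ∩ F (l + L)) ⊆ G := by
    intro ω hω
    obtain ⟨l, hlE, hlF⟩ := Set.mem_iUnion.1 hω
    refine ⟨l + L, by omega, fun j hj1 hj2 => funext fun i => ?_⟩
    have hj : j ∈ Finset.Ico ((l + L) * N) ((l + L) * N + N) := Finset.mem_Ico.2 ⟨hj1, hj2⟩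
    have h1 : ζ j i ω ≤ ρ := Set.mem_iInter₂.1 hlF (j, i)
      (Finset.mem_product.2 ⟨hj, Finset.mem_univ _⟩)
    have h2 : ∑ j ∈ Finset.Ico ((l + L) * N) ((l + L) * N + N), u j ω < M := not_le.1 hlE
    have h3 : u j ω ≤ ∑ j ∈ Finset.Ico ((l + L) * N) ((l + L) * N + N), u j ω :=
      Finset.single_le_sum (f := fun j => u j ω) (fun j _ => hu0 j ω) hj
    have h4 : quad (Y i) (meas C (state A x₀ w) v j i ω) ≤ u j ω :=
      Finset.single_le_sum (f := fun i => quad (Y i) (meas C (state A x₀ w) v j i ω))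
        (fun i _ => hq0 j i ω) (Finset.mem_univ i)
    refine decide_eq_true (h1.trans ?_)
    rw [dropProb_eq]
    exact Real.exp_le_exp.2 (by linarith)
  exact tsub_le_iff_right.1 (key.trans (measure_mono hsub))

end Silence

/-! ### Comparison with the all-silent recursion -/

section Bounds

variable {n m : ℕ} {s : Fin m → ℕ} {A Sigma0 Q : Matrix (Fin n) (Fin n) ℝ}
  {C : (i : Fin m) → Matrix (Fin (s i)) (Fin n) ℝ}
  {R : Matrix ((i : Fin m) × Fin (s i)) ((i : Fin m) × Fin (s i)) ℝ}
  {Y : (i : Fin m) → Matrix (Fin (s i)) (Fin (s i)) ℝ}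

/-- The error covariance is largest when all sensors are silent. -/
lemma patternCov_le (hQ : Q.PosDef) (hR : R.PosDef) (hSigma0 : Sigma0.PosDef)
    (hY : ∀ i, (Y i).PosDef) (g : ℕ → Fin m → Bool) (k : ℕ) :
    patternCov A Sigma0 Q C R Y g k ≤ measUpdate (stack C) (R + silentNoise Y fun _ => true)
      ((riccati A (stack C) Q (R + silentNoise Y fun _ => true))^[k] Sigma0) := by
  have hW := fun d => silentNoise_posDef hR hY d
  induction k with
  | zero =>
    exact measUpdate_mono (hW _) (hW _) hSigma0.posSemidef hSigma0.posSemidef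
      (add_le_add_right (silentNoise_le hY _) _) le_rfl
  | succ k ih =>
    have h1 := iterate_riccati_posSemidef (A := A) (C := stack C) hQ (hW fun _ => true)
      hSigma0.posSemidef k
    have h2 := patternCov_posSemidef (A := A) (C := C) hQ hR hSigma0 hY g k
    have h3 := measUpdate_posSemidef (C := stack C) (hW fun _ => true) h1
    rw [patternCov, Function.iterate_succ_apply', riccati_eq]
    refine measUpdate_mono (hW _) (hW _) ((conj_posSemidef h2).add hQ.posSemidef)
      ((conj_posSemidef h3).add hQ.posSemidef) (add_le_add_right (silentNoise_le hY _) _)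
      (add_le_add_left ?_ _)
    rw [Matrix.le_iff] at ih ⊢
    have h4 := conj_posSemidef (A := A) ih
    rwa [Matrix.mul_sub, Matrix.sub_mul] at h4

/-- After a window of silence the error covariance dominates the Riccati iterates started
from zero. -/
lemma le_patternCov (hQ : Q.PosDef) (hR : R.PosDef) (hSigma0 : Sigma0.PosDef)
    (hY : ∀ i, (Y i).PosDef) {g : ℕ → Fin m → Bool} {l : ℕ} (N : ℕ)
    (hg : ∀ j, l ≤ j → j ≤ l + N → g j = fun _ => true) :
    measUpdate (stack C) (R + silentNoise Y fun _ => true)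
        ((riccati A (stack C) Q (R + silentNoise Y fun _ => true))^[N] 0)
      ≤ patternCov A Sigma0 Q C R Y g (l + N) := by
  have hW := silentNoise_posDef hR hY fun _ => true
  induction N with
  | zero =>
    -- Whatever happened before time `l`, the covariance entering the update is at least `0`.
    have hg0 := hg l le_rfl (by omega)
    rw [add_zero]
    cases l with
    | zero =>
      rw [patternCov, hg0]
      exact measUpdate_mono hW hW .zero hSigma0.posSemidef le_rfl hSigma0.posSemidef.nonneg
    | succ l =>
      have h2 := (conj_posSemidef (A := A) (patternCov_posSemidef (A := A) (C := C) hQ hR hSigma0 hY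
        g l)).add hQ.posSemidef
      rw [patternCov, hg0]
      exact measUpdate_mono hW hW .zero h2 le_rfl h2.nonneg
  | succ N ih =>
    have ih := ih fun j h1 h2 => hg j h1 (by omega)
    have h1 := iterate_riccati_posSemidef (A := A) (C := stack C) hQ hW .zero N
    have h2 := patternCov_posSemidef (A := A) (C := C) hQ hR hSigma0 hY g (l + N)
    have h3 := measUpdate_posSemidef (C := stack C) hW h1
    rw [← add_assoc, patternCov, hg _ (by omega) (by omega), Function.iterate_succ_apply',
      riccati_eq]
    refine measUpdate_mono hW hW ((conj_posSemidef h3).add hQ.posSemidef)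
      ((conj_posSemidef h2).add hQ.posSemidef) le_rfl (add_le_add_left ?_ _)
    rw [Matrix.le_iff] at ih ⊢
    have h4 := conj_posSemidef (A := A) ih
    rwa [Matrix.mul_sub, Matrix.sub_mul] at h4

end Bounds

end EventTrigger

end

/-! ### The asymptotic bounds -/

theorem corollary1 {Ω : Type*} [MeasurableSpace Ω] (μ : Measure Ω) [IsProbabilityMeasure μ]
    {n m : ℕ} {s : Fin m → ℕ}
    -- system matrices, noise covariances and trigger parameters
    (A : Matrix (Fin n) (Fin n) ℝ) (hA : EventTrigger.SchurStable A)
    (C : (i : Fin m) → Matrix (Fin (s i)) (Fin n) ℝ)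
    (Q : Matrix (Fin n) (Fin n) ℝ) (hQ : Q.PosDef)
    (R : Matrix ((i : Fin m) × Fin (s i)) ((i : Fin m) × Fin (s i)) ℝ) (hR : R.PosDef)
    (Sigma0 : Matrix (Fin n) (Fin n) ℝ) (hSigma0 : Sigma0.PosDef)
    (Y : (i : Fin m) → Matrix (Fin (s i)) (Fin (s i)) ℝ) (hY : ∀ i, (Y i).PosDef)
    -- initial state, process noise, measurement noise and trigger variables
    (x₀ : Ω → EuclideanSpace ℝ (Fin n)) (w : ℕ → Ω → EuclideanSpace ℝ (Fin n))
    (v : ℕ → Ω → EuclideanSpace ℝ ((i : Fin m) × Fin (s i))) (ζ : ℕ → Fin m → Ω → ℝ)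
    (hx₀m : Measurable x₀) (hwm : ∀ k, Measurable (w k)) (hvm : ∀ k, Measurable (v k))
    (hζm : ∀ k i, Measurable (ζ k i))
    (hx₀ : μ.map x₀ = multivariateGaussian 0 Sigma0)
    (hw : ∀ k, μ.map (w k) = multivariateGaussian 0 Q)
    (hv : ∀ k, μ.map (v k) = multivariateGaussian 0 R)
    (hζ : ∀ k i, μ.map (ζ k i) = (volume : Measure ℝ).restrict (Set.Icc 0 1))
    (hindep : iIndep (EventTrigger.sourceSigma x₀ w v ζ) μ) :
    -- the Riccati equation has a unique positive semidefinite solution `Xbar`, and it is positive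
    -- definite
    ∃ Xbar : Matrix (Fin n) (Fin n) ℝ,
      Xbar.PosDef ∧
      EventTrigger.riccati A (EventTrigger.stack C) Q (R + (Matrix.blockDiagonal' Y)⁻¹) Xbar
        = Xbar ∧
      (∀ X : Matrix (Fin n) (Fin n) ℝ, X.PosSemidef →
        EventTrigger.riccati A (EventTrigger.stack C) Q (R + (Matrix.blockDiagonal' Y)⁻¹) X = X →
        X = Xbar) ∧
      -- the asymptotic bounds in terms of `Pbar`
      ∀ Pbar : Matrix (Fin n) (Fin n) ℝ,
        Pbar = EventTrigger.measUpdate (EventTrigger.stack C)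
          (R + (Matrix.blockDiagonal' Y)⁻¹) Xbar →
        (∀ ε : ℝ, 0 < ε → ∃ N : ℕ, ∀ᵐ ω ∂μ, ∀ k, N ≤ k →
          EventTrigger.errCov μ A C Y x₀ w v ζ k ω ≤ Pbar + ε • 1) ∧
        (∀ ε : ℝ, 0 < ε → ∀ᵐ ω ∂μ, ∃ᶠ k in atTop,
          Pbar - ε • 1 ≤ EventTrigger.errCov μ A C Y x₀ w v ζ k ω) := by
  open EventTrigger in
  have h : NoiseModel μ Sigma0 Q R x₀ w v ζ :=
    ⟨hQ, hR, hSigma0, hx₀m, hwm, hvm, hζm, hx₀, hw, hv, hζ, hindep⟩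
  rw [← silentNoise_true hY]
  have hW := silentNoise_posDef hR hY fun _ => true
  obtain ⟨X, hX, hfix, hlim⟩ := exists_riccati_fixedPoint (C := stack C) hA hQ hW
  have hcov := ae_all_iff.2 fun k => h.errCov_eq (A := A) (C := C) hY k
  refine ⟨X, hX, hfix, fun X' hX' hfix' => ?_, ?_⟩
  -- Started at a fixed point the iteration is constant, and attraction identifies it with `X`.
  · have h1 := hlim X' hX'
    simp only [Function.iterate_fixed hfix'] at h1
    exact tendsto_nhds_unique tendsto_const_nhds h1
  · rintro _ rfl
    have happrox : ∀ (X₀ : Matrix (Fin n) (Fin n) ℝ), X₀.PosSemidef → ∀ ε : ℝ, 0 < ε →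
        ∃ N, ∀ k, N ≤ k → _ := fun X₀ hX₀ ε hε => eventually_atTop.1
      (eventually_le_add_smul_one
        (fun k => measUpdate_transpose hW (iterate_riccati_posSemidef hQ hW hX₀ k))
        (measUpdate_transpose hW hX.posSemidef)
        (tendsto_measUpdate (C := stack C) hW hX.posSemidef (hlim X₀ hX₀)) hε)
    constructor
    · intro ε hε
      -- `N` comes from the all-silent iteration alone, so it does not depend on `ω`.
      obtain ⟨N, hN⟩ := happrox Sigma0 hSigma0.posSemidef ε hε
      refine ⟨N, ?_⟩
      filter_upwards [hcov] with ω hω k hk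
      rw [hω k]
      exact (patternCov_le hQ hR hSigma0 hY _ k).trans (hN k hk).1
    · intro ε hε
      obtain ⟨N, hN⟩ := happrox 0 .zero ε hε
      -- Windows of length `N + 1`: `le_patternCov` with `N` steps needs silence at the times `l, …,
      -- l + N`.
      filter_upwards [hcov, ae_all_iff.2 fun L =>
        h.ae_exists_silent_window (A := A) (C := C) hA hY (N + 1) L] with ω hω hsil
      refine frequently_atTop.2 fun L => ?_
      obtain ⟨k, hk, hwin⟩ := hsil L
      refine ⟨k * (N + 1) + N, by nlinarith, ?_⟩
      rw [hω]
      exact (hN N le_rfl).2.trans (le_patternCov hQ hR hSigma0 hY N fun j h1 h2 =>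
        hwin j h1 (by omega))
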